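/- Let $k\ge 0$, $Z>0$, $R>0$ with $k\neq m\pi/Z$ for all integers $m\ge 1$. For $m\ge1$ put $k_m=\sqrt{k^2-m^2\pi^2/Z^2}$ if $k>m\pi/Z$ and $k_m=i\sqrt{m^2\pi^2/Z^2-k^2}$ otherwise, and let $\kappa=\min_{m\ge1}|k_m|$. For $\chi_0>0$ let $$\chi(r)=\begin{cases}0,& r\le R,\\ \chi_0(r-R)^2,& r>R,\end{cases}\qquad F(r)=r+(1+i)\chi(r),\qquad \alpha=F',\qquad \beta(r)=F(r)/r .$$ For $\rho\ge 2R$ let $d=\rho-R$, $\Omega_{\mathrm{pml}}=(R,\rho)\times(0,Z)$ (coordinates $(r,z)$) and $\Gamma_R=\{R\}\times(0,Z)$. Let $H^{1/2}_0(\Gamma_R)$ be the space of all complex $\eta\in L^2(0,Z)$ with sine series $\eta=\sum_{m\ge1}\eta_m\sin(m\pi z/Z)$ such that $\|\eta\|_{H^{1/2}(\Gamma_R)}^2:=\sum_{m\ge1}m|\eta_m|^2<\infty$. For $\eta\in H^{1/2}_0(\Gamma_R)$ consider the Dirichlet problem $$\frac{r\beta}{\alpha}\frac{\partial}{\partial r}\Big(\frac{1}{r\alpha\beta}\frac{\partial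 w}{\partial r}\Big)+\frac{\partial^2 w}{\partial z^2}+k^2w=0\ \text{ in }\Omega_{\mathrm{pml}},\qquad w=\eta\ \text{ on }\Gamma_R,\qquad w=0\ \text{ on }\partial\Omega_{\mathrm{pml}}\setminus\Gamma_R .$$ A solution in $H^1(\Omega_{\mathrm{pml}})$ is a complex-valued $w\in H^1(\Omega_{\mathrm{pml}})$ that takes these boundary values in the sense of traces and satisfies $$\int_{\Omega_{\mathrm{pml}}}\frac1{r\beta}\Big(\frac1\alpha\,\frac{\partial w}{\partial r}\frac{\partial\bar v}{\partial r}+\alpha\,\frac{\partial w}{\partial z}\frac{\partial\bar v}{\partial z}-\alpha k^2w\bar v\Big)\,dr\,dz=0\qquad\text{for all } v\in H^1_0(\Omega_{\mathrm{pml}}).$$ **Theorem.** There is a constant $C>0$, depending only on $k$, $Z$ and $R$ (in particular independent of $\chi_0$, $\rho$ and $\eta$), such that for all $\chi_0>0$ with $\kappa\chi_0R\ge1$, all $\rho\ge2R$ and all $\eta\in H^{1/2}_0(\Gamma_R)$ the problem has a unique solution $w\in H^1(\Omega_{\mathrm{pml}})$, and $$\|w\|_{H^1(\Omega_{\mathrm{pml}})}\le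 C\,d^6\,|\alpha(\rho)|^4\,|\beta(\rho)|^2\,\|\eta\|_{H^{1/2}(\Gamma_R)} .$$ Here $\|w\|_{H^1(\Omega_{\mathrm{pml}})}^2=\int_{\Omega_{\mathrm{pml}}}\big(|w|^2+|\partial_rw|^2+|\partial_zw|^2\big)\,dr\,dz$. -/

import Mathlib

open MeasureTheory Set Filter Topology
open scoped ContDiff

namespace PML

/-! ### Complex stretching of the radial coordinate -/

/-- The profile `χ`: `0` for `r ≤ R` and `χ₀ (r - R)²` for `r > R`. -/
noncomputable def chi (χ₀ R r : ℝ) : ℝ := if r ≤ R then 0 else χ₀ * (r - R) ^ 2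

/-- The stretched coordinate `F(r) = r + (1 + i) χ(r)`. -/
noncomputable def stretch (χ₀ R r : ℝ) : ℂ := (r : ℂ) + (1 + Complex.I) * (chi χ₀ R r : ℂ)

/-- `α = F'`. -/
noncomputable def alpha (χ₀ R r : ℝ) : ℂ := deriv (stretch χ₀ R) r

/-- `β(r) = F(r) / r`. -/
noncomputable def beta (χ₀ R r : ℝ) : ℂ := stretch χ₀ R r / (r : ℂ)

/-- The modal wave number `k_m`: the nonnegative square root of `k² - m²π²/Z²` if
`k > mπ/Z`, and `i` times the nonnegative square root of `m²π²/Z² - k²` otherwise. -/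
noncomputable def modeNumber (k Z : ℝ) (m : ℕ) : ℂ :=
  if m * Real.pi / Z < k then (Real.sqrt (k ^ 2 - m ^ 2 * Real.pi ^ 2 / Z ^ 2) : ℂ)
  else Complex.I * (Real.sqrt (m ^ 2 * Real.pi ^ 2 / Z ^ 2 - k ^ 2) : ℂ)

/-- `κ = min_{m ≥ 1} |k_m|`. -/
noncomputable def kappa (k Z : ℝ) : ℝ := ⨅ m : ℕ+, ‖modeNumber k Z m‖

/-! ### The space `H¹` of an open set of the `(r, z)`-plane -/

/-- `g` is the weak derivative of `u` in the direction `e` on `Ω`. -/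
def IsWeakDeriv (Ω : Set (ℝ × ℝ)) (e : ℝ × ℝ) (u g : ℝ × ℝ → ℂ) : Prop :=
  ∀ φ : ℝ × ℝ → ℂ, ContDiff ℝ ∞ φ → HasCompactSupport φ → tsupport φ ⊆ Ω →
    ∫ p in Ω, u p * fderiv ℝ φ p e = -∫ p in Ω, g p * φ p

/-- An element of the complex Sobolev space `H¹(Ω)`: a class in `L²(Ω)` together with its two
weak partial derivatives (which it determines when `Ω` is open), both in `L²(Ω)`. -/
structure H1 (Ω : Set (ℝ × ℝ)) where
  val : Lp ℂ 2 (volume.restrict Ω)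
  dr : Lp ℂ 2 (volume.restrict Ω)
  dz : Lp ℂ 2 (volume.restrict Ω)
  weak_dr : IsWeakDeriv Ω (1, 0) val dr
  weak_dz : IsWeakDeriv Ω (0, 1) val dz

/-- The `H¹` norm (without weight). -/
noncomputable def H1.norm {Ω : Set (ℝ × ℝ)} (w : H1 Ω) : ℝ :=
  Real.sqrt (‖w.val‖ ^ 2 + ‖w.dr‖ ^ 2 + ‖w.dz‖ ^ 2)

/-- `w` has trace `g` on the boundary segment parametrized by arc length as `γ` on `I`: some
sequence of `C¹` functions converges to `w` in `H¹(Ω)` and its restrictions to the segment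
converge to `g` in `L²`. -/
def H1.HasTrace {Ω : Set (ℝ × ℝ)} (w : H1 Ω) (γ : ℝ → ℝ × ℝ) (I : Set ℝ) (g : ℝ → ℂ) : Prop :=
  ∃ φ : ℕ → ℝ × ℝ → ℂ, (∀ n, ContDiff ℝ 1 (φ n)) ∧
    Tendsto (fun n => eLpNorm (fun p => φ n p - w.val p) 2 (volume.restrict Ω)) atTop (𝓝 0) ∧
    Tendsto (fun n => eLpNorm (fun p => fderiv ℝ (φ n) p (1, 0) - w.dr p) 2
      (volume.restrict Ω)) atTop (𝓝 0) ∧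
    Tendsto (fun n => eLpNorm (fun p => fderiv ℝ (φ n) p (0, 1) - w.dz p) 2
      (volume.restrict Ω)) atTop (𝓝 0) ∧
    Tendsto (fun n => eLpNorm (fun t => φ n (γ t) - g t) 2 (volume.restrict I)) atTop (𝓝 0)

/-! ### Boundary data on `Γ_R = {R} × (0, Z)` -/

/-- The Fourier coefficient of `sin (mπz/Z)` in the sine series of `η` on `(0, Z)`. -/
noncomputable def sineCoeff (Z : ℝ) (η : ℝ → ℂ) (m : ℕ) : ℂ :=
  (2 / Z : ℂ) * ∫ z in Ioo 0 Z, η z * (Real.sin (m * Real.pi * z / Z) : ℂ)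

/-- The trace space `H₀^{1/2}(Γ_R)`: square integrable `η = ∑ η_m sin (mπz/Z)` with
`∑ m |η_m|² < ∞`. -/
def HalfSpace (Z : ℝ) : Set (Lp ℂ 2 (volume.restrict (Ioo (0 : ℝ) Z))) :=
  {η | Summable fun m : ℕ => (m : ℝ) * ‖sineCoeff Z η m‖ ^ 2}

/-- The norm `(∑ m |η_m|²)^{1/2}`. -/
noncomputable def halfNorm (Z : ℝ) (η : Lp ℂ 2 (volume.restrict (Ioo (0 : ℝ) Z))) : ℝ :=
  Real.sqrt (∑' m : ℕ, (m : ℝ) * ‖sineCoeff Z η m‖ ^ 2)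

/-! ### The Dirichlet problem in the layer -/

/-- The layer `R < r < ρ`, `0 < z < Z`. -/
def layer (R ρ Z : ℝ) : Set (ℝ × ℝ) := Ioo R ρ ×ˢ Ioo 0 Z

/-- `w = η` on the side `r = R` of the layer, and `w = 0` on the three other sides. -/
def HasDirichletData {R ρ Z : ℝ} (w : H1 (layer R ρ Z)) (η : ℝ → ℂ) : Prop :=
  w.HasTrace (fun z => (R, z)) (Ioo 0 Z) η ∧
  w.HasTrace (fun z => (ρ, z)) (Ioo 0 Z) (fun _ => 0) ∧
  w.HasTrace (fun r => (r, 0)) (Ioo R ρ) (fun _ => 0) ∧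
  w.HasTrace (fun r => (r, Z)) (Ioo R ρ) (fun _ => 0)

/-- The sesquilinear form of the equation
`(rβ/α) ∂_r ((rαβ)⁻¹ ∂_r w) + ∂_z² w + k² w = 0`, which is multiplied by `α / (rβ)` and by the
conjugate of the test function and integrated by parts. -/
noncomputable def form (k χ₀ : ℝ) {R ρ Z : ℝ} (w v : H1 (layer R ρ Z)) : ℂ :=
  ∫ p in layer R ρ Z, 1 / ((p.1 : ℂ) * beta χ₀ R p.1) *
    ((alpha χ₀ R p.1)⁻¹ * w.dr p * star (v.dr p)
      + alpha χ₀ R p.1 * w.dz p * star (v.dz p)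
      - alpha χ₀ R p.1 * (k : ℂ) ^ 2 * w.val p * star (v.val p))

/-- `w ∈ H¹` is a (weak) solution of the Dirichlet problem in the layer with data `η`: it
satisfies the equation, tested with every `H¹` function of zero trace, and takes the data. -/
def IsSolution (k χ₀ : ℝ) {R ρ Z : ℝ} (η : ℝ → ℂ) (w : H1 (layer R ρ Z)) : Prop :=
  (∀ v : H1 (layer R ρ Z), HasDirichletData v (fun _ => 0) → form k χ₀ w v = 0) ∧
  HasDirichletData w η

end PML

namespace PML

/-! ### Linear differential equations on a compact interval -/

section LinearODE

variable {E : Type*} [NormedAddCommGroup E] [NormedSpace ℝ E] [CompleteSpace E]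

/-! Separation of variables. Write `F` for `stretch`, `G = Fα` for `fluxCoeff`, `H = α/F` for
`massCoeff`, `l = m²π²/Z² - k²` for `sep`, `d = ρ - R` and `A = 1 + χ₀d`. Since `rβ = F`, the
coefficient `w` of `sin (mπz/Z)` satisfies the first order system `w' = G p`, `p' = l H w` with the
flux `p = w'/G` (`IsMode`).

Everything rests on an a priori bound for one mode with `w(ρ) = 0` (`exists_mode_bound`).
Integrating `(p w̄)'` gives `l∫H|w|² + ∫Ḡ|p|² = -p(R) w̄(R)` (`IsMode.energy`). For the finitely
many modes with `l ≤ 0` the real part is indefinite, but `Im G` and `Im H` are nonnegative, so the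
imaginary part controls `∫ Im G |p|²`. The weight `Im G` vanishes at `R` like `χ₀R(r-R)`; Hardy's
inequality compensates for this, and `κχ₀R ≥ 1` removes `χ₀` (`IsMode.bound_of_neg`). For `l > 0`
the real part of the identity times `1 + i/2` is coercive, uniformly in `l` (`IsMode.bound_of_pos`).

In both cases the right-hand side contains the unknown flux `p(R)`. It is bounded by the energy
itself, by averaging the flux equation over a short interval at `R` (`IsMode.sq_flux_le`), and the
resulting inequality `S ≤ C √S |w(R)|` closes. For large `m` an interval of length of order `1/m`
yields the factor `m` of the `H^{1/2}` norm.

The bound excludes nontrivial modes with zero data, so shooting solves every modal Dirichlet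
problem, also with a source (`exists_isMode_dirichlet`). The series of modes with the sine
coefficients of `η` converges in `H¹` by orthogonality and solves the problem (`exists_isSolution`).
Uniqueness is by duality: testing with modes that have a source shows that `η` determines all
integrals of `w` against `f(r) sin (mπz/Z)`, which determine `w` by completeness of the sines
(`IsSolution.unique`). Finally `A ≤ |α(ρ)|` and `A ≤ 2|β(ρ)|` turn the factor `d⁶A⁶` into the stated
one. -/

theorem exists_integral_solution_of_continuous {A : ℝ → E →L[ℝ] E} {g : ℝ → E} {a b : ℝ}
    (hab : a ≤ b) (hA : Continuous A) (hg : Continuous g) {K : ℝ} (hK : 0 ≤ K)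
    (hAK : ∀ t, ‖A t‖ ≤ K) (x₀ : E) :
    ∃ y : ℝ → E, Continuous y ∧ ∀ t ∈ Icc a b, y t = x₀ + ∫ s in a..t, (A s (y s) + g s) := by
  -- Picard iteration for `z(t) = exp(-L(t - a)) y(t)`: in this exponentially weighted norm the
  -- integral operator has Lipschitz constant at most `K/L ≤ 1/2` on the whole interval. The summand
  -- `1` keeps `L` positive when `K = 0`.
  set L : ℝ := 2 * (K + 1) with hL
  have hLpos : 0 < L := by positivity
  let ext : C(Icc a b, E) → ℝ → E := fun z s => z (projIcc a b hab s)
  have hext : ∀ z, Continuous (ext z) := fun z => z.continuous.comp continuous_projIcc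
  let h : C(Icc a b, E) → ℝ → E := fun z s => Real.exp (L * (s - a)) • A s (ext z s) + g s
  have hh : ∀ z, Continuous (h z) := fun z =>
    ((by fun_prop : Continuous fun s : ℝ => Real.exp (L * (s - a))).smul
      (hA.clm_apply (hext z))).add hg
  have hprim : ∀ z, Continuous fun t => ∫ s in a..t, h z s := fun z =>
    intervalIntegral.continuous_primitive (fun _ _ => (hh z).intervalIntegrable _ _) a
  let T : C(Icc a b, E) → C(Icc a b, E) := fun z =>
    ⟨fun t => Real.exp (-(L * (t - a))) • (x₀ + ∫ s in a..(t : ℝ), h z s), by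
      refine Continuous.smul (by fun_prop) (continuous_const.add ?_)
      exact (hprim z).comp continuous_subtype_val⟩
  have hT : ContractingWith (1 / 2 : NNReal) T := by
    refine ⟨by norm_num, LipschitzWith.of_dist_le_mul fun z₁ z₂ => ?_⟩
    rw [ContinuousMap.dist_le (by positivity)]
    intro t
    have ht := t.2
    have hD : ∀ s, ‖ext z₁ s - ext z₂ s‖ ≤ dist z₁ z₂ := fun s => by
      rw [← dist_eq_norm]; exact ContinuousMap.dist_apply_le_dist _
    have e1 : T z₁ t - T z₂ t = Real.exp (-(L * (t - a))) •
        ∫ s in a..(t : ℝ), (h z₁ s - h z₂ s) := by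
      rw [intervalIntegral.integral_sub ((hh z₁).intervalIntegrable _ _)
        ((hh z₂).intervalIntegrable _ _)]
      simp only [T, ContinuousMap.coe_mk, ← smul_sub]
      congr 1; abel
    have e2 : ‖∫ s in a..(t : ℝ), (h z₁ s - h z₂ s)‖
        ≤ ∫ s in a..(t : ℝ), Real.exp (L * (s - a)) * (K * dist z₁ z₂) := by
      refine intervalIntegral.norm_integral_le_of_norm_le ht.1
        (ae_of_all _ fun s _ => ?_) (Continuous.intervalIntegrable (by fun_prop) _ _)
      have : h z₁ s - h z₂ s = Real.exp (L * (s - a)) • A s (ext z₁ s - ext z₂ s) := by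
        simp only [h, map_sub, smul_sub]; abel
      rw [this, norm_smul, Real.norm_of_nonneg (Real.exp_pos _).le]
      gcongr
      exact ((A s).le_opNorm _).trans (mul_le_mul (hAK s) (hD s) (norm_nonneg _) hK)
    have e3 : ∫ s in a..(t : ℝ), Real.exp (L * (s - a)) * (K * dist z₁ z₂)
        = (Real.exp (L * (t - a)) - 1) / L * (K * dist z₁ z₂) := by
      rw [intervalIntegral.integral_mul_const]
      congr 1
      have : ∀ s ∈ uIcc a (t : ℝ), HasDerivAt (fun s => Real.exp (L * (s - a)) / L)
          (Real.exp (L * (s - a))) s := fun s _ => by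
        have := ((((hasDerivAt_id s).sub_const a).const_mul L).exp).div_const L
        exact this.congr_deriv (by rw [mul_one, mul_div_cancel_right₀ _ hLpos.ne']; rfl)
      rw [intervalIntegral.integral_eq_sub_of_hasDerivAt this
        (Continuous.intervalIntegrable (by fun_prop) _ _)]
      simp; ring
    rw [dist_eq_norm, e1, norm_smul, Real.norm_of_nonneg (Real.exp_pos _).le]
    calc _ ≤ Real.exp (-(L * (t - a))) *
          ((Real.exp (L * (t - a)) - 1) / L * (K * dist z₁ z₂)) := by
            gcongr; exact e2.trans e3.le
      _ = (1 - Real.exp (-(L * (t - a)))) * (K / L * dist z₁ z₂) := by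
            have : Real.exp (-(L * (t - a))) * Real.exp (L * (t - a)) = 1 := by
              rw [← Real.exp_add]; simp
            linear_combination (K * dist z₁ z₂ / L) * this
      _ ≤ 1 * (1 / 2 * dist z₁ z₂) := by
            have h1 : K / L ≤ 1 / 2 := by rw [div_le_iff₀ hLpos, hL]; linarith
            have h2 := Real.exp_pos (-(L * ((t : ℝ) - a)))
            have h3 : 0 ≤ K / L * dist z₁ z₂ := by positivity
            exact mul_le_mul (by linarith)
              (mul_le_mul_of_nonneg_right h1 dist_nonneg) h3 zero_le_one
      _ = _ := by push_cast; ring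
  set z := ContractingWith.fixedPoint T hT with hz
  have hfix : T z = z := hT.fixedPoint_isFixedPt
  refine ⟨fun s => Real.exp (L * (s - a)) • ext z s,
    Continuous.smul (by fun_prop) (hext z), fun t ht => ?_⟩
  have h1 : ext z t = Real.exp (-(L * (t - a))) • (x₀ + ∫ s in a..t, h z s) := by
    have : ext z t = z ⟨t, ht⟩ := by simp only [ext, projIcc_of_mem hab ht]
    rw [this]
    conv_lhs => rw [← hfix]
    rfl
  simp only [h1, smul_smul, ← Real.exp_add]
  simp only [add_neg_cancel, Real.exp_zero, one_smul, h, ← map_smul]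

/-- A linear initial value problem with continuous coefficients on a compact interval has a
solution, which extends to a `C¹` function on the line. -/
theorem exists_contDiff_linear_solution {A : ℝ → E →L[ℝ] E} {g : ℝ → E} {a b : ℝ}
    (hab : a ≤ b) (hA : ContinuousOn A (Icc a b)) (hg : ContinuousOn g (Icc a b)) (x₀ : E) :
    ∃ y : ℝ → E, ContDiff ℝ 1 y ∧ y a = x₀ ∧
      ∀ t ∈ Icc a b, HasDerivAt y (A t (y t) + g t) t := by
  -- Outside `[a, b]` the coefficients are frozen at their endpoint values, which makes them
  -- continuous and bounded on the line.
  let c : ℝ → ℝ := fun s => projIcc a b hab s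
  have hc : Continuous c := continuous_subtype_val.comp continuous_projIcc
  have hcm : ∀ s, c s ∈ Icc a b := fun s => (projIcc a b hab s).2
  have hci : ∀ s ∈ Icc a b, c s = s := fun s hs => by simp only [c, projIcc_of_mem hab hs]
  have hA' : Continuous (A ∘ c) := hA.comp_continuous hc hcm
  have hg' : Continuous (g ∘ c) := hg.comp_continuous hc hcm
  obtain ⟨K, hK⟩ := isCompact_Icc.exists_bound_of_continuousOn hA
  obtain ⟨y, hy, hyeq⟩ := exists_integral_solution_of_continuous hab hA' hg' (K := max K 0)
    (le_max_right _ _) (fun t => (hK _ (hcm t)).trans (le_max_left _ _)) x₀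
  let h : ℝ → E := fun s => (A ∘ c) s (y s) + (g ∘ c) s
  have hh : Continuous h := (hA'.clm_apply hy).add hg'
  have hd : ∀ t, HasDerivAt (fun t => x₀ + ∫ s in a..t, h s) (h t) t := fun t =>
    (intervalIntegral.integral_hasDerivAt_right (hh.intervalIntegrable _ _)
      (hh.stronglyMeasurableAtFilter _ _) hh.continuousAt).const_add x₀
  -- The integral is used in place of `y`: it agrees with `y` on `[a, b]` and is `C¹` everywhere.
  refine ⟨fun t => x₀ + ∫ s in a..t, h s, ?_, by simp, fun t ht => ?_⟩
  · rw [contDiff_one_iff_deriv]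
    refine ⟨fun t => (hd t).differentiableAt, ?_⟩
    rw [funext fun t => (hd t).deriv]
    exact hh
  · have := hd t
    simp only [h, Function.comp, hci t ht, hyeq t ht] at this ⊢
    exact this

end LinearODE

/-! ### Bounds for the stretched coefficients -/

section Coefficients

variable {χ₀ R ρ r : ℝ}

theorem chi_eq_max (χ₀ R r : ℝ) : chi χ₀ R r = χ₀ * (max (r - R) 0) ^ 2 := by
  unfold chi
  split_ifs with h
  · rw [max_eq_right (by linarith)]; simp
  · rw [max_eq_left (by linarith)]

theorem hasDerivAt_max_sq (x : ℝ) :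
    HasDerivAt (fun x : ℝ => (max x 0) ^ 2) (2 * max x 0) x := by
  rcases lt_trichotomy x 0 with h | h | h
  · rw [max_eq_right h.le, mul_zero]
    refine (hasDerivAt_const x (0 : ℝ)).congr_of_eventuallyEq ?_
    filter_upwards [eventually_lt_nhds h] with y hy
    rw [max_eq_right hy.le]; simp
  · subst h
    rw [max_self, mul_zero, hasDerivAt_iff_isLittleO]
    simp only [max_self, sub_zero, smul_zero, ne_eq, OfNat.ofNat_ne_zero, not_false_eq_true,
      zero_pow]
    refine Asymptotics.IsBigO.trans_isLittleO (g := fun x : ℝ => x ^ 2) ?_ ?_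
    · refine Asymptotics.IsBigO.of_bound 1 (Eventually.of_forall fun x => ?_)
      rw [Real.norm_of_nonneg (by positivity), Real.norm_of_nonneg (by positivity), one_mul,
        sq_le_sq]
      rcases le_total x 0 with hx | hx
      · rw [max_eq_right hx]; simp
      · rw [max_eq_left hx]
    · simpa using Asymptotics.isLittleO_pow_pow (𝕜 := ℝ) (m := 1) (n := 2) (by norm_num)
  · rw [max_eq_left h.le]
    refine ((hasDerivAt_pow 2 x).congr_of_eventuallyEq ?_).congr_deriv (by simp)
    filter_upwards [eventually_gt_nhds h] with y hy
    rw [max_eq_left hy.le]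

/-- The quadratic profile is `C¹` across `r = R`, so `alpha`, defined by a two-sided derivative, has
a single formula valid on both sides and at `R` itself. -/
theorem hasDerivAt_stretch (χ₀ R r : ℝ) :
    HasDerivAt (stretch χ₀ R)
      (1 + (1 + Complex.I) * ((2 * χ₀ * max (r - R) 0 : ℝ) : ℂ)) r := by
  have h1 : HasDerivAt (chi χ₀ R) (2 * χ₀ * max (r - R) 0) r := by
    rw [funext (chi_eq_max χ₀ R)]
    refine (((hasDerivAt_max_sq (r - R)).comp r
      ((hasDerivAt_id r).sub_const R)).const_mul χ₀).congr_deriv ?_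
    ring
  exact (Complex.ofRealCLM.hasDerivAt (x := r)).add
    (h1.ofReal_comp.const_mul (1 + Complex.I))

theorem alpha_eq (χ₀ R r : ℝ) :
    alpha χ₀ R r = 1 + (1 + Complex.I) * ((2 * χ₀ * max (r - R) 0 : ℝ) : ℂ) :=
  (hasDerivAt_stretch χ₀ R r).deriv

theorem continuous_alpha (χ₀ R : ℝ) : Continuous (alpha χ₀ R) := by
  rw [funext (alpha_eq χ₀ R)]; fun_prop

theorem continuous_stretch (χ₀ R : ℝ) : Continuous (stretch χ₀ R) :=
  continuous_iff_continuousAt.2 fun r => (hasDerivAt_stretch χ₀ R r).continuousAt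

theorem alpha_re (h : R ≤ r) : (alpha χ₀ R r).re = 1 + 2 * χ₀ * (r - R) := by
  rw [alpha_eq, max_eq_left (by linarith)]
  simp

theorem alpha_im (h : R ≤ r) : (alpha χ₀ R r).im = 2 * χ₀ * (r - R) := by
  rw [alpha_eq, max_eq_left (by linarith)]
  simp

theorem stretch_re (h : R ≤ r) : (stretch χ₀ R r).re = r + χ₀ * (r - R) ^ 2 := by
  rw [stretch, chi_eq_max, max_eq_left (by linarith)]
  generalize χ₀ * (r - R) ^ 2 = x
  simp

theorem stretch_im (h : R ≤ r) : (stretch χ₀ R r).im = χ₀ * (r - R) ^ 2 := by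
  rw [stretch, chi_eq_max, max_eq_left (by linarith)]
  generalize χ₀ * (r - R) ^ 2 = x
  simp

/-- The coefficient `F α` relating the derivative of a mode to its flux. -/
noncomputable def fluxCoeff (χ₀ R r : ℝ) : ℂ := stretch χ₀ R r * alpha χ₀ R r

/-- The coefficient `α / F` of the zeroth order term. -/
noncomputable def massCoeff (χ₀ R r : ℝ) : ℂ := alpha χ₀ R r / stretch χ₀ R r

theorem stretch_ne_zero (hχ : 0 ≤ χ₀) (hR : 0 < R) (h : R ≤ r) : stretch χ₀ R r ≠ 0 := by
  intro h0
  have := stretch_re (χ₀ := χ₀) h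
  rw [h0] at this
  simp only [Complex.zero_re] at this
  nlinarith [mul_nonneg hχ (sq_nonneg (r - R))]

theorem alpha_ne_zero (hχ : 0 ≤ χ₀) (h : R ≤ r) : alpha χ₀ R r ≠ 0 := by
  intro h0
  have := alpha_re (χ₀ := χ₀) h
  rw [h0] at this
  simp only [Complex.zero_re] at this
  nlinarith [mul_nonneg hχ (sub_nonneg.2 h)]

theorem fluxCoeff_ne_zero (hχ : 0 ≤ χ₀) (hR : 0 < R) (h : R ≤ r) : fluxCoeff χ₀ R r ≠ 0 :=
  mul_ne_zero (stretch_ne_zero hχ hR h) (alpha_ne_zero hχ h)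

theorem continuous_fluxCoeff (χ₀ R : ℝ) : Continuous (fluxCoeff χ₀ R) :=
  (continuous_stretch χ₀ R).mul (continuous_alpha χ₀ R)

theorem continuousOn_massCoeff (hχ : 0 ≤ χ₀) (hR : 0 < R) :
    ContinuousOn (massCoeff χ₀ R) (Ici R) :=
  (continuous_alpha χ₀ R).continuousOn.div (continuous_stretch χ₀ R).continuousOn
    fun _ h => stretch_ne_zero hχ hR h

/-- The terms quadratic in `χ₀` cancel because real and imaginary stretching have equal strength. -/
theorem fluxCoeff_re_nonneg (hχ : 0 ≤ χ₀) (hR : 0 < R) (h : R ≤ r) :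
    0 ≤ (fluxCoeff χ₀ R r).re := by
  rw [fluxCoeff, Complex.mul_re, alpha_re h, alpha_im h, stretch_re h, stretch_im h]
  have ht : 0 ≤ r - R := sub_nonneg.2 h
  have hr : 0 ≤ r := hR.le.trans h
  have : (r + χ₀ * (r - R) ^ 2) * (1 + 2 * χ₀ * (r - R)) -
      χ₀ * (r - R) ^ 2 * (2 * χ₀ * (r - R)) =
      r + χ₀ * (r - R) ^ 2 + 2 * χ₀ * (r - R) * r := by ring
  rw [this]; positivity

/-- Only the part of `Im (Fα)` of first order at `r = R` is kept; the rest is nonnegative. With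
`κχ₀R ≥ 1` this weight dominates `r - R` independently of `χ₀`. -/
theorem le_fluxCoeff_im (hχ : 0 ≤ χ₀) (h : R ≤ r) :
    2 * χ₀ * R * (r - R) ≤ (fluxCoeff χ₀ R r).im := by
  rw [fluxCoeff, Complex.mul_im, alpha_re h, alpha_im h, stretch_re h, stretch_im h]
  have ht : 0 ≤ r - R := sub_nonneg.2 h
  have : (r + χ₀ * (r - R) ^ 2) * (2 * χ₀ * (r - R)) +
      χ₀ * (r - R) ^ 2 * (1 + 2 * χ₀ * (r - R)) = 2 * χ₀ * R * (r - R) +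
      (3 * χ₀ * (r - R) ^ 2 + 4 * (χ₀ ^ 2 * (r - R) ^ 3)) := by ring
  rw [this]
  have : 0 ≤ 3 * χ₀ * (r - R) ^ 2 + 4 * (χ₀ ^ 2 * (r - R) ^ 3) := by positivity
  linarith

theorem fluxCoeff_im_nonneg (hχ : 0 ≤ χ₀) (hR : 0 < R) (h : R ≤ r) :
    0 ≤ (fluxCoeff χ₀ R r).im := by
  refine le_trans ?_ (le_fluxCoeff_im hχ h)
  have ht : 0 ≤ r - R := sub_nonneg.2 h
  positivity

theorem norm_le_re_add_im {z : ℂ} (h1 : 0 ≤ z.re) (h2 : 0 ≤ z.im) : ‖z‖ ≤ z.re + z.im := by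
  simpa [abs_of_nonneg h1, abs_of_nonneg h2] using Complex.norm_le_abs_re_add_abs_im z

theorem norm_alpha_le (hχ : 0 ≤ χ₀) (h : R ≤ r) :
    ‖alpha χ₀ R r‖ ≤ 1 + 4 * χ₀ * (r - R) := by
  have ht : 0 ≤ r - R := sub_nonneg.2 h
  have := norm_le_re_add_im (z := alpha χ₀ R r) (by rw [alpha_re h]; positivity)
    (by rw [alpha_im h]; positivity)
  rw [alpha_re h, alpha_im h] at this
  linarith

theorem norm_alpha_le_of_mem (hχ : 0 ≤ χ₀) (h : r ∈ Icc R ρ) :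
    ‖alpha χ₀ R r‖ ≤ 4 * (1 + χ₀ * (ρ - R)) := by
  refine (norm_alpha_le hχ h.1).trans ?_
  nlinarith [mul_le_mul_of_nonneg_left (sub_le_sub_right h.2 R) hχ]

theorem le_norm_stretch (hχ : 0 ≤ χ₀) (h : R ≤ r) : R ≤ ‖stretch χ₀ R r‖ := by
  refine le_trans ?_ (Complex.re_le_norm _)
  rw [stretch_re h]
  nlinarith [mul_nonneg hχ (sq_nonneg (r - R))]

theorem norm_stretch_le_of_mem (hχ : 0 ≤ χ₀) (hR : 0 < R) (hρ : 2 * R ≤ ρ) (h : r ∈ Icc R ρ) :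
    ‖stretch χ₀ R r‖ ≤ 2 * (ρ - R) * (1 + χ₀ * (ρ - R)) := by
  have ht : 0 ≤ r - R := sub_nonneg.2 h.1
  have hr : 0 ≤ r := hR.le.trans h.1
  have := norm_le_re_add_im (z := stretch χ₀ R r) (by rw [stretch_re h.1]; positivity)
    (by rw [stretch_im h.1]; positivity)
  rw [stretch_re h.1, stretch_im h.1] at this
  have h2 : (r - R) ^ 2 ≤ (ρ - R) ^ 2 := pow_le_pow_left₀ ht (sub_le_sub_right h.2 R) 2
  nlinarith [mul_le_mul_of_nonneg_left h2 hχ, h.2]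

theorem norm_fluxCoeff_le (hχ : 0 ≤ χ₀) (hR : 0 < R) (hρ : 2 * R ≤ ρ) (h : r ∈ Icc R ρ) :
    ‖fluxCoeff χ₀ R r‖ ≤ 8 * (ρ - R) * (1 + χ₀ * (ρ - R)) ^ 2 := by
  rw [fluxCoeff, norm_mul]
  have hd : 0 ≤ ρ - R := by linarith
  calc _ ≤ (2 * (ρ - R) * (1 + χ₀ * (ρ - R))) * (4 * (1 + χ₀ * (ρ - R))) :=
        mul_le_mul (norm_stretch_le_of_mem hχ hR hρ h) (norm_alpha_le_of_mem hχ h)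
          (norm_nonneg _) (by positivity)
    _ = _ := by ring

theorem one_le_norm_alpha (hχ : 0 ≤ χ₀) (h : R ≤ r) : 1 ≤ ‖alpha χ₀ R r‖ := by
  refine le_trans ?_ (Complex.re_le_norm _)
  rw [alpha_re h]
  nlinarith [mul_nonneg hχ (sub_nonneg.2 h)]

theorem le_norm_fluxCoeff (hχ : 0 ≤ χ₀) (hR : 0 < R) (h : R ≤ r) : R ≤ ‖fluxCoeff χ₀ R r‖ := by
  rw [fluxCoeff, norm_mul]
  nlinarith [one_le_norm_alpha hχ h, le_norm_stretch hχ h]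

theorem norm_massCoeff_le (hχ : 0 ≤ χ₀) (hR : 0 < R) (h : R ≤ r) {a : ℝ}
    (ha : ‖alpha χ₀ R r‖ ≤ a) : ‖massCoeff χ₀ R r‖ ≤ a / R := by
  rw [massCoeff, norm_div]
  exact div_le_div₀ ((norm_nonneg _).trans ha) ha hR (le_norm_stretch hχ h)

theorem norm_massCoeff_le_of_mem (hχ : 0 ≤ χ₀) (hR : 0 < R) (h : r ∈ Icc R ρ) :
    ‖massCoeff χ₀ R r‖ ≤ 4 * (1 + χ₀ * (ρ - R)) / R :=
  norm_massCoeff_le hχ hR h.1 (norm_alpha_le_of_mem hχ h)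

/-- Within distance `1/χ₀` of the interface the stretching is not felt: the bound is free of `χ₀`.
This is why the flux at `R` is estimated on a short interval only. -/
theorem norm_massCoeff_le_of_near (hχ : 0 ≤ χ₀) (hR : 0 < R) (h : R ≤ r)
    (h' : χ₀ * (r - R) ≤ 1) : ‖massCoeff χ₀ R r‖ ≤ 5 / R :=
  norm_massCoeff_le hχ hR h ((norm_alpha_le hχ h).trans (by linarith))

theorem massCoeff_re (χ₀ R r : ℝ) : (massCoeff χ₀ R r).re =
    ((alpha χ₀ R r).re * (stretch χ₀ R r).re + (alpha χ₀ R r).im * (stretch χ₀ R r).im) /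
      Complex.normSq (stretch χ₀ R r) := by
  rw [massCoeff, Complex.div_re]; ring

theorem massCoeff_im (χ₀ R r : ℝ) : (massCoeff χ₀ R r).im =
    ((alpha χ₀ R r).im * (stretch χ₀ R r).re - (alpha χ₀ R r).re * (stretch χ₀ R r).im) /
      Complex.normSq (stretch χ₀ R r) := by
  rw [massCoeff, Complex.div_im]; ring

theorem massCoeff_im_nonneg (hχ : 0 ≤ χ₀) (hR : 0 < R) (h : R ≤ r) :
    0 ≤ (massCoeff χ₀ R r).im := by
  rw [massCoeff_im, alpha_re h, alpha_im h, stretch_re h, stretch_im h]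
  refine div_nonneg ?_ (Complex.normSq_nonneg _)
  have ht : 0 ≤ r - R := sub_nonneg.2 h
  have : 2 * χ₀ * (r - R) * (r + χ₀ * (r - R) ^ 2) -
      (1 + 2 * χ₀ * (r - R)) * (χ₀ * (r - R) ^ 2) =
      2 * χ₀ * (r - R) * R + χ₀ * (r - R) ^ 2 := by ring
  rw [this]; positivity

/-- Write `F = x + iy` and `t = r - R`. Subtracting half of the imaginary part leaves `x(1 + χ₀t)`
plus nonnegative terms in the numerator, while `|F|² ≤ 2x²` and `x ≤ 2d(1 + χ₀t)`. The factors `1 +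
χ₀t` cancel, so the bound is uniform in `χ₀`; subtracting the full imaginary part would lose `χ₀t`
in that leading term. -/
theorem le_massCoeff_re_sub_im (hχ : 0 ≤ χ₀) (hR : 0 < R) (hρ : 2 * R ≤ ρ) (h : r ∈ Icc R ρ) :
    1 / (4 * (ρ - R)) ≤ (massCoeff χ₀ R r).re - (massCoeff χ₀ R r).im / 2 := by
  have hd : 0 < ρ - R := by linarith
  have ht : 0 ≤ r - R := sub_nonneg.2 h.1
  have hr : 0 < r := hR.trans_le h.1
  have hN : 0 < Complex.normSq (stretch χ₀ R r) :=
    Complex.normSq_pos.2 (stretch_ne_zero hχ hR h.1)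
  rw [massCoeff_im, massCoeff_re, div_right_comm, ← sub_div, div_le_div_iff₀ (by positivity) hN,
    Complex.normSq_apply, alpha_re h.1,
    alpha_im h.1, stretch_re h.1, stretch_im h.1]
  set t := r - R with ht'
  set x := r + χ₀ * t ^ 2 with hx
  have hx0 : 0 < x := by positivity
  have hyx : χ₀ * t ^ 2 ≤ x := by rw [hx]; linarith
  have hy0 : 0 ≤ χ₀ * t ^ 2 := by positivity
  have hxd : x ≤ 2 * (ρ - R) * (1 + χ₀ * t) := by
    have : t ≤ ρ - R := by linarith [h.2]
    have h3 : χ₀ * t * t ≤ χ₀ * t * (ρ - R) := mul_le_mul_of_nonneg_left this (by positivity)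
    have h4 : 0 ≤ χ₀ * t * (ρ - R) := by positivity
    nlinarith [h.2]
  have e1 : x * (1 + χ₀ * t) ≤ (1 + 2 * χ₀ * t) * x + 2 * χ₀ * t * (χ₀ * t ^ 2) -
      (2 * χ₀ * t * x - (1 + 2 * χ₀ * t) * (χ₀ * t ^ 2)) / 2 := by
    have : 0 ≤ 3 * χ₀ * t * (χ₀ * t ^ 2) + χ₀ * t ^ 2 / 2 := by positivity
    nlinarith
  calc 1 * (x * x + χ₀ * t ^ 2 * (χ₀ * t ^ 2)) ≤ 2 * (x * x) := by nlinarith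
    _ ≤ 2 * (x * (2 * (ρ - R) * (1 + χ₀ * t))) := by gcongr
    _ = (x * (1 + χ₀ * t)) * (4 * (ρ - R)) := by ring
    _ ≤ _ := by gcongr

theorem le_norm_alpha (hχ : 0 ≤ χ₀) (h : R ≤ ρ) : 1 + χ₀ * (ρ - R) ≤ ‖alpha χ₀ R ρ‖ := by
  refine le_trans ?_ (Complex.re_le_norm _)
  rw [alpha_re h]
  nlinarith [mul_nonneg hχ (sub_nonneg.2 h)]

/-- `Re β(ρ) = 1 + χ₀d²/ρ`, and `d ≥ ρ/2` because `ρ ≥ 2R`. -/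
theorem le_norm_beta (hχ : 0 ≤ χ₀) (hR : 0 < R) (hρ : 2 * R ≤ ρ) :
    (1 + χ₀ * (ρ - R)) / 2 ≤ ‖beta χ₀ R ρ‖ := by
  have hρ0 : 0 < ρ := by linarith
  refine le_trans ?_ (Complex.re_le_norm _)
  rw [beta, Complex.div_ofReal_re, stretch_re (by linarith), le_div_iff₀ hρ0]
  nlinarith [mul_nonneg (mul_nonneg hχ (by linarith : 0 ≤ ρ - R)) (by linarith : 0 ≤ ρ - 2 * R)]

end Coefficients

/-! ### Modes: energy identities and a priori bounds -/

/-- Cauchy–Schwarz, from the discriminant of the nonnegative quadratic `s ↦ ∫ (s f + g)²`. -/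
theorem sq_integral_mul_le {f g : ℝ → ℝ} {a b : ℝ} (hab : a ≤ b)
    (hf : ContinuousOn f (Icc a b)) (hg : ContinuousOn g (Icc a b)) :
    (∫ x in a..b, f x * g x) ^ 2 ≤ (∫ x in a..b, f x ^ 2) * ∫ x in a..b, g x ^ 2 := by
  have i1 : IntervalIntegrable (fun x => f x ^ 2) volume a b :=
    (hf.pow 2).intervalIntegrable_of_Icc hab
  have i2 : IntervalIntegrable (fun x => f x * g x) volume a b :=
    (hf.mul hg).intervalIntegrable_of_Icc hab
  have i3 : IntervalIntegrable (fun x => g x ^ 2) volume a b :=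
    (hg.pow 2).intervalIntegrable_of_Icc hab
  have key : ∀ s : ℝ, 0 ≤ (∫ x in a..b, f x ^ 2) * (s * s) + (2 * ∫ x in a..b, f x * g x) * s
      + ∫ x in a..b, g x ^ 2 := fun s => by
    have : (∫ x in a..b, f x ^ 2) * (s * s) + (2 * ∫ x in a..b, f x * g x) * s
      + ∫ x in a..b, g x ^ 2 = ∫ x in a..b, (s * f x + g x) ^ 2 := by
      rw [show (fun x => (s * f x + g x) ^ 2) = fun x =>
        (f x ^ 2 * (s * s) + f x * g x * (2 * s)) + g x ^ 2 from funext fun x => by ring,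
        intervalIntegral.integral_add ((i1.mul_const _).add (i2.mul_const _)) i3,
        intervalIntegral.integral_add (i1.mul_const _) (i2.mul_const _),
        intervalIntegral.integral_mul_const, intervalIntegral.integral_mul_const]
      ring
    rw [this]
    exact intervalIntegral.integral_nonneg hab fun x _ => sq_nonneg _
  have := discrim_le_zero key
  rw [discrim] at this
  linarith

/-- Closes the energy estimates: `S` is an energy, `P` the unknown flux and `w` the datum at `R`.
Squaring the first inequality and inserting the second lets one factor `S` cancel. -/
theorem le_mul_sq_of_le_mul {S P c w q : ℝ} (hS : 0 ≤ S) (h1 : S ≤ q * (P * w))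
    (h2 : P ^ 2 ≤ c * S) (hc : 0 ≤ c) : S ≤ q ^ 2 * c * w ^ 2 := by
  rcases hS.eq_or_lt with h | h
  · rw [← h]; positivity
  · have h3 : S ^ 2 ≤ (q * (P * w)) ^ 2 := pow_le_pow_left₀ hS h1 2
    have h4 : S * S ≤ (q ^ 2 * c * w ^ 2) * S := by
      calc S * S = S ^ 2 := by ring
        _ ≤ (q * (P * w)) ^ 2 := h3
        _ = q ^ 2 * w ^ 2 * P ^ 2 := by ring
        _ ≤ q ^ 2 * w ^ 2 * (c * S) := by gcongr
        _ = _ := by ring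
    exact le_of_mul_le_mul_right h4 h

/-- A solution `w` of the modal equation `F/α (w'/(F α))' = l w + f` written as a first order
system with the flux `p = w'/(F α)`. -/
structure IsMode (χ₀ R ρ l : ℝ) (f w p : ℝ → ℂ) : Prop where
  contDiff_fst : ContDiff ℝ 1 w
  contDiff_flux : ContDiff ℝ 1 p
  hasDerivAt_fst : ∀ r ∈ Icc R ρ, HasDerivAt w (fluxCoeff χ₀ R r * p r) r
  hasDerivAt_flux : ∀ r ∈ Icc R ρ, HasDerivAt p (l * massCoeff χ₀ R r * w r + f r) r

section Estimates

variable {χ₀ R ρ l : ℝ} {w p : ℝ → ℂ}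

/-- Real and imaginary parts of the integral of `(p w̄)' = l H|w|² + Ḡ|p|²`; the end `ρ` does not
contribute. The conjugate on `G` is what gives the two imaginary terms opposite signs. -/
theorem IsMode.energy (hχ : 0 ≤ χ₀) (hR : 0 < R) (hρ : R ≤ ρ)
    (h : IsMode χ₀ R ρ l 0 w p) (hwρ : w ρ = 0) :
    (l * ∫ r in R..ρ, (massCoeff χ₀ R r).re * ‖w r‖ ^ 2) +
        ∫ r in R..ρ, (fluxCoeff χ₀ R r).re * ‖p r‖ ^ 2 = -(p R * star (w R)).re ∧
    (l * ∫ r in R..ρ, (massCoeff χ₀ R r).im * ‖w r‖ ^ 2) -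
        ∫ r in R..ρ, (fluxCoeff χ₀ R r).im * ‖p r‖ ^ 2 = -(p R * star (w R)).im := by
  have cw := h.contDiff_fst.continuous
  have cp := h.contDiff_flux.continuous
  have cH : ContinuousOn (massCoeff χ₀ R) (Icc R ρ) :=
    (continuousOn_massCoeff hχ hR).mono Icc_subset_Ici_self
  have cG : ContinuousOn (fluxCoeff χ₀ R) (Icc R ρ) := (continuous_fluxCoeff χ₀ R).continuousOn
  let g : ℝ → ℂ := fun r => l * massCoeff χ₀ R r * w r * star (w r) +
    p r * star (fluxCoeff χ₀ R r * p r)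
  have cg : ContinuousOn g (Icc R ρ) :=
    ((((continuousOn_const.mul cH).mul cw.continuousOn).mul cw.star.continuousOn).add
      (cp.continuousOn.mul (cG.mul cp.continuousOn).star))
  have ig : IntervalIntegrable g volume R ρ := cg.intervalIntegrable_of_Icc hρ
  have key : ∫ r in R..ρ, g r = -(p R * star (w R)) := by
    have hd : ∀ r ∈ uIcc R ρ, HasDerivAt (fun r => p r * star (w r)) (g r) r := fun r hr => by
      rw [uIcc_of_le hρ] at hr
      have := (h.hasDerivAt_flux r hr).mul (h.hasDerivAt_fst r hr).star
      exact this.congr_deriv (by simp [g])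
    rw [intervalIntegral.integral_eq_sub_of_hasDerivAt hd ig, hwρ]
    simp
  have nsq : ∀ z : ℂ, z * star z = ((‖z‖ ^ 2 : ℝ) : ℂ) := fun z => by
    have := Complex.mul_conj' z
    rw [starRingEnd_apply] at this
    rw [this]; push_cast; rfl
  have eg : ∀ r, g r = ((l * ‖w r‖ ^ 2 : ℝ) : ℂ) * massCoeff χ₀ R r +
      ((‖p r‖ ^ 2 : ℝ) : ℂ) * star (fluxCoeff χ₀ R r) := fun r => by
    simp only [g]
    rw [mul_assoc _ (w r), nsq, star_mul', mul_comm (star (fluxCoeff χ₀ R r)), ← mul_assoc, nsq]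
    push_cast; ring
  have cHr : ContinuousOn (fun r => (massCoeff χ₀ R r).re) (Icc R ρ) :=
    Complex.continuous_re.comp_continuousOn cH
  have cHi : ContinuousOn (fun r => (massCoeff χ₀ R r).im) (Icc R ρ) :=
    Complex.continuous_im.comp_continuousOn cH
  have cGr : ContinuousOn (fun r => (fluxCoeff χ₀ R r).re) (Icc R ρ) :=
    Complex.continuous_re.comp_continuousOn cG
  have cGi : ContinuousOn (fun r => (fluxCoeff χ₀ R r).im) (Icc R ρ) :=
    Complex.continuous_im.comp_continuousOn cG
  have cw2 : ContinuousOn (fun r => ‖w r‖ ^ 2) (Icc R ρ) := (cw.norm.pow 2).continuousOn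
  have cp2 : ContinuousOn (fun r => ‖p r‖ ^ 2) (Icc R ρ) := (cp.norm.pow 2).continuousOn
  have icHr : IntervalIntegrable (fun r => (massCoeff χ₀ R r).re * ‖w r‖ ^ 2) volume R ρ :=
    (cHr.mul cw2).intervalIntegrable_of_Icc hρ
  have icGr : IntervalIntegrable (fun r => (fluxCoeff χ₀ R r).re * ‖p r‖ ^ 2) volume R ρ :=
    (cGr.mul cp2).intervalIntegrable_of_Icc hρ
  have icHi : IntervalIntegrable (fun r => (massCoeff χ₀ R r).im * ‖w r‖ ^ 2) volume R ρ :=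
    (cHi.mul cw2).intervalIntegrable_of_Icc hρ
  have icGi : IntervalIntegrable (fun r => (fluxCoeff χ₀ R r).im * ‖p r‖ ^ 2) volume R ρ :=
    (cGi.mul cp2).intervalIntegrable_of_Icc hρ
  constructor
  · rw [← intervalIntegral.integral_const_mul, ← intervalIntegral.integral_add
      (icHr.const_mul l)
      icGr, ← Complex.neg_re, ← key]
    refine (Eq.trans ?_ (Complex.reCLM.intervalIntegral_comp_comm ig))
    refine intervalIntegral.integral_congr fun r _ => ?_
    change _ = (g r).re
    rw [eg, Complex.add_re, Complex.re_ofReal_mul, Complex.re_ofReal_mul, Complex.star_def,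
      Complex.conj_re]
    ring
  · rw [← intervalIntegral.integral_const_mul, ← intervalIntegral.integral_sub
      (icHi.const_mul l)
      icGi, ← Complex.neg_im, ← key]
    refine (Eq.trans ?_ (Complex.imCLM.intervalIntegral_comp_comm ig))
    refine intervalIntegral.integral_congr fun r _ => ?_
    change _ = (g r).im
    rw [eg, Complex.add_im, Complex.im_ofReal_mul, Complex.im_ofReal_mul, Complex.star_def,
      Complex.conj_im]
    ring

/-- Bound for the flux at the inner end in terms of averages over `[R, R + s]`. -/
theorem IsMode.sq_flux_le (hχ : 0 ≤ χ₀) (hR : 0 < R) {s a : ℝ} (hs : 0 < s) (hsρ : R + s ≤ ρ)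
    (h : IsMode χ₀ R ρ l 0 w p) (hH : ∀ r ∈ Icc R (R + s), ‖massCoeff χ₀ R r‖ ≤ a) :
    ‖p R‖ ^ 2 ≤ 8 / s ^ 4 * (∫ r in R..R + s, (r - R) * ‖p r‖) ^ 2 +
      2 * l ^ 2 * a ^ 2 * s * ∫ r in R..ρ, ‖w r‖ ^ 2 := by
  have cw := h.contDiff_fst.continuous
  have cp := h.contDiff_flux.continuous
  have hRs : R ≤ R + s := by linarith
  have hsub : Icc R (R + s) ⊆ Icc R ρ := Icc_subset_Icc_right hsρ
  have ha : 0 ≤ a := (norm_nonneg _).trans (hH R ⟨le_rfl, hRs⟩)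
  have cH : ContinuousOn (massCoeff χ₀ R) (Icc R (R + s)) :=
    (continuousOn_massCoeff hχ hR).mono Icc_subset_Ici_self
  -- This is the derivative of `(s² - (r - R)²) p`. The cutoff vanishes at `R + s`, and its own
  -- derivative vanishes at `R`, so that `p` appears with the factor `r - R` that the degenerate
  -- weight `Im G` can absorb.
  let g : ℝ → ℂ := fun r => ((-2 * (r - R) : ℝ) : ℂ) * p r +
    ((s ^ 2 - (r - R) ^ 2 : ℝ) : ℂ) * (l * massCoeff χ₀ R r * w r)
  have cg : ContinuousOn g (Icc R (R + s)) :=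
    ((by fun_prop : Continuous fun r => ((-2 * (r - R) : ℝ) : ℂ)).mul cp).continuousOn.add
      ((by fun_prop : Continuous fun r => ((s ^ 2 - (r - R) ^ 2 : ℝ) : ℂ)).continuousOn.mul
        ((continuousOn_const.mul cH).mul cw.continuousOn))
  have key : ∫ r in R..R + s, g r = -((s ^ 2 : ℝ) * p R) := by
    have hd : ∀ r ∈ uIcc R (R + s),
        HasDerivAt (fun r => ((s ^ 2 - (r - R) ^ 2 : ℝ) : ℂ) * p r) (g r) r := fun r hr => by
      rw [uIcc_of_le hRs] at hr
      have h1 : HasDerivAt (fun r : ℝ => s ^ 2 - (r - R) ^ 2) (-2 * (r - R)) r := by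
        refine ((((hasDerivAt_id r).sub_const R).pow 2).const_sub (s ^ 2)).congr_deriv ?_
        simp
      have := h1.ofReal_comp.mul (h.hasDerivAt_flux r (hsub hr))
      exact this.congr_deriv (by simp [g])
    rw [intervalIntegral.integral_eq_sub_of_hasDerivAt hd (cg.intervalIntegrable_of_Icc hRs)]
    simp
  have c1 : Continuous fun r => (r - R) * ‖p r‖ := by fun_prop
  have bound : s ^ 2 * ‖p R‖ ≤ 2 * (∫ r in R..R + s, (r - R) * ‖p r‖) +
      s ^ 2 * |l| * a * ∫ r in R..R + s, ‖w r‖ := by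
    rw [← intervalIntegral.integral_const_mul, ← intervalIntegral.integral_const_mul,
      ← intervalIntegral.integral_add ((c1.intervalIntegrable _ _).const_mul _)
        ((cw.norm.intervalIntegrable _ _).const_mul _)]
    have : s ^ 2 * ‖p R‖ = ‖∫ r in R..R + s, g r‖ := by
      rw [key, norm_neg, norm_mul, Complex.norm_real, Real.norm_of_nonneg (by positivity)]
    rw [this]
    refine intervalIntegral.norm_integral_le_of_norm_le hRs (ae_of_all _ fun r hr => ?_)
      (Continuous.intervalIntegrable (by fun_prop) _ _)
    have hr0 : 0 ≤ r - R := by linarith [hr.1]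
    have hrs : r - R ≤ s := by linarith [hr.2]
    refine (norm_add_le _ _).trans (add_le_add ?_ ?_)
    · rw [norm_mul, Complex.norm_real, Real.norm_eq_abs, abs_mul, abs_of_nonneg hr0]
      norm_num
      linarith
    · rw [norm_mul, norm_mul, norm_mul, Complex.norm_real, Complex.norm_real, Real.norm_eq_abs,
        Real.norm_eq_abs, abs_of_nonneg (by nlinarith)]
      have h1 : s ^ 2 - (r - R) ^ 2 ≤ s ^ 2 := by nlinarith
      have h2 := hH r ⟨hr.1.le, hr.2⟩
      calc _ ≤ s ^ 2 * (|l| * a * ‖w r‖) := by gcongr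
        _ = _ := by ring
  have hW : (∫ r in R..R + s, ‖w r‖) ^ 2 ≤ s * ∫ r in R..ρ, ‖w r‖ ^ 2 := by
    have h1 := sq_integral_mul_le hRs (f := fun _ => 1) (g := fun r => ‖w r‖) continuousOn_const
      cw.norm.continuousOn
    simp only [one_mul, one_pow, intervalIntegral.integral_const, smul_eq_mul, mul_one,
      add_sub_cancel_left] at h1
    refine h1.trans (mul_le_mul_of_nonneg_left ?_ hs.le)
    refine intervalIntegral.integral_mono_interval le_rfl hRs hsρ
      (ae_of_all _ fun r => sq_nonneg _) ((cw.norm.pow 2).intervalIntegrable _ _)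
  set X := ∫ r in R..R + s, (r - R) * ‖p r‖
  set Y := ∫ r in R..R + s, ‖w r‖
  have e1 : ‖p R‖ ≤ 2 / s ^ 2 * X + |l| * a * Y := by
    have : s ^ 2 * (2 / s ^ 2 * X + |l| * a * Y) = 2 * X + s ^ 2 * |l| * a * Y := by
      field_simp
    exact le_of_mul_le_mul_left (this ▸ bound) (by positivity)
  calc ‖p R‖ ^ 2 ≤ (2 / s ^ 2 * X + |l| * a * Y) ^ 2 := pow_le_pow_left₀ (norm_nonneg _) e1 2
    _ ≤ 2 * (2 / s ^ 2 * X) ^ 2 + 2 * (|l| * a * Y) ^ 2 := by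
      nlinarith [sq_nonneg (2 / s ^ 2 * X - |l| * a * Y)]
    _ = 8 / s ^ 4 * X ^ 2 + 2 * l ^ 2 * a ^ 2 * Y ^ 2 := by
      rw [mul_pow (|l| * a), mul_pow |l|, sq_abs]; field_simp; ring
    _ ≤ 8 / s ^ 4 * X ^ 2 + 2 * l ^ 2 * a ^ 2 * (s * ∫ r in R..ρ, ‖w r‖ ^ 2) := by gcongr
    _ = _ := by ring

/-- A one-dimensional Hardy inequality. -/
theorem integral_sq_le_of_eq_zero {f f' : ℝ → ℂ} {a b : ℝ} (hab : a ≤ b)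
    (hf : ∀ r ∈ Icc a b, HasDerivAt f (f' r) r) (hf' : ContinuousOn f' (Icc a b))
    (hb : f b = 0) :
    ∫ r in a..b, ‖f r‖ ^ 2 ≤ 4 * ∫ r in a..b, (r - a) ^ 2 * ‖f' r‖ ^ 2 := by
  have cf : ContinuousOn f (Icc a b) := fun r hr => (hf r hr).continuousAt.continuousWithinAt
  have c1 : ContinuousOn (fun r => ‖f r‖ ^ 2) (Icc a b) := cf.norm.pow 2
  have c2 : ContinuousOn (fun r => (r - a) * ((inner ℝ (f r) (f' r)) * 2)) (Icc a b) :=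
    (by fun_prop : Continuous fun r : ℝ => r - a).continuousOn.mul
      ((cf.inner (𝕜 := ℝ) hf').mul continuousOn_const)
  have c3 : ContinuousOn (fun r => (r - a) ^ 2 * ‖f' r‖ ^ 2) (Icc a b) :=
    (by fun_prop : Continuous fun r : ℝ => (r - a) ^ 2).continuousOn.mul (hf'.norm.pow 2)
  have i1 := c1.intervalIntegrable_of_Icc (μ := volume) hab
  have i2 := c2.intervalIntegrable_of_Icc (μ := volume) hab
  have i3 := c3.intervalIntegrable_of_Icc (μ := volume) hab
  -- The primitive `(r - a)‖f‖²` vanishes at both ends, at `a` thanks to the weight. Young's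
  -- inequality then absorbs half of `‖f‖²`.
  have key : ∫ r in a..b, (‖f r‖ ^ 2 + (r - a) * ((inner ℝ (f r) (f' r)) * 2)) = 0 := by
    have hd : ∀ r ∈ uIcc a b, HasDerivAt (fun r => (r - a) * ‖f r‖ ^ 2)
        (‖f r‖ ^ 2 + (r - a) * ((inner ℝ (f r) (f' r)) * 2)) r := fun r hr => by
      rw [uIcc_of_le hab] at hr
      have h1 := ((hasDerivAt_id r).sub_const a).mul (hf r hr).norm_sq
      refine h1.congr_deriv ?_
      simp only [id]; ring
    rw [intervalIntegral.integral_eq_sub_of_hasDerivAt hd (i1.add i2), hb]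
    simp
  rw [intervalIntegral.integral_add i1 i2] at key
  have h2 : -∫ r in a..b, (r - a) * ((inner ℝ (f r) (f' r)) * 2) ≤
      ∫ r in a..b, (‖f r‖ ^ 2 * (1 / 2) + (r - a) ^ 2 * ‖f' r‖ ^ 2 * 2) := by
    rw [← intervalIntegral.integral_neg]
    refine intervalIntegral.integral_mono_on hab i2.neg ((i1.mul_const _).add (i3.mul_const _))
      fun r hr => ?_
    have h3 : -inner ℝ (f r) (f' r) ≤ ‖f r‖ * ‖f' r‖ :=
      (neg_le_abs _).trans (abs_real_inner_le_norm _ _)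
    have h4 : 0 ≤ r - a := by linarith [hr.1]
    nlinarith [mul_le_mul_of_nonneg_left h3 h4, sq_nonneg (‖f r‖ - 2 * ((r - a) * ‖f' r‖))]
  rw [intervalIntegral.integral_add (i1.mul_const _) (i3.mul_const _),
    intervalIntegral.integral_mul_const, intervalIntegral.integral_mul_const] at h2
  linarith

end Estimates

/-! ### A priori bounds for one mode, according to the sign of the separation constant -/

section Bounds

variable {χ₀ R ρ l κ : ℝ} {w p : ℝ → ℂ}

theorem IsMode.continuousOn_deriv (h : IsMode χ₀ R ρ l 0 w p) :
    ContinuousOn (fun r => fluxCoeff χ₀ R r * p r) (Icc R ρ) :=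
  ((continuous_fluxCoeff χ₀ R).mul h.contDiff_flux.continuous).continuousOn

set_option maxHeartbeats 1000000 in
/-- A priori bound for the modes with `l < 0`: the imaginary part of the energy is definite,
with a weight that degenerates at `r = R`. -/
theorem IsMode.bound_of_neg (hχ : 0 < χ₀) (hR : 0 < R) (hρ : 2 * R ≤ ρ)
    (hκ : 1 ≤ κ * χ₀ * R) {μ c A : ℝ} (hμ : 0 ≤ μ) (hA : A = 1 + χ₀ * (ρ - R))
    (hc : c = 2 * κ / R ^ 5 + 6400 * μ ^ 2 * κ / R)
    (h : IsMode χ₀ R ρ (-μ) 0 w p) (hwρ : w ρ = 0) :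
    ∫ r in R..ρ, ‖w r‖ ^ 2 ≤ 128 * κ * c * ((ρ - R) ^ 6 * A ^ 8) * ‖w R‖ ^ 2 ∧
    ∫ r in R..ρ, ‖fluxCoeff χ₀ R r * p r‖ ^ 2 ≤
      8 * (512 * μ * κ * c / R + 2 * c / R ^ 3) * ((ρ - R) ^ 7 * A ^ 11) * ‖w R‖ ^ 2 := by
  have hRρ : R ≤ ρ := by linarith
  set d := ρ - R with hd
  have hdR : R ≤ d := by rw [hd]; linarith
  have hd0 : 0 < d := hR.trans_le hdR
  have hA1 : 1 ≤ A := by rw [hA]; nlinarith [mul_pos hχ hd0]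
  have hA0 : 0 < A := by linarith
  have hκ0 : 0 < κ := by
    by_contra hneg
    have : κ * (χ₀ * R) ≤ 0 := mul_nonpos_of_nonpos_of_nonneg (not_lt.1 hneg) (by positivity)
    nlinarith
  have hc0 : 0 < c := by rw [hc]; positivity
  have cw := h.contDiff_fst.continuous
  have cp := h.contDiff_flux.continuous
  have cG := continuous_fluxCoeff χ₀ R
  have cH : ContinuousOn (massCoeff χ₀ R) (Icc R ρ) :=
    (continuousOn_massCoeff hχ.le hR).mono Icc_subset_Ici_self
  have cHr : ContinuousOn (fun r => (massCoeff χ₀ R r).re) (Icc R ρ) :=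
    Complex.continuous_re.comp_continuousOn cH
  have cGr : Continuous (fun r => (fluxCoeff χ₀ R r).re) := Complex.continuous_re.comp cG
  have cGi : Continuous (fun r => (fluxCoeff χ₀ R r).im) := Complex.continuous_im.comp cG
  obtain ⟨eRe, eIm⟩ := h.energy hχ.le hR hRρ hwρ
  set z := p R * star (w R) with hz
  have hzn : ‖z‖ = ‖p R‖ * ‖w R‖ := by rw [hz, norm_mul, norm_star]
  set E := ∫ r in R..ρ, (fluxCoeff χ₀ R r).im * ‖p r‖ ^ 2 with hE
  set W := ∫ r in R..ρ, ‖w r‖ ^ 2 with hW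
  have hW0 : 0 ≤ W := intervalIntegral.integral_nonneg hRρ fun r _ => sq_nonneg _
  have hE0 : 0 ≤ E := intervalIntegral.integral_nonneg hRρ fun r hr =>
    mul_nonneg (fluxCoeff_im_nonneg hχ.le hR hr.1) (sq_nonneg _)
  have hHi : 0 ≤ ∫ r in R..ρ, (massCoeff χ₀ R r).im * ‖w r‖ ^ 2 :=
    intervalIntegral.integral_nonneg hRρ fun r hr =>
      mul_nonneg (massCoeff_im_nonneg hχ.le hR hr.1) (sq_nonneg _)
  -- With `l = -μ` both terms of the imaginary part of the energy have the same sign, so the one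
  -- with `Im H` can be dropped.
  have hEz : E ≤ 1 * (‖p R‖ * ‖w R‖) := by
    rw [one_mul, ← hzn]
    have := (le_abs_self _).trans (Complex.abs_im_le_norm z)
    nlinarith [mul_nonneg hμ hHi]
  -- Here `κχ₀R ≥ 1` replaces `χ₀` by the constant `κ`.
  have hpt : ∀ r ∈ Icc R ρ, (r - R) ≤ κ / 2 * (fluxCoeff χ₀ R r).im := fun r hr => by
    have h1 := mul_le_mul_of_nonneg_left (le_fluxCoeff_im hχ.le hr.1) (half_pos hκ0).le
    have h2 := mul_le_mul_of_nonneg_right hκ (sub_nonneg.2 hr.1)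
    linarith
  have hG : ∀ r ∈ Icc R ρ, ‖fluxCoeff χ₀ R r‖ ≤ 8 * d * A ^ 2 := fun r hr => by
    rw [hA]; exact norm_fluxCoeff_le hχ.le hR hρ hr
  -- Hardy's inequality
  have hWE : W ≤ 128 * κ * (d ^ 3 * A ^ 4) * E := by
    have h1 := integral_sq_le_of_eq_zero hRρ h.hasDerivAt_fst
      (f' := fun r => fluxCoeff χ₀ R r * p r) h.continuousOn_deriv hwρ
    have h2 : ∫ r in R..ρ, (r - R) ^ 2 * ‖fluxCoeff χ₀ R r * p r‖ ^ 2 ≤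
        ∫ r in R..ρ, 32 * κ * (d ^ 3 * A ^ 4) * ((fluxCoeff χ₀ R r).im * ‖p r‖ ^ 2) := by
      refine intervalIntegral.integral_mono_on hRρ
        (Continuous.intervalIntegrable (by fun_prop) _ _)
        (Continuous.intervalIntegrable (by fun_prop) _ _) fun r hr => ?_
      have hr0 : 0 ≤ r - R := sub_nonneg.2 hr.1
      have hrd : r - R ≤ d := by rw [hd]; linarith [hr.2]
      rw [norm_mul, mul_pow]
      calc (r - R) ^ 2 * (‖fluxCoeff χ₀ R r‖ ^ 2 * ‖p r‖ ^ 2)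
          = (r - R) * (r - R) * ‖fluxCoeff χ₀ R r‖ ^ 2 * ‖p r‖ ^ 2 := by ring
        _ ≤ d * (κ / 2 * (fluxCoeff χ₀ R r).im) * (8 * d * A ^ 2) ^ 2 * ‖p r‖ ^ 2 := by
          have h3 : 0 ≤ κ / 2 * (fluxCoeff χ₀ R r).im := hr0.trans (hpt r hr)
          gcongr
          · exact hpt r hr
          · exact hG r hr
        _ = _ := by ring
    rw [intervalIntegral.integral_const_mul] at h2
    linarith
  -- bound of the flux at `R`
  have hs : 0 < R / A := by positivity
  have hsR : R / A ≤ R := div_le_self hR.le hA1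
  have hsρ : R + R / A ≤ ρ := by linarith
  have hPE : ‖p R‖ ^ 2 ≤ c * (d ^ 3 * A ^ 4) * E := by
    -- The length `R/A` is such that `χ₀(r - R) ≤ 1` on the interval, since `χ₀R ≤ χ₀d ≤ A`; it also
    -- fits into the layer because `d ≥ R`.
    have h1 := h.sq_flux_le hχ.le hR hs hsρ (a := 5 / R) fun r hr =>
      norm_massCoeff_le_of_near hχ.le hR hr.1 (by
        have h1 : r - R ≤ R / A := by linarith [hr.2]
        have h2 : χ₀ * (R / A) ≤ 1 := by
          rw [mul_div_assoc', div_le_one hA0, hA]; nlinarith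
        exact (mul_le_mul_of_nonneg_left h1 hχ.le).trans h2)
    set s := R / A with hs'
    have h2 : (∫ r in R..R + s, (r - R) * ‖p r‖) ^ 2 ≤ s ^ 2 / 2 * (κ / 2 * E) := by
      have hRs : R ≤ R + s := by linarith
      -- The factor `r - R` is split evenly, so that only `∫ (r - R)|p|²` is needed, which `E`
      -- controls.
      have h3 := sq_integral_mul_le hRs (f := fun r => √(r - R)) (g := fun r => √(r - R) * ‖p r‖)
        (by fun_prop) (by fun_prop)
      have e1 : ∫ r in R..R + s, √(r - R) * (√(r - R) * ‖p r‖) =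
          ∫ r in R..R + s, (r - R) * ‖p r‖ := by
        refine intervalIntegral.integral_congr fun r hr => ?_
        rw [uIcc_of_le hRs] at hr
        rw [← mul_assoc, Real.mul_self_sqrt (sub_nonneg.2 hr.1)]
      have e2 : ∫ r in R..R + s, √(r - R) ^ 2 = s ^ 2 / 2 := by
        have : ∫ r in R..R + s, √(r - R) ^ 2 = ∫ r in R..R + s, (r - R) := by
          refine intervalIntegral.integral_congr fun r hr => ?_
          rw [uIcc_of_le hRs] at hr
          exact Real.sq_sqrt (sub_nonneg.2 hr.1)
        rw [this, intervalIntegral.integral_comp_sub_right (fun x => x), integral_id]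
        ring
      have e3 : ∫ r in R..R + s, (√(r - R) * ‖p r‖) ^ 2 ≤ κ / 2 * E := by
        calc ∫ r in R..R + s, (√(r - R) * ‖p r‖) ^ 2
            ≤ ∫ r in R..ρ, (√(r - R) * ‖p r‖) ^ 2 :=
              intervalIntegral.integral_mono_interval le_rfl hRs hsρ
                (ae_of_all _ fun r => sq_nonneg _)
                (Continuous.intervalIntegrable (by fun_prop) _ _)
          _ ≤ ∫ r in R..ρ, κ / 2 * ((fluxCoeff χ₀ R r).im * ‖p r‖ ^ 2) := by
              refine intervalIntegral.integral_mono_on hRρ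
                (Continuous.intervalIntegrable (by fun_prop) _ _)
                (Continuous.intervalIntegrable (by fun_prop) _ _) fun r hr => ?_
              rw [mul_pow, Real.sq_sqrt (sub_nonneg.2 hr.1), ← mul_assoc]
              gcongr
              exact hpt r hr
          _ = κ / 2 * E := by rw [intervalIntegral.integral_const_mul]
      rw [e1, e2] at h3
      exact h3.trans (mul_le_mul_of_nonneg_left e3 (by positivity))
    have h4 : 8 / s ^ 4 * (∫ r in R..R + s, (r - R) * ‖p r‖) ^ 2 ≤
        2 * κ / R ^ 5 * (d ^ 3 * A ^ 4) * E := by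
      calc _ ≤ 8 / s ^ 4 * (s ^ 2 / 2 * (κ / 2 * E)) := by gcongr
        _ = 2 * κ * E * (A ^ 2 / R ^ 2) := by rw [hs']; field_simp; ring
        _ ≤ 2 * κ * E * (A ^ 4 / R ^ 2 * (d ^ 3 / R ^ 3)) := by
          have h5 : A ^ 2 ≤ A ^ 4 := pow_le_pow_right₀ hA1 (by norm_num)
          have h6 : 1 ≤ d ^ 3 / R ^ 3 := by
            rw [one_le_div (by positivity)]; exact pow_le_pow_left₀ hR.le hdR 3
          gcongr
          calc A ^ 2 / R ^ 2 ≤ A ^ 4 / R ^ 2 := by gcongr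
            _ ≤ _ := le_mul_of_one_le_right (by positivity) h6
        _ = _ := by field_simp
    have h5 : 2 * (-μ) ^ 2 * (5 / R) ^ 2 * s * W ≤
        6400 * μ ^ 2 * κ / R * (d ^ 3 * A ^ 4) * E := by
      calc _ ≤ 2 * (-μ) ^ 2 * (5 / R) ^ 2 * R * (128 * κ * (d ^ 3 * A ^ 4) * E) := by gcongr
        _ = _ := by field_simp; ring
    calc _ ≤ _ := h1
      _ ≤ 2 * κ / R ^ 5 * (d ^ 3 * A ^ 4) * E + 6400 * μ ^ 2 * κ / R * (d ^ 3 * A ^ 4) * E :=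
        add_le_add h4 h5
      _ = _ := by rw [hc]; ring
  have hEw : E ≤ c * (d ^ 3 * A ^ 4) * ‖w R‖ ^ 2 := by
    simpa using le_mul_sq_of_le_mul hE0 hEz hPE (by positivity)
  have hWw : W ≤ 128 * κ * c * (d ^ 6 * A ^ 8) * ‖w R‖ ^ 2 := by
    calc W ≤ 128 * κ * (d ^ 3 * A ^ 4) * E := hWE
      _ ≤ 128 * κ * (d ^ 3 * A ^ 4) * (c * (d ^ 3 * A ^ 4) * ‖w R‖ ^ 2) := by gcongr
      _ = _ := by ring
  refine ⟨hWw, ?_⟩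
  have hPw : ‖p R‖ * ‖w R‖ ≤ c * (d ^ 3 * A ^ 4) * ‖w R‖ ^ 2 := by
    have h1 : ‖p R‖ ^ 2 ≤ (c * (d ^ 3 * A ^ 4) * ‖w R‖) ^ 2 := by
      calc _ ≤ _ := hPE
        _ ≤ c * (d ^ 3 * A ^ 4) * (c * (d ^ 3 * A ^ 4) * ‖w R‖ ^ 2) := by gcongr
        _ = _ := by ring
    have h2 := abs_le_of_sq_le_sq h1 (by positivity)
    calc _ ≤ (c * (d ^ 3 * A ^ 4) * ‖w R‖) * ‖w R‖ := by gcongr; exact (le_abs_self _).trans h2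
      _ = _ := by ring
  -- The real part of the energy, indefinite for `l < 0`, is usable now that `W` and `p(R)` are
  -- bounded. It supplies the control of `p` near `R` that the weight `Im G` misses.
  have hRe : ∫ r in R..ρ, (fluxCoeff χ₀ R r).re * ‖p r‖ ^ 2 ≤
      μ * (4 * A / R * W) + ‖p R‖ * ‖w R‖ := by
    have h1 : ∫ r in R..ρ, (massCoeff χ₀ R r).re * ‖w r‖ ^ 2 ≤ 4 * A / R * W := by
      rw [hW, ← intervalIntegral.integral_const_mul]
      refine intervalIntegral.integral_mono_on hRρ
        ((cHr.mul (cw.norm.pow 2).continuousOn).intervalIntegrable_of_Icc hRρ)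
        (Continuous.intervalIntegrable (by fun_prop) _ _) fun r hr => ?_
      gcongr
      rw [hA]
      exact (Complex.re_le_norm _).trans (norm_massCoeff_le_of_mem hχ.le hR hr)
    have h2 := (neg_le_abs _).trans (Complex.abs_re_le_norm z)
    have h3 := mul_le_mul_of_nonneg_left h1 hμ
    linarith
  calc ∫ r in R..ρ, ‖fluxCoeff χ₀ R r * p r‖ ^ 2
      ≤ ∫ r in R..ρ, 8 * d * A ^ 2 *
        ((fluxCoeff χ₀ R r).re * ‖p r‖ ^ 2 + (fluxCoeff χ₀ R r).im * ‖p r‖ ^ 2) := by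
        refine intervalIntegral.integral_mono_on hRρ
          (Continuous.intervalIntegrable (by fun_prop) _ _)
          (Continuous.intervalIntegrable (by fun_prop) _ _) fun r hr => ?_
        have h1 := norm_le_re_add_im (fluxCoeff_re_nonneg hχ.le hR hr.1)
          (fluxCoeff_im_nonneg hχ.le hR hr.1)
        rw [norm_mul, mul_pow, sq ‖fluxCoeff χ₀ R r‖, ← add_mul, ← mul_assoc]
        gcongr
        exact hG r hr
    _ = 8 * d * A ^ 2 * ((∫ r in R..ρ, (fluxCoeff χ₀ R r).re * ‖p r‖ ^ 2) + E) := by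
        rw [intervalIntegral.integral_const_mul, intervalIntegral.integral_add
          (Continuous.intervalIntegrable (by fun_prop) _ _)
          (Continuous.intervalIntegrable (by fun_prop) _ _)]
    _ ≤ 8 * d * A ^ 2 * ((μ * (4 * A / R * (128 * κ * c * (d ^ 6 * A ^ 8) * ‖w R‖ ^ 2)) +
          c * (d ^ 3 * A ^ 4) * ‖w R‖ ^ 2) + c * (d ^ 3 * A ^ 4) * ‖w R‖ ^ 2) := by
        gcongr
        refine hRe.trans ?_
        gcongr
    _ = 8 * (512 * μ * κ * c / R * (d ^ 7 * A ^ 11) + 2 * c * (d ^ 4 * A ^ 6)) *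
          ‖w R‖ ^ 2 := by ring
    _ ≤ 8 * (512 * μ * κ * c / R * (d ^ 7 * A ^ 11) + 2 * c / R ^ 3 * (d ^ 7 * A ^ 11)) *
          ‖w R‖ ^ 2 := by
        have h5 : A ^ 6 ≤ A ^ 11 := pow_le_pow_right₀ hA1 (by norm_num)
        have h6 : 1 ≤ d ^ 3 / R ^ 3 := by
          rw [one_le_div (by positivity)]; exact pow_le_pow_left₀ hR.le hdR 3
        gcongr 8 * (_ + ?_) * _
        calc 2 * c * (d ^ 4 * A ^ 6) ≤ 2 * c * (d ^ 4 * A ^ 11) := by gcongr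
          _ ≤ 2 * c * (d ^ 4 * A ^ 11) * (d ^ 3 / R ^ 3) :=
            le_mul_of_one_le_right (by positivity) h6
          _ = _ := by ring
    _ = _ := by ring

set_option maxHeartbeats 1000000 in
/-- A priori bound for the modes with `l > 0`, uniform in `l`: the form is coercive. -/
theorem IsMode.bound_of_pos (hχ : 0 < χ₀) (hR : 0 < R) (hρ : 2 * R ≤ ρ)
    {a m c A : ℝ} (hl : 0 < l) (hm : 1 ≤ m) (hla : l ≤ a * m ^ 2) (ha : 0 ≤ a)
    (hA : A = 1 + χ₀ * (ρ - R)) (hc : c = 16 / R ^ 3 + 200 * a / R)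
    (h : IsMode χ₀ R ρ l 0 w p) (hwρ : w ρ = 0) :
    l * ∫ r in R..ρ, ‖w r‖ ^ 2 ≤ 16 * c * ((ρ - R) ^ 2 * A) * m * ‖w R‖ ^ 2 ∧
    ∫ r in R..ρ, ‖fluxCoeff χ₀ R r * p r‖ ^ 2 ≤
      64 * c * ((ρ - R) ^ 2 * A ^ 3) * m * ‖w R‖ ^ 2 := by
  have hRρ : R ≤ ρ := by linarith
  set d := ρ - R with hd
  have hdR : R ≤ d := by rw [hd]; linarith
  have hd0 : 0 < d := hR.trans_le hdR
  have hA1 : 1 ≤ A := by rw [hA]; nlinarith [mul_pos hχ hd0]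
  have hA0 : 0 < A := by linarith
  have hm0 : 0 < m := by linarith
  have hc0 : 0 < c := by rw [hc]; positivity
  have cw := h.contDiff_fst.continuous
  have cp := h.contDiff_flux.continuous
  have cG := continuous_fluxCoeff χ₀ R
  have cH : ContinuousOn (massCoeff χ₀ R) (Icc R ρ) :=
    (continuousOn_massCoeff hχ.le hR).mono Icc_subset_Ici_self
  have cHr : ContinuousOn (fun r => (massCoeff χ₀ R r).re) (Icc R ρ) :=
    Complex.continuous_re.comp_continuousOn cH
  have cHi : ContinuousOn (fun r => (massCoeff χ₀ R r).im) (Icc R ρ) :=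
    Complex.continuous_im.comp_continuousOn cH
  have cGr : Continuous (fun r => (fluxCoeff χ₀ R r).re) := Complex.continuous_re.comp cG
  have cGi : Continuous (fun r => (fluxCoeff χ₀ R r).im) := Complex.continuous_im.comp cG
  obtain ⟨eRe, eIm⟩ := h.energy hχ.le hR hRρ hwρ
  set z := p R * star (w R) with hz
  have hzn : ‖z‖ = ‖p R‖ * ‖w R‖ := by rw [hz, norm_mul, norm_star]
  set W := ∫ r in R..ρ, ‖w r‖ ^ 2 with hW
  set E := ∫ r in R..ρ, ‖fluxCoeff χ₀ R r‖ * ‖p r‖ ^ 2 with hE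
  have hW0 : 0 ≤ W := intervalIntegral.integral_nonneg hRρ fun r _ => sq_nonneg _
  have hE0 : 0 ≤ E := intervalIntegral.integral_nonneg hRρ fun r _ => by positivity
  have hG : ∀ r ∈ Icc R ρ, ‖fluxCoeff χ₀ R r‖ ≤ 8 * d * A ^ 2 := fun r hr => by
    rw [hA]; exact norm_fluxCoeff_le hχ.le hR hρ hr
  have hE1 : E / 2 ≤ (∫ r in R..ρ, (fluxCoeff χ₀ R r).re * ‖p r‖ ^ 2) +
      (∫ r in R..ρ, (fluxCoeff χ₀ R r).im * ‖p r‖ ^ 2) / 2 := by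
    rw [hE, ← intervalIntegral.integral_div, ← intervalIntegral.integral_div,
      ← intervalIntegral.integral_add (Continuous.intervalIntegrable (by fun_prop) _ _)
        (Continuous.intervalIntegrable (by fun_prop) _ _)]
    refine intervalIntegral.integral_mono_on hRρ
      (Continuous.intervalIntegrable (by fun_prop) _ _)
      (Continuous.intervalIntegrable (by fun_prop) _ _) fun r hr => ?_
    have h0 := fluxCoeff_re_nonneg hχ.le hR hr.1
    have h1 := norm_le_re_add_im h0 (fluxCoeff_im_nonneg hχ.le hR hr.1)
    nlinarith [mul_le_mul_of_nonneg_right h1 (sq_nonneg ‖p r‖), mul_nonneg h0 (sq_nonneg ‖p r‖)]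
  have hW1 : 1 / (4 * d) * W ≤ (∫ r in R..ρ, (massCoeff χ₀ R r).re * ‖w r‖ ^ 2) -
      (∫ r in R..ρ, (massCoeff χ₀ R r).im * ‖w r‖ ^ 2) / 2 := by
    have i1 : IntervalIntegrable (fun r => (massCoeff χ₀ R r).re * ‖w r‖ ^ 2) volume R ρ :=
      (cHr.mul (cw.norm.pow 2).continuousOn).intervalIntegrable_of_Icc hRρ
    have i2 : IntervalIntegrable (fun r => (massCoeff χ₀ R r).im * ‖w r‖ ^ 2) volume R ρ :=
      (cHi.mul (cw.norm.pow 2).continuousOn).intervalIntegrable_of_Icc hRρ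
    rw [hW, ← intervalIntegral.integral_const_mul, ← intervalIntegral.integral_div,
      ← intervalIntegral.integral_sub i1 (i2.div_const 2)]
    refine intervalIntegral.integral_mono_on hRρ
      (Continuous.intervalIntegrable (by fun_prop) _ _) (i1.sub (i2.div_const 2)) fun r hr => ?_
    have := mul_le_mul_of_nonneg_right (le_massCoeff_re_sub_im hχ.le hR hρ hr)
      (sq_nonneg ‖w r‖)
    linarith
  -- The coercive part of the real part of the energy identity multiplied by `1 + i/2`, that is, of
  -- `eRe` minus half of `eIm`.
  set S := E / 2 + l * (1 / (4 * d) * W) with hS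
  have hWS0 : 0 ≤ l * (1 / (4 * d) * W) := by positivity
  have hS0 : 0 ≤ S := by positivity
  have hES : E ≤ 2 * S := by rw [hS]; linarith
  have hWS : l * W ≤ 4 * d * S := by
    have : 4 * d * (l * (1 / (4 * d) * W)) = l * W := by field_simp
    rw [← this, hS]
    gcongr
    linarith
  have hSz : S ≤ 2 * (‖p R‖ * ‖w R‖) := by
    rw [← hzn]
    have h1 := (neg_le_abs _).trans (Complex.abs_re_le_norm z)
    have h2 := (le_abs_self _).trans (Complex.abs_im_le_norm z)
    have h3 := mul_le_mul_of_nonneg_left hW1 hl.le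
    have h4 := norm_nonneg z
    rw [hS]
    linarith
  -- The interval shrinks like `1/m`. The two contributions to `|p(R)|²` are of orders `S/s` and `s
  -- l S` with `l ≤ a m²`, so both become of order `m S`, uniformly in the mode.
  have hs : 0 < R / (A * m) := by positivity
  have hAm : 1 ≤ A * m := one_le_mul_of_one_le_of_one_le hA1 hm
  have hsR : R / (A * m) ≤ R := div_le_self hR.le hAm
  have hsρ : R + R / (A * m) ≤ ρ := by linarith
  have hPS : ‖p R‖ ^ 2 ≤ m * c * (d * A) * S := by
    have h1 := h.sq_flux_le hχ.le hR hs hsρ (a := 5 / R) fun r hr =>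
      norm_massCoeff_le_of_near hχ.le hR hr.1 (by
        have h1 : r - R ≤ R / (A * m) := by linarith [hr.2]
        have h2 : χ₀ * (R / (A * m)) ≤ 1 := by
          rw [mul_div_assoc', div_le_one (by positivity)]
          have : A ≤ A * m := le_mul_of_one_le_right hA0.le hm
          nlinarith
        exact (mul_le_mul_of_nonneg_left h1 hχ.le).trans h2)
    set s := R / (A * m) with hs'
    have h2 : (∫ r in R..R + s, (r - R) * ‖p r‖) ^ 2 ≤ s ^ 3 * (2 * S / R) := by
      have hRs : R ≤ R + s := by linarith
      have h3 := sq_integral_mul_le hRs (f := fun r => r - R) (g := fun r => ‖p r‖)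
        (by fun_prop) (by fun_prop)
      have e2 : ∫ r in R..R + s, (r - R) ^ 2 ≤ s ^ 3 := by
        rw [intervalIntegral.integral_comp_sub_right (fun x => x ^ 2), integral_pow]
        have : 0 < s ^ 3 := by positivity
        norm_num
        linarith
      have e3 : ∫ r in R..R + s, ‖p r‖ ^ 2 ≤ 2 * S / R := by
        rw [le_div_iff₀ hR]
        refine le_trans ?_ hES
        calc (∫ r in R..R + s, ‖p r‖ ^ 2) * R
            ≤ (∫ r in R..ρ, ‖p r‖ ^ 2) * R := by
              gcongr
              exact intervalIntegral.integral_mono_interval le_rfl hRs hsρ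
                (ae_of_all _ fun r => sq_nonneg _)
                (Continuous.intervalIntegrable (by fun_prop) _ _)
          _ ≤ E := by
              rw [hE, ← intervalIntegral.integral_mul_const]
              refine intervalIntegral.integral_mono_on hRρ
                (Continuous.intervalIntegrable (by fun_prop) _ _)
                (Continuous.intervalIntegrable (by fun_prop) _ _) fun r hr => ?_
              rw [mul_comm]
              gcongr
              exact le_norm_fluxCoeff hχ.le hR hr.1
      refine h3.trans (mul_le_mul e2 e3 ?_ (by positivity))
      exact intervalIntegral.integral_nonneg hRs fun r _ => sq_nonneg _
    have h4 : 8 / s ^ 4 * (∫ r in R..R + s, (r - R) * ‖p r‖) ^ 2 ≤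
        m * (16 / R ^ 3) * (d * A) * S := by
      calc _ ≤ 8 / s ^ 4 * (s ^ 3 * (2 * S / R)) := by gcongr
        _ = 16 * S * m * A / R ^ 3 * R := by rw [hs']; field_simp; ring
        _ ≤ 16 * S * m * A / R ^ 3 * d := by gcongr
        _ = _ := by ring
    have h5 : 2 * l ^ 2 * (5 / R) ^ 2 * s * W ≤ m * (200 * a / R) * (d * A) * S := by
      calc _ = 50 / R ^ 2 * s * l * (l * W) := by ring
        _ ≤ 50 / R ^ 2 * s * (a * m ^ 2) * (4 * d * S) := by gcongr
        _ = 200 * a / R * m * d * S * (1 / A) := by rw [hs']; field_simp; ring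
        _ ≤ 200 * a / R * m * d * S * A := by
          gcongr
          rw [div_le_iff₀ hA0]; nlinarith
        _ = _ := by ring
    calc _ ≤ _ := h1
      _ ≤ m * (16 / R ^ 3) * (d * A) * S + m * (200 * a / R) * (d * A) * S := add_le_add h4 h5
      _ = _ := by rw [hc]; ring
  have hSw : S ≤ 2 ^ 2 * (m * c * (d * A)) * ‖w R‖ ^ 2 :=
    le_mul_sq_of_le_mul hS0 hSz hPS (by positivity)
  constructor
  · calc l * W ≤ 4 * d * S := hWS
      _ ≤ 4 * d * (2 ^ 2 * (m * c * (d * A)) * ‖w R‖ ^ 2) := by gcongr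
      _ = _ := by ring
  · calc ∫ r in R..ρ, ‖fluxCoeff χ₀ R r * p r‖ ^ 2
        ≤ ∫ r in R..ρ, 8 * d * A ^ 2 * (‖fluxCoeff χ₀ R r‖ * ‖p r‖ ^ 2) := by
          refine intervalIntegral.integral_mono_on hRρ
            (Continuous.intervalIntegrable (by fun_prop) _ _)
            (Continuous.intervalIntegrable (by fun_prop) _ _) fun r hr => ?_
          rw [norm_mul, mul_pow, sq ‖fluxCoeff χ₀ R r‖, ← mul_assoc]
          gcongr
          exact hG r hr
      _ = 8 * d * A ^ 2 * E := by rw [intervalIntegral.integral_const_mul]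
      _ ≤ 8 * d * A ^ 2 * (2 * (2 ^ 2 * (m * c * (d * A)) * ‖w R‖ ^ 2)) := by
          gcongr
          exact hES.trans (by gcongr)
      _ = _ := by ring

end Bounds

/-! ### Uniform bounds and solvability for the modes -/

/-- The separation constant `m²π²/Z² - k²` of the mode `sin (mπz/Z)`. -/
noncomputable def sep (k Z : ℝ) (m : ℕ) : ℝ := (m * Real.pi / Z) ^ 2 - k ^ 2

theorem kappa_nonneg (k Z : ℝ) : 0 ≤ kappa k Z := Real.iInf_nonneg fun _ => norm_nonneg _

/-- The separation constant equals `|k_m|²` up to sign, so `κ²` is a spectral gap around `l = 0`. -/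
theorem kappa_sq_le {k Z : ℝ} (hk : 0 ≤ k) (hZ : 0 < Z) {m : ℕ} (hm : 1 ≤ m) :
    kappa k Z ^ 2 ≤ |sep k Z m| := by
  have h1 : kappa k Z ≤ ‖modeNumber k Z m‖ :=
    ciInf_le (f := fun m : ℕ+ => ‖modeNumber k Z m‖)
      ⟨0, by rintro _ ⟨m, rfl⟩; exact norm_nonneg _⟩ (⟨m, hm⟩ : ℕ+)
  refine (pow_le_pow_left₀ (kappa_nonneg k Z) h1 2).trans (le_of_eq ?_)
  have hs : (m : ℝ) ^ 2 * Real.pi ^ 2 / Z ^ 2 = (m * Real.pi / Z) ^ 2 := by ring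
  have h0 : 0 ≤ m * Real.pi / Z := by positivity
  rw [modeNumber, sep, hs]
  split_ifs with h
  · have h2 := pow_le_pow_left₀ h0 h.le 2
    rw [Complex.norm_real, Real.norm_of_nonneg (Real.sqrt_nonneg _), Real.sq_sqrt (by linarith),
      abs_of_nonpos (by linarith)]
    ring
  · have h2 := pow_le_pow_left₀ hk (not_lt.1 h) 2
    rw [norm_mul, Complex.norm_I, one_mul, Complex.norm_real,
      Real.norm_of_nonneg (Real.sqrt_nonneg _), Real.sq_sqrt (by linarith),
      abs_of_nonneg (by linarith)]

/-- Missing powers of `d` are supplied by `d/R ≥ 1` and those of `A` by `A ≥ 1`; this brings all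
bounds to a common power. -/
theorem pow_mul_pow_le {R d A : ℝ} (hR : 0 < R) (hd : R ≤ d) (hA : 1 ≤ A) {a b e n : ℕ}
    (ha : a + e = n) (hb : b ≤ n) : d ^ a * A ^ b ≤ (1 / R) ^ e * (d ^ n * A ^ n) := by
  have hd0 : 0 < d := hR.trans_le hd
  have h1 : A ^ b ≤ A ^ n := pow_le_pow_right₀ hA hb
  have h2 : 1 ≤ (1 / R * d) ^ e :=
    one_le_pow₀ (by rw [one_div, ← div_eq_inv_mul, one_le_div hR]; exact hd)
  calc d ^ a * A ^ b ≤ d ^ a * A ^ n := by gcongr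
    _ ≤ d ^ a * A ^ n * (1 / R * d) ^ e := le_mul_of_one_le_right (by positivity) h2
    _ = (1 / R) ^ e * (d ^ (a + e) * A ^ n) := by rw [mul_pow, pow_add]; ring
    _ = _ := by rw [ha]

set_option maxHeartbeats 1000000 in
/-- The energy of a mode is bounded by its boundary value at `r = R`, uniformly in the number of
the mode, in the strength `χ₀` and in the thickness of the layer. -/
theorem exists_mode_bound {k Z R : ℝ} (hk : 0 ≤ k) (hZ : 0 < Z) (hR : 0 < R) :
    ∃ C : ℝ, 0 < C ∧ ∀ χ₀ ρ : ℝ, 0 < χ₀ → 1 ≤ kappa k Z * χ₀ * R → 2 * R ≤ ρ →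
      ∀ (m : ℕ) (w p : ℝ → ℂ), 1 ≤ m → IsMode χ₀ R ρ (sep k Z m) 0 w p → w ρ = 0 →
        (∫ r in R..ρ, ‖fluxCoeff χ₀ R r * p r‖ ^ 2) +
          (1 + (m * Real.pi / Z) ^ 2) * ∫ r in R..ρ, ‖w r‖ ^ 2 ≤
        C * ((ρ - R) ^ 12 * (1 + χ₀ * (ρ - R)) ^ 12) * m * ‖w R‖ ^ 2 := by
  set κ := kappa k Z with hκdef
  have hκ0 : 0 ≤ κ := kappa_nonneg k Z
  obtain ⟨c₁, hc₁⟩ : ∃ y, y = 2 * κ / R ^ 5 + 6400 * (k ^ 2) ^ 2 * κ / R := ⟨_, rfl⟩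
  obtain ⟨a, ha⟩ : ∃ y, y = (Real.pi / Z) ^ 2 := ⟨_, rfl⟩
  obtain ⟨c₂, hc₂⟩ : ∃ y, y = 16 / R ^ 3 + 200 * a / R := ⟨_, rfl⟩
  have hc₁0 : 0 ≤ c₁ := by rw [hc₁]; positivity
  have ha0 : 0 ≤ a := by rw [ha]; positivity
  have hc₂0 : 0 < c₂ := by rw [hc₂]; positivity
  obtain ⟨b, hb⟩ : ∃ y, y = 1 + (1 + k ^ 2) / κ ^ 2 := ⟨_, rfl⟩
  have hb0 : 0 ≤ b := by rw [hb]; positivity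
  -- `D₁` serves the modes with `l ≤ 0` and `D₂` those with `l > 0`. The powers of `1/R` come from
  -- raising `d⁷`, `d⁶` and `d²` to `d¹²`, as the squared norm is to be bounded by the square of
  -- `d⁶A⁶`.
  obtain ⟨D₁, hD₁⟩ : ∃ y, y = 8 * (512 * k ^ 2 * κ * c₁ / R + 2 * c₁ / R ^ 3) * (1 / R) ^ 5 +
    (1 + k ^ 2) * (128 * κ * c₁) * (1 / R) ^ 6 := ⟨_, rfl⟩
  obtain ⟨D₂, hD₂⟩ : ∃ y, y = 64 * c₂ * (1 / R) ^ 10 + b * (16 * c₂) * (1 / R) ^ 10 := ⟨_, rfl⟩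
  have hD₁0 : 0 ≤ D₁ := by rw [hD₁]; positivity
  have hD₂0 : 0 < D₂ := by rw [hD₂]; positivity
  refine ⟨D₁ + D₂, by positivity, fun χ₀ ρ hχ hκ hρ m w p hm h hwρ => ?_⟩
  have hm1 : (1 : ℝ) ≤ m := by exact_mod_cast hm
  -- The condition `κχ₀R ≥ 1` already excludes resonance.
  have hκpos : 0 < κ := by
    refine hκ0.lt_of_ne fun h0 => ?_
    rw [← h0] at hκ
    norm_num at hκ
  have hgap := kappa_sq_le hk hZ hm
  rw [← hκdef] at hgap
  set A := 1 + χ₀ * (ρ - R) with hA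
  have hd : R ≤ ρ - R := by linarith
  have hd0 : 0 < ρ - R := hR.trans_le hd
  have hA1 : 1 ≤ A := by rw [hA]; nlinarith [mul_pos hχ hd0]
  obtain ⟨T, hT⟩ : ∃ y, y = (ρ - R) ^ 12 * A ^ 12 := ⟨_, rfl⟩
  have hT0 : 0 < T := by rw [hT]; positivity
  rw [← hT]
  have hM : (m * Real.pi / Z) ^ 2 = a * m ^ 2 := by rw [ha]; ring
  set W := ∫ r in R..ρ, ‖w r‖ ^ 2 with hW
  have hW0 : 0 ≤ W := intervalIntegral.integral_nonneg (by linarith) fun r _ => sq_nonneg _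
  clear_value W A κ
  rcases le_or_gt (sep k Z m) 0 with hl | hl
  · have hμ : 0 ≤ -sep k Z m := by linarith
    have hμk : -sep k Z m ≤ k ^ 2 := by rw [sep]; nlinarith [sq_nonneg (m * Real.pi / Z)]
    have h' : IsMode χ₀ R ρ (-(-sep k Z m)) 0 w p := by rwa [neg_neg]
    set μ := -sep k Z m with hμdef
    clear_value μ
    obtain ⟨c, hc⟩ : ∃ y, y = 2 * κ / R ^ 5 + 6400 * μ ^ 2 * κ / R := ⟨_, rfl⟩
    obtain ⟨b1, b2⟩ := h'.bound_of_neg hχ hR hρ hκ hμ hA hc hwρ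
    rw [← hW] at b1
    have hcc : c ≤ c₁ := by rw [hc, hc₁]; gcongr
    have hc0 : 0 ≤ c := by rw [hc]; positivity
    have hMk : (m * Real.pi / Z) ^ 2 ≤ k ^ 2 := by rw [sep] at hl; linarith
    have e1 : (ρ - R) ^ 7 * A ^ 11 ≤ (1 / R) ^ 5 * T := by
      rw [hT]; exact pow_mul_pow_le hR hd hA1 (by norm_num) (by norm_num)
    have e2 : (ρ - R) ^ 6 * A ^ 8 ≤ (1 / R) ^ 6 * T := by
      rw [hT]; exact pow_mul_pow_le hR hd hA1 (by norm_num) (by norm_num)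
    calc _ ≤ 8 * (512 * k ^ 2 * κ * c₁ / R + 2 * c₁ / R ^ 3) * ((1 / R) ^ 5 * T) * ‖w R‖ ^ 2 +
          (1 + k ^ 2) * (128 * κ * c₁ * ((1 / R) ^ 6 * T) * ‖w R‖ ^ 2) := by
          refine add_le_add (b2.trans ?_) (mul_le_mul (by linarith) (b1.trans ?_) hW0
            (by positivity))
          · gcongr
          · gcongr
      _ = D₁ * T * 1 * ‖w R‖ ^ 2 := by rw [hD₁]; ring
      _ ≤ (D₁ + D₂) * T * m * ‖w R‖ ^ 2 := by
          gcongr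
          linarith
  · have hla : sep k Z m ≤ a * m ^ 2 := by
      rw [sep, hM]; linarith [sq_nonneg k]
    obtain ⟨b1, b2⟩ := h.bound_of_pos hχ hR hρ hl hm1 hla ha0 hA hc₂ hwρ
    rw [← hW] at b1
    have e1 : (ρ - R) ^ 2 * A ^ 3 ≤ (1 / R) ^ 10 * T := by
      rw [hT]; exact pow_mul_pow_le hR hd hA1 (by norm_num) (by norm_num)
    have e2 : (ρ - R) ^ 2 * A ≤ (1 / R) ^ 10 * T := by
      have := pow_mul_pow_le hR hd hA1 (a := 2) (b := 1) (e := 10) (n := 12) (by norm_num)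
        (by norm_num)
      rwa [pow_one, ← hT] at this
    -- Since `l ≥ κ²`, the full `H¹` weight `1 + k² + l` is at most a fixed multiple of `l`.
    have hMl : 1 + (m * Real.pi / Z) ^ 2 ≤ b * sep k Z m := by
      rw [abs_of_pos hl] at hgap
      have h1 : 1 + k ^ 2 ≤ (1 + k ^ 2) / κ ^ 2 * sep k Z m := by
        rw [div_mul_eq_mul_div, le_div_iff₀ (by positivity)]
        gcongr
      have h2 : (m * Real.pi / Z) ^ 2 = sep k Z m + k ^ 2 := by rw [sep]; ring
      rw [h2, hb, add_mul, one_mul]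
      linarith
    calc _ ≤ 64 * c₂ * ((1 / R) ^ 10 * T) * m * ‖w R‖ ^ 2 +
          b * (16 * c₂ * ((1 / R) ^ 10 * T) * m * ‖w R‖ ^ 2) := by
          refine add_le_add (b2.trans (by gcongr)) ?_
          calc _ ≤ b * sep k Z m * W := by gcongr
            _ = b * (sep k Z m * W) := by ring
            _ ≤ _ := mul_le_mul_of_nonneg_left (b1.trans (by gcongr)) hb0
      _ = D₂ * T * m * ‖w R‖ ^ 2 := by rw [hD₂]; ring
      _ ≤ (D₁ + D₂) * T * m * ‖w R‖ ^ 2 := by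
          gcongr
          linarith

theorem exists_isMode {χ₀ R ρ l : ℝ} {f : ℝ → ℂ} (hχ : 0 ≤ χ₀) (hR : 0 < R) (hρ : R ≤ ρ)
    (hf : ContinuousOn f (Icc R ρ)) (x y : ℂ) :
    ∃ w p : ℝ → ℂ, IsMode χ₀ R ρ l f w p ∧ w R = x ∧ p R = y := by
  let B₁ : (ℂ × ℂ) →L[ℝ] ℂ × ℂ :=
    ((ContinuousLinearMap.snd ℝ ℂ ℂ).prod 0)
  let B₂ : (ℂ × ℂ) →L[ℝ] ℂ × ℂ :=
    ((0 : (ℂ × ℂ) →L[ℝ] ℂ).prod (ContinuousLinearMap.fst ℝ ℂ ℂ))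
  let A : ℝ → (ℂ × ℂ) →L[ℝ] ℂ × ℂ := fun r =>
    fluxCoeff χ₀ R r • B₁ + (l * massCoeff χ₀ R r : ℂ) • B₂
  have cH : ContinuousOn (massCoeff χ₀ R) (Icc R ρ) :=
    (continuousOn_massCoeff hχ hR).mono Icc_subset_Ici_self
  have hA : ContinuousOn A (Icc R ρ) :=
    ((continuous_fluxCoeff χ₀ R).continuousOn.smul continuousOn_const).add
      ((continuousOn_const.mul cH).smul continuousOn_const)
  have hg : ContinuousOn (fun r => ((0 : ℂ), f r)) (Icc R ρ) := continuousOn_const.prodMk hf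
  obtain ⟨Y, hY, h0, hd⟩ := exists_contDiff_linear_solution hρ hA hg (x, y)
  refine ⟨fun r => (Y r).1, fun r => (Y r).2, ⟨hY.fst, hY.snd, fun r hr => ?_, fun r hr => ?_⟩,
    by simp [h0], by simp [h0]⟩
  · have := (ContinuousLinearMap.fst ℝ ℂ ℂ).hasFDerivAt.comp_hasDerivAt r (hd r hr)
    refine this.congr_deriv ?_
    simp [A, B₁, B₂]
  · have := (ContinuousLinearMap.snd ℝ ℂ ℂ).hasFDerivAt.comp_hasDerivAt r (hd r hr)
    refine this.congr_deriv ?_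
    simp [A, B₁, B₂]

theorem IsMode.sub_smul {χ₀ R ρ l : ℝ} {f w p u q : ℝ → ℂ} (h : IsMode χ₀ R ρ l f w p)
    (h' : IsMode χ₀ R ρ l 0 u q) (c : ℂ) :
    IsMode χ₀ R ρ l f (fun r => w r - c * u r) (fun r => p r - c * q r) where
  contDiff_fst := h.contDiff_fst.sub (contDiff_const.mul h'.contDiff_fst)
  contDiff_flux := h.contDiff_flux.sub (contDiff_const.mul h'.contDiff_flux)
  hasDerivAt_fst r hr := ((h.hasDerivAt_fst r hr).sub
    ((h'.hasDerivAt_fst r hr).const_mul c)).congr_deriv (by ring)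
  hasDerivAt_flux r hr := ((h.hasDerivAt_flux r hr).sub
    ((h'.hasDerivAt_flux r hr).const_mul c)).congr_deriv (by simp; ring)

theorem eq_zero_of_integral_norm_sq_nonpos {f : ℝ → ℂ} {a b : ℝ} (hab : a < b)
    (hf : ContinuousOn f (Icc a b)) (h : ∫ r in a..b, ‖f r‖ ^ 2 ≤ 0) : f a = 0 := by
  by_contra hne
  have : 0 < ∫ r in a..b, ‖f r‖ ^ 2 :=
    intervalIntegral.integral_pos hab (hf.norm.pow 2) (fun _ _ => sq_nonneg _)
      ⟨a, ⟨le_rfl, hab.le⟩, by positivity⟩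
  linarith

/-- The Dirichlet problem for each mode is solvable. -/
theorem exists_isMode_dirichlet {k Z R χ₀ ρ : ℝ} (hk : 0 ≤ k) (hZ : 0 < Z) (hR : 0 < R)
    (hχ : 0 < χ₀) (hκ : 1 ≤ kappa k Z * χ₀ * R) (hρ : 2 * R ≤ ρ) {m : ℕ} (hm : 1 ≤ m)
    {f : ℝ → ℂ} (hf : ContinuousOn f (Icc R ρ)) (x : ℂ) :
    ∃ w p : ℝ → ℂ, IsMode χ₀ R ρ (sep k Z m) f w p ∧ w R = x ∧ w ρ = 0 := by
  have hRρ : R < ρ := by linarith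
  -- Shooting: `u` is the homogeneous solution with `u(R) = 0` and unit flux, `v` has the right
  -- datum at `R` and includes the source. A multiple of `u` corrects `v` at `ρ`, provided `u(ρ) ≠
  -- 0`.
  obtain ⟨u, q, hu, hu0, hq0⟩ := exists_isMode (l := sep k Z m) (f := 0) hχ.le hR hRρ.le
    continuousOn_const 0 1
  obtain ⟨v, p, hv, hv0, -⟩ := exists_isMode (l := sep k Z m) hχ.le hR hRρ.le hf x 0
  -- Otherwise the a priori bound with zero data gives `u' = 0`, against `u'(R) = G(R) ≠ 0`.
  have huρ : u ρ ≠ 0 := fun huρ => by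
    obtain ⟨C, -, hC⟩ := exists_mode_bound hk hZ hR
    have h1 := hC χ₀ ρ hχ hκ hρ m u q hm hu huρ
    rw [hu0] at h1
    have h2 : 0 ≤ (1 + (m * Real.pi / Z) ^ 2) * ∫ r in R..ρ, ‖u r‖ ^ 2 :=
      mul_nonneg (by positivity)
        (intervalIntegral.integral_nonneg hRρ.le fun r _ => sq_nonneg _)
    have h3 := eq_zero_of_integral_norm_sq_nonpos hRρ hu.continuousOn_deriv (by
      simp only [norm_zero, ne_eq, OfNat.ofNat_ne_zero, not_false_eq_true, zero_pow,
        mul_zero] at h1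
      linarith)
    rw [hq0, mul_one] at h3
    exact fluxCoeff_ne_zero hχ.le hR le_rfl h3
  refine ⟨_, _, hv.sub_smul hu (v ρ / u ρ), by simp [hu0, hv0], ?_⟩
  field_simp
  simp

/-! ### The sine system on `(0, Z)` -/

section Sine

theorem integral_cos_int_mul {Z : ℝ} (hZ : 0 < Z) {j : ℤ} (hj : j ≠ 0) :
    ∫ z in (0 : ℝ)..Z, Real.cos (j * Real.pi * z / Z) = 0 := by
  have hc : (j * Real.pi / Z : ℝ) ≠ 0 := by
    have : (j : ℝ) ≠ 0 := by exact_mod_cast hj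
    have := Real.pi_ne_zero
    positivity
  have h : ∀ z, Real.cos (j * Real.pi * z / Z) = Real.cos (j * Real.pi / Z * z) := fun z => by
    congr 1; ring
  simp_rw [h]
  rw [intervalIntegral.integral_comp_mul_left (fun x => Real.cos x) hc, integral_cos]
  rw [div_mul_cancel₀ _ hZ.ne', Real.sin_int_mul_pi]
  simp

theorem integral_sin_mul_sin {Z : ℝ} (hZ : 0 < Z) {m n : ℕ} (hm : m ≠ 0) :
    ∫ z in (0 : ℝ)..Z, Real.sin (m * Real.pi * z / Z) * Real.sin (n * Real.pi * z / Z) =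
      if m = n then Z / 2 else 0 := by
  have h : ∀ z : ℝ, Real.sin (m * Real.pi * z / Z) * Real.sin (n * Real.pi * z / Z) =
      Real.cos (((m - n : ℤ) : ℝ) * Real.pi * z / Z) / 2 -
        Real.cos (((m + n : ℤ) : ℝ) * Real.pi * z / Z) / 2 := fun z => by
    have e1 : ((m - n : ℤ) : ℝ) * Real.pi * z / Z =
      m * Real.pi * z / Z - n * Real.pi * z / Z := by push_cast; ring
    have e2 : ((m + n : ℤ) : ℝ) * Real.pi * z / Z =
      m * Real.pi * z / Z + n * Real.pi * z / Z := by push_cast; ring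
    rw [e1, e2, Real.cos_sub, Real.cos_add]; ring
  simp_rw [h]
  rw [intervalIntegral.integral_sub (Continuous.intervalIntegrable (by fun_prop) _ _)
    (Continuous.intervalIntegrable (by fun_prop) _ _), intervalIntegral.integral_div,
    intervalIntegral.integral_div, integral_cos_int_mul hZ (j := m + n) (by omega)]
  split_ifs with hmn
  · subst hmn; simp
  · rw [integral_cos_int_mul hZ (by omega)]; simp

theorem integral_cos_mul_cos {Z : ℝ} (hZ : 0 < Z) {m n : ℕ} (hm : m ≠ 0) :
    ∫ z in (0 : ℝ)..Z, Real.cos (m * Real.pi * z / Z) * Real.cos (n * Real.pi * z / Z) =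
      if m = n then Z / 2 else 0 := by
  have h : ∀ z : ℝ, Real.cos (m * Real.pi * z / Z) * Real.cos (n * Real.pi * z / Z) =
      Real.cos (((m - n : ℤ) : ℝ) * Real.pi * z / Z) / 2 +
        Real.cos (((m + n : ℤ) : ℝ) * Real.pi * z / Z) / 2 := fun z => by
    have e1 : ((m - n : ℤ) : ℝ) * Real.pi * z / Z =
      m * Real.pi * z / Z - n * Real.pi * z / Z := by push_cast; ring
    have e2 : ((m + n : ℤ) : ℝ) * Real.pi * z / Z =
      m * Real.pi * z / Z + n * Real.pi * z / Z := by push_cast; ring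
    rw [e1, e2, Real.cos_sub, Real.cos_add]; ring
  simp_rw [h]
  rw [intervalIntegral.integral_add (Continuous.intervalIntegrable (by fun_prop) _ _)
    (Continuous.intervalIntegrable (by fun_prop) _ _), intervalIntegral.integral_div,
    intervalIntegral.integral_div, integral_cos_int_mul hZ (j := m + n) (by omega)]
  split_ifs with hmn
  · subst hmn; simp
  · rw [integral_cos_int_mul hZ (by omega)]; simp

theorem integrable_mul_continuous {a b : ℝ} {f g : ℝ → ℂ}
    (hf : Integrable f (volume.restrict (Ioo a b))) (hg : Continuous g) :
    Integrable (fun z => f z * g z) (volume.restrict (Ioo a b)) := by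
  obtain ⟨C, hC⟩ := isCompact_Icc.exists_bound_of_continuousOn (hg.continuousOn (s := Icc a b))
  refine hf.mul_bdd (c := C) hg.aestronglyMeasurable ?_
  filter_upwards [ae_restrict_mem measurableSet_Ioo] with z hz
  exact hC z (Ioo_subset_Icc_self hz)

/-- An integrable function on an interval which is orthogonal to all continuous functions
vanishes. -/
theorem ae_eq_zero_of_forall_integral_mul_continuous {a b : ℝ} {f : ℝ → ℂ}
    (hf : Integrable f (volume.restrict (Ioo a b)))
    (h : ∀ g : ℝ → ℝ, Continuous g → ∫ z in Ioo a b, f z * (g z : ℂ) = 0) :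
    f =ᵐ[volume.restrict (Ioo a b)] 0 := by
  have := isOpen_Ioo.ae_eq_zero_of_integral_contDiff_smul_eq_zero (μ := volume)
    (IntegrableOn.locallyIntegrableOn hf) fun g hg _ hs => by
      have h1 := h g hg.continuous
      rw [← integral_indicator measurableSet_Ioo] at h1
      rw [← h1]
      congr 1
      ext z
      by_cases hz : z ∈ Ioo a b
      · rw [indicator_of_mem hz, Complex.real_smul, mul_comm]
      · rw [indicator_of_notMem hz, image_eq_zero_of_notMem_tsupport fun h' => hz (hs h'),
          zero_smul]
  exact (ae_restrict_iff' measurableSet_Ioo).2 this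

/-- Completeness of the sine system. -/
theorem ae_eq_zero_of_forall_integral_mul_sin {Z : ℝ} (hZ : 0 < Z) {f : ℝ → ℂ}
    (hf : Integrable f (volume.restrict (Ioo 0 Z)))
    (h : ∀ m : ℕ, 1 ≤ m → ∫ z in Ioo 0 Z, f z * (Real.sin (m * Real.pi * z / Z) : ℂ) = 0) :
    f =ᵐ[volume.restrict (Ioo 0 Z)] 0 := by
  -- With `x = πz/Z`, the formula `2 sin(mx) cos x = sin((m+1)x) + sin((m-1)x)` reduces powers of
  -- the cosine. For `m = 1` this makes `f sin x` orthogonal to all polynomials in `cos x`.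
  have step : ∀ n m : ℕ, ∫ z in Ioo 0 Z, f z * ((Real.sin (m * Real.pi * z / Z) : ℂ) *
      (Real.cos (Real.pi * z / Z) : ℂ) ^ n) = 0 := by
    intro n
    induction n with
    | zero =>
      intro m
      rcases Nat.eq_zero_or_pos m with rfl | hm
      · simp
      · simpa using h m hm
    | succ n ih =>
      intro m
      rcases m with _ | m
      · simp
      have e : ∀ z : ℝ, f z * ((Real.sin ((m + 1 : ℕ) * Real.pi * z / Z) : ℂ) *
          (Real.cos (Real.pi * z / Z) : ℂ) ^ (n + 1)) =
          (1 / 2 : ℂ) * (f z * ((Real.sin ((m + 2 : ℕ) * Real.pi * z / Z) : ℂ) *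
            (Real.cos (Real.pi * z / Z) : ℂ) ^ n)) +
          (1 / 2 : ℂ) * (f z * ((Real.sin (m * Real.pi * z / Z) : ℂ) *
            (Real.cos (Real.pi * z / Z) : ℂ) ^ n)) := fun z => by
        have e1 : ((m + 2 : ℕ) : ℝ) * Real.pi * z / Z =
          (m + 1 : ℕ) * Real.pi * z / Z + Real.pi * z / Z := by push_cast; ring
        have e2 : (m : ℝ) * Real.pi * z / Z =
          (m + 1 : ℕ) * Real.pi * z / Z - Real.pi * z / Z := by push_cast; ring
        rw [e1, e2, Real.sin_add, Real.sin_sub, pow_succ]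
        push_cast
        ring
      simp_rw [e]
      rw [integral_add ((integrable_mul_continuous hf (by fun_prop)).const_mul _)
        ((integrable_mul_continuous hf (by fun_prop)).const_mul _), integral_const_mul,
        integral_const_mul, ih, ih]
      simp
  set g : ℝ → ℂ := fun z => f z * (Real.sin (Real.pi * z / Z) : ℂ) with hg
  have ig : Integrable g (volume.restrict (Ioo 0 Z)) := integrable_mul_continuous hf (by fun_prop)
  have poly : ∀ P : Polynomial ℝ,
      ∫ z in Ioo 0 Z, g z * ((P.eval (Real.cos (Real.pi * z / Z)) : ℝ) : ℂ) = 0 := by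
    intro P
    induction P using Polynomial.induction_on' with
    | add P Q hP hQ =>
      simp_rw [Polynomial.eval_add, Complex.ofReal_add, mul_add]
      rw [integral_add (integrable_mul_continuous ig (by fun_prop))
        (integrable_mul_continuous ig (by fun_prop)), hP, hQ, add_zero]
    | monomial n c =>
      have : ∀ z : ℝ, g z * (((Polynomial.monomial n c).eval (Real.cos (Real.pi * z / Z)) : ℝ) : ℂ)
          = (c : ℂ) * (f z * ((Real.sin ((1 : ℕ) * Real.pi * z / Z) : ℂ) *
            (Real.cos (Real.pi * z / Z) : ℂ) ^ n)) := fun z => by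
        rw [Polynomial.eval_monomial, hg]
        push_cast
        rw [one_mul]
        ring
      simp_rw [this]
      rw [integral_const_mul, step, mul_zero]
  have hcont : ∀ u : ℝ → ℝ, Continuous u → ∫ z in Ioo 0 Z, g z * (u z : ℂ) = 0 := by
    intro u hu
    have key : ∀ ε > 0, ‖∫ z in Ioo 0 Z, g z * (u z : ℂ)‖ ≤ ε * ∫ z in Ioo 0 Z, ‖g z‖ := by
      intro ε hε
      -- The cosine maps `[0, π]` bijectively onto `[-1, 1]`, so `u` is a continuous function of
      -- `cos (πz/Z)` and Weierstrass approximation applies.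
      obtain ⟨P, hP⟩ := exists_polynomial_near_of_continuousOn (-1) 1
        (fun x => u (Z / Real.pi * Real.arccos x))
        (hu.comp (continuous_const.mul Real.continuous_arccos)).continuousOn ε hε
      have e1 : ∫ z in Ioo 0 Z, g z * (u z : ℂ) =
          ∫ z in Ioo 0 Z, (g z * (u z : ℂ) -
            g z * ((P.eval (Real.cos (Real.pi * z / Z)) : ℝ) : ℂ)) := by
        rw [integral_sub (integrable_mul_continuous ig (by fun_prop))
          (integrable_mul_continuous ig (by fun_prop)), poly, sub_zero]
      rw [e1, ← integral_const_mul]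
      refine norm_integral_le_of_norm_le (ig.norm.const_mul ε) ?_
      filter_upwards [ae_restrict_mem measurableSet_Ioo] with z hz
      have hz0 : 0 ≤ Real.pi * z / Z := by have := hz.1; positivity
      have hzπ : Real.pi * z / Z ≤ Real.pi := by
        rw [div_le_iff₀ hZ]; exact mul_le_mul_of_nonneg_left hz.2.le Real.pi_pos.le
      have h2 := hP (Real.cos (Real.pi * z / Z)) ⟨Real.neg_one_le_cos _, Real.cos_le_one _⟩
      rw [Real.arccos_cos hz0 hzπ] at h2
      have e2 : Z / Real.pi * (Real.pi * z / Z) = z := by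
        field_simp
      rw [e2] at h2
      rw [← mul_sub, norm_mul, mul_comm, ← Complex.ofReal_sub, Complex.norm_real, norm_sub_rev]
      exact mul_le_mul_of_nonneg_right h2.le (norm_nonneg _)
    have hI : 0 ≤ ∫ z in Ioo 0 Z, ‖g z‖ := integral_nonneg fun _ => norm_nonneg _
    by_contra hne
    have hpos : 0 < ‖∫ z in Ioo 0 Z, g z * (u z : ℂ)‖ := norm_pos_iff.2 hne
    have := key (‖∫ z in Ioo 0 Z, g z * (u z : ℂ)‖ / (2 * ((∫ z in Ioo 0 Z, ‖g z‖) + 1)))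
      (by positivity)
    rw [div_mul_eq_mul_div, le_div_iff₀ (by positivity)] at this
    nlinarith
  filter_upwards [ae_eq_zero_of_forall_integral_mul_continuous ig hcont,
    ae_restrict_mem measurableSet_Ioo] with z hz hzI
  have hs : 0 < Real.sin (Real.pi * z / Z) := by
    refine Real.sin_pos_of_pos_of_lt_pi (by have := hzI.1; positivity) ?_
    rw [div_lt_iff₀ hZ]
    exact mul_lt_mul_of_pos_left hzI.2 Real.pi_pos
  have : (Real.sin (Real.pi * z / Z) : ℂ) ≠ 0 := by exact_mod_cast hs.ne'
  exact (mul_eq_zero.1 hz).resolve_right this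

end Sine

/-! ### Sine series in `L²(0, Z)` -/

section SineSeries

theorem memLp_of_continuous_of_subset_isCompact {X : Type*} [TopologicalSpace X]
    [SecondCountableTopologyEither X ℂ] [MeasurableSpace X] [OpensMeasurableSpace X]
    {μ : Measure X} [IsFiniteMeasureOnCompacts μ] {s K : Set X} (hs : MeasurableSet s)
    (hK : IsCompact K) (hsK : s ⊆ K) {f : X → ℂ} (hf : Continuous f) (p : ENNReal) :
    MemLp f p (μ.restrict s) := by
  obtain ⟨C, hC⟩ := hK.exists_bound_of_continuousOn hf.continuousOn
  have : IsFiniteMeasure (μ.restrict s) :=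
    ⟨by rw [Measure.restrict_apply_univ]; exact (measure_mono hsK).trans_lt hK.measure_lt_top⟩
  refine MemLp.of_bound hf.aestronglyMeasurable C ?_
  filter_upwards [ae_restrict_mem hs] with x hx using hC x (hsK hx)

theorem memLp_Ioo {a b : ℝ} {f : ℝ → ℂ} (hf : Continuous f) :
    MemLp f 2 (volume.restrict (Ioo a b)) :=
  memLp_of_continuous_of_subset_isCompact measurableSet_Ioo isCompact_Icc Ioo_subset_Icc_self hf 2

/-- The function `sin (mπz/Z)`. -/
noncomputable def sinMode (Z : ℝ) (m : ℕ) (z : ℝ) : ℂ := (Real.sin (m * Real.pi * z / Z) : ℂ)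

/-- The function `cos (mπz/Z)`. -/
noncomputable def cosMode (Z : ℝ) (m : ℕ) (z : ℝ) : ℂ := (Real.cos (m * Real.pi * z / Z) : ℂ)

theorem continuous_sinMode (Z : ℝ) (m : ℕ) : Continuous (sinMode Z m) := by
  unfold sinMode; fun_prop

theorem continuous_cosMode (Z : ℝ) (m : ℕ) : Continuous (cosMode Z m) := by
  unfold cosMode; fun_prop

theorem hasDerivAt_sinMode (Z : ℝ) (m : ℕ) (z : ℝ) :
    HasDerivAt (sinMode Z m) ((m * Real.pi / Z : ℝ) * cosMode Z m z) z := by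
  have h1 : HasDerivAt (fun z : ℝ => m * Real.pi * z / Z) (m * Real.pi / Z) z := by
    simpa using ((hasDerivAt_id z).const_mul (m * Real.pi)).div_const Z
  refine (h1.sin.ofReal_comp).congr_deriv ?_
  rw [cosMode]; push_cast; ring

theorem hasDerivAt_cosMode (Z : ℝ) (m : ℕ) (z : ℝ) :
    HasDerivAt (cosMode Z m) (-(m * Real.pi / Z : ℝ) * sinMode Z m z) z := by
  have h1 : HasDerivAt (fun z : ℝ => m * Real.pi * z / Z) (m * Real.pi / Z) z := by
    simpa using ((hasDerivAt_id z).const_mul (m * Real.pi)).div_const Z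
  refine (h1.cos.ofReal_comp).congr_deriv ?_
  rw [sinMode]; push_cast; ring

theorem contDiff_sinMode (Z : ℝ) (m : ℕ) : ContDiff ℝ 1 (sinMode Z m) := by
  unfold sinMode
  exact Complex.ofRealCLM.contDiff.comp (Real.contDiff_sin.comp (by fun_prop))

theorem sinMode_zero_right (Z : ℝ) (m : ℕ) : sinMode Z m 0 = 0 := by simp [sinMode]

theorem sinMode_right {Z : ℝ} (hZ : 0 < Z) (m : ℕ) : sinMode Z m Z = 0 := by
  rw [sinMode, mul_div_cancel_right₀ _ hZ.ne', Real.sin_nat_mul_pi]; simp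

theorem star_sinMode (Z : ℝ) (m : ℕ) (z : ℝ) : star (sinMode Z m z) = sinMode Z m z :=
  Complex.conj_ofReal _

theorem integral_sinMode_mul {Z : ℝ} (hZ : 0 < Z) {m n : ℕ} (hm : m ≠ 0) :
    ∫ z in Ioo 0 Z, sinMode Z m z * sinMode Z n z = if m = n then ((Z / 2 : ℝ) : ℂ) else 0 := by
  rw [← integral_Ioc_eq_integral_Ioo, ← intervalIntegral.integral_of_le hZ.le]
  simp_rw [sinMode, ← Complex.ofReal_mul]
  rw [intervalIntegral.integral_ofReal, integral_sin_mul_sin hZ hm]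
  split_ifs <;> simp

theorem integral_cosMode_mul {Z : ℝ} (hZ : 0 < Z) {m n : ℕ} (hm : m ≠ 0) :
    ∫ z in Ioo 0 Z, cosMode Z m z * cosMode Z n z = if m = n then ((Z / 2 : ℝ) : ℂ) else 0 := by
  rw [← integral_Ioc_eq_integral_Ioo, ← intervalIntegral.integral_of_le hZ.le]
  simp_rw [cosMode, ← Complex.ofReal_mul]
  rw [intervalIntegral.integral_ofReal, integral_cos_mul_cos hZ hm]
  split_ifs <;> simp

/-- The sine functions as elements of `L²(0, Z)`. -/
noncomputable def sinLp (Z : ℝ) (m : ℕ) : Lp ℂ 2 (volume.restrict (Ioo (0 : ℝ) Z)) :=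
  (memLp_Ioo (continuous_sinMode Z m)).toLp (sinMode Z m)

theorem inner_sinLp (Z : ℝ) (m : ℕ) (η : Lp ℂ 2 (volume.restrict (Ioo (0 : ℝ) Z))) :
    inner ℂ (sinLp Z m) η = ∫ z in Ioo 0 Z, η z * sinMode Z m z := by
  rw [L2.inner_def]
  refine integral_congr_ae ?_
  filter_upwards [(memLp_Ioo (continuous_sinMode Z m)).coeFn_toLp] with z hz
  rw [sinLp, hz, RCLike.inner_apply, starRingEnd_apply, star_sinMode]

theorem integrable_of_Lp {Z : ℝ} (η : Lp ℂ 2 (volume.restrict (Ioo (0 : ℝ) Z))) :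
    Integrable η (volume.restrict (Ioo (0 : ℝ) Z)) :=
  (Lp.memLp η).integrable (by norm_num)

/-- The sine series of an `L²` function converges to it. -/
theorem tendsto_sine_series {Z : ℝ} (hZ : 0 < Z)
    (η : Lp ℂ 2 (volume.restrict (Ioo (0 : ℝ) Z))) :
    Tendsto (fun N : ℕ => eLpNorm (fun z => (∑ m ∈ Finset.range N,
      sineCoeff Z η (m + 1) * sinMode Z (m + 1) z) - η z) 2 (volume.restrict (Ioo 0 Z)))
      atTop (𝓝 0) := by
  set c : ℝ := √(2 / Z) with hc
  have hcsq : c * c = 2 / Z := Real.mul_self_sqrt (by positivity)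
  have hc0 : c ≠ 0 := (Real.sqrt_pos.2 (by positivity)).ne'
  -- `√(2/Z)` normalizes the sines; the shift to `m + 1` omits the zero function `sin 0`.
  let v : ℕ → Lp ℂ 2 (volume.restrict (Ioo (0 : ℝ) Z)) := fun m => (c : ℂ) • sinLp Z (m + 1)
  have hv : Orthonormal ℂ v := by
    rw [orthonormal_iff_ite]
    intro m n
    rw [inner_smul_left, inner_smul_right, inner_sinLp]
    have : ∫ z in Ioo 0 Z, sinLp Z (n + 1) z * sinMode Z (m + 1) z =
        ∫ z in Ioo 0 Z, sinMode Z (m + 1) z * sinMode Z (n + 1) z := by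
      refine integral_congr_ae ?_
      filter_upwards [(memLp_Ioo (continuous_sinMode Z (n + 1))).coeFn_toLp] with z hz
      rw [sinLp, hz, mul_comm]
    rw [this, integral_sinMode_mul hZ (by omega), Complex.conj_ofReal]
    simp only [add_left_inj]
    split_ifs
    · rw [← Complex.ofReal_mul, ← Complex.ofReal_mul, ← mul_assoc, hcsq]
      field_simp
      simp
    · simp
  have hbot : (Submodule.span ℂ (Set.range v))ᗮ = ⊥ := by
    rw [Submodule.eq_bot_iff]
    intro f hf
    rw [Submodule.mem_orthogonal] at hf
    refine (Lp.eq_zero_iff_ae_eq_zero).2 ?_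
    refine ae_eq_zero_of_forall_integral_mul_sin hZ (integrable_of_Lp f) fun m hm => ?_
    obtain ⟨m, rfl⟩ := Nat.exists_eq_succ_of_ne_zero (Nat.one_le_iff_ne_zero.1 hm)
    have h1 := hf (v m) (Submodule.subset_span ⟨m, rfl⟩)
    rw [inner_smul_left, inner_sinLp, Complex.conj_ofReal] at h1
    exact (mul_eq_zero.1 h1).resolve_left (by exact_mod_cast hc0)
  let b := HilbertBasis.mkOfOrthogonalEqBot hv hbot
  have hb : ∀ m, b m = v m := fun m => by
    rw [HilbertBasis.coe_mkOfOrthogonalEqBot]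
  have hsum := (b.hasSum_repr η).tendsto_sum_nat
  have hterm : ∀ m, b.repr η m • b m = sineCoeff Z η (m + 1) • sinLp Z (m + 1) := fun m => by
    rw [b.repr_apply_apply, hb, inner_smul_left, inner_sinLp, Complex.conj_ofReal, smul_smul,
      sineCoeff]
    congr 1
    rw [mul_right_comm, ← Complex.ofReal_mul, hcsq, Complex.ofReal_div, Complex.ofReal_ofNat]
    rfl
  simp_rw [hterm] at hsum
  rw [Lp.tendsto_Lp_iff_tendsto_eLpNorm'] at hsum
  refine hsum.congr fun N => eLpNorm_congr_ae ?_
  have h1 : ∀ᵐ z ∂(volume.restrict (Ioo (0 : ℝ) Z)), ∀ m, sinLp Z m z = sinMode Z m z :=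
    ae_all_iff.2 fun m => (memLp_Ioo (continuous_sinMode Z m)).coeFn_toLp
  have h2 : ∀ᵐ z ∂(volume.restrict (Ioo (0 : ℝ) Z)), ∀ m,
      (sineCoeff Z η (m + 1) • sinLp Z (m + 1) : Lp ℂ 2 _) z =
        sineCoeff Z η (m + 1) * sinLp Z (m + 1) z :=
    ae_all_iff.2 fun m => Lp.coeFn_smul _ _
  have h3 := Lp.coeFn_finsetSum (Finset.range N) fun m =>
    (sineCoeff Z η (m + 1) • sinLp Z (m + 1) : Lp ℂ 2 (volume.restrict (Ioo (0 : ℝ) Z)))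
  filter_upwards [h1, h2, h3] with z h1 h2 h3
  simp only [Pi.sub_apply]
  rw [h3, Finset.sum_apply]
  simp only [h2, h1]

end SineSeries

/-! ### Green's formulas in the layer -/

section Green

variable {R ρ Z : ℝ}

theorem isOpen_layer (R ρ Z : ℝ) : IsOpen (layer R ρ Z) := isOpen_Ioo.prod isOpen_Ioo

theorem measurableSet_layer (R ρ Z : ℝ) : MeasurableSet (layer R ρ Z) :=
  (isOpen_layer R ρ Z).measurableSet

theorem memLp_layer {f : ℝ × ℝ → ℂ} (hf : Continuous f) :
    MemLp f 2 (volume.restrict (layer R ρ Z)) :=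
  memLp_of_continuous_of_subset_isCompact (measurableSet_layer R ρ Z)
    (isCompact_Icc.prod isCompact_Icc) (prod_mono Ioo_subset_Icc_self Ioo_subset_Icc_self) hf 2

theorem restrict_layer (R ρ Z : ℝ) : (volume.restrict (layer R ρ Z) : Measure (ℝ × ℝ)) =
    (volume.restrict (Ioo R ρ)).prod (volume.restrict (Ioo 0 Z)) := by
  rw [Measure.prod_restrict, layer, Measure.volume_eq_prod]

instance (R ρ Z : ℝ) : IsFiniteMeasure (volume.restrict (layer R ρ Z) : Measure (ℝ × ℝ)) := by
  rw [restrict_layer]; infer_instance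

theorem integrable_layer {f : ℝ × ℝ → ℂ} (hf : Continuous f) :
    Integrable f (volume.restrict (layer R ρ Z)) :=
  (memLp_layer hf).integrable (by norm_num)

theorem integrable_mul_of_memLp {X : Type*} [MeasurableSpace X] {μ : Measure X} {f g : X → ℂ}
    (hf : MemLp f 2 μ) (hg : MemLp g 2 μ) : Integrable (fun x => f x * g x) μ :=
  memLp_one_iff_integrable.1 (hg.smul hf)

/-- Hölder's inequality. It is the only limit passage used: identities proved for `C¹` functions
carry over to `H¹` through it. -/
theorem tendsto_integral_mul_of_eLpNorm {X : Type*} [MeasurableSpace X] {μ : Measure X}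
    {Q f : X → ℂ} {F : ℕ → X → ℂ} (hQ : MemLp Q 2 μ) (hF : ∀ n, MemLp (F n) 2 μ)
    (hf : MemLp f 2 μ)
    (h : Tendsto (fun n => eLpNorm (fun x => F n x - f x) 2 μ) atTop (𝓝 0)) :
    Tendsto (fun n => ∫ x, Q x * F n x ∂μ) atTop (𝓝 (∫ x, Q x * f x ∂μ)) := by
  refine tendsto_integral_of_L1' _ (integrable_mul_of_memLp hQ hf).aestronglyMeasurable
    (Eventually.of_forall fun n => integrable_mul_of_memLp hQ (hF n)) ?_
  have h0 : Tendsto (fun n => eLpNorm Q 2 μ * eLpNorm (fun x => F n x - f x) 2 μ) atTop (𝓝 0) := by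
    simpa using ENNReal.Tendsto.const_mul h (Or.inr hQ.eLpNorm_ne_top)
  refine tendsto_of_tendsto_of_tendsto_of_le_of_le tendsto_const_nhds h0
    (fun n => zero_le) fun n => ?_
  have := eLpNorm_smul_le_mul_eLpNorm (p := 2) (q := 2) (r := 1)
    ((hF n).sub hf).aestronglyMeasurable
    hQ.aestronglyMeasurable
  refine le_trans (le_of_eq ?_) this
  congr 1
  ext x
  simp [mul_sub]

theorem continuous_fderiv_apply {φ : ℝ × ℝ → ℂ} (hφ : ContDiff ℝ 1 φ) (e : ℝ × ℝ) :
    Continuous fun p => fderiv ℝ φ p e :=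
  (hφ.continuous_fderiv (by norm_num)).clm_apply continuous_const

theorem hasDerivAt_fst_slice {φ : ℝ × ℝ → ℂ} (hφ : ContDiff ℝ 1 φ) (r z : ℝ) :
    HasDerivAt (fun r => φ (r, z)) (fderiv ℝ φ (r, z) (1, 0)) r := by
  have h1 : HasDerivAt (fun r : ℝ => (r, z)) ((1 : ℝ), (0 : ℝ)) r :=
    (hasDerivAt_id r).prodMk (hasDerivAt_const r z)
  exact ((hφ.differentiable (by norm_num) (r, z)).hasFDerivAt).comp_hasDerivAt r h1

theorem hasDerivAt_snd_slice {φ : ℝ × ℝ → ℂ} (hφ : ContDiff ℝ 1 φ) (r z : ℝ) :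
    HasDerivAt (fun z => φ (r, z)) (fderiv ℝ φ (r, z) (0, 1)) z := by
  have h1 : HasDerivAt (fun z : ℝ => (r, z)) ((0 : ℝ), (1 : ℝ)) z :=
    (hasDerivAt_const z r).prodMk (hasDerivAt_id z)
  exact ((hφ.differentiable (by norm_num) (r, z)).hasFDerivAt).comp_hasDerivAt z h1

theorem integral_layer_deriv_fst (hρ : R ≤ ρ) {g s : ℝ → ℂ} (hg : ContDiff ℝ 1 g)
    (hs : Continuous s) {φ : ℝ × ℝ → ℂ} (hφ : ContDiff ℝ 1 φ) :
    ∫ p in layer R ρ Z, (g p.1 * s p.2 * fderiv ℝ φ p (1, 0) + deriv g p.1 * s p.2 * φ p) =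
      ∫ z in Ioo 0 Z, s z * (g ρ * φ (ρ, z) - g R * φ (R, z)) := by
  have cg := hg.continuous
  have cg' := hg.continuous_deriv le_rfl
  have cφ := hφ.continuous
  have cφ' := continuous_fderiv_apply hφ (1, 0)
  have cF : Continuous fun p : ℝ × ℝ =>
      g p.1 * s p.2 * fderiv ℝ φ p (1, 0) + deriv g p.1 * s p.2 * φ p := by fun_prop
  have hI := integrable_layer (R := R) (ρ := ρ) (Z := Z) cF
  rw [restrict_layer] at hI ⊢
  rw [integral_prod_symm _ hI]
  refine integral_congr_ae (ae_of_all _ fun z => ?_)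
  simp only
  rw [← integral_Ioc_eq_integral_Ioo, ← intervalIntegral.integral_of_le hρ,
    intervalIntegral.integral_eq_sub_of_hasDerivAt (f := fun r => g r * s z * φ (r, z))]
  · ring
  · intro r _
    have h1 := ((hg.differentiable (by norm_num) r).hasDerivAt.mul_const (s z)).mul
      (hasDerivAt_fst_slice hφ r z)
    exact h1.congr_deriv (by ring)
  · exact (cF.comp (by fun_prop : Continuous fun r : ℝ => (r, z))).intervalIntegrable _ _

theorem integral_layer_deriv_snd (hZ : 0 ≤ Z) {g s : ℝ → ℂ} (hg : Continuous g)
    (hs : ContDiff ℝ 1 s) {φ : ℝ × ℝ → ℂ} (hφ : ContDiff ℝ 1 φ) :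
    ∫ p in layer R ρ Z, (g p.1 * s p.2 * fderiv ℝ φ p (0, 1) + g p.1 * deriv s p.2 * φ p) =
      ∫ r in Ioo R ρ, g r * (s Z * φ (r, Z) - s 0 * φ (r, 0)) := by
  have cs := hs.continuous
  have cs' := hs.continuous_deriv le_rfl
  have cφ := hφ.continuous
  have cφ' := continuous_fderiv_apply hφ (0, 1)
  have cF : Continuous fun p : ℝ × ℝ =>
      g p.1 * s p.2 * fderiv ℝ φ p (0, 1) + g p.1 * deriv s p.2 * φ p := by fun_prop
  have hI := integrable_layer (R := R) (ρ := ρ) (Z := Z) cF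
  rw [restrict_layer] at hI ⊢
  rw [integral_prod _ hI]
  refine integral_congr_ae (ae_of_all _ fun r => ?_)
  simp only
  rw [← integral_Ioc_eq_integral_Ioo, ← intervalIntegral.integral_of_le hZ,
    intervalIntegral.integral_eq_sub_of_hasDerivAt (f := fun z => g r * s z * φ (r, z))]
  · ring
  · intro z _
    have h1 := ((hs.differentiable (by norm_num) z).hasDerivAt.const_mul (g r)).mul
      (hasDerivAt_snd_slice hφ r z)
    exact h1.congr_deriv (by ring)
  · exact (cF.comp (by fun_prop : Continuous fun z : ℝ => (r, z))).intervalIntegrable _ _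

/-- A boundary identity valid for `C¹` functions carries over to `H¹` functions with a trace. -/
theorem HasTrace.integral_dr {v : H1 (layer R ρ Z)} {γ : ℝ → ℝ × ℝ} {a b : ℝ} {η : ℝ → ℂ}
    (hv : v.HasTrace γ (Ioo a b) η) (hγ : Continuous γ)
    (hη : MemLp η 2 (volume.restrict (Ioo a b))) {Q Q' : ℝ × ℝ → ℂ} {q : ℝ → ℂ}
    (hQ : Continuous Q) (hQ' : Continuous Q') (hq : Continuous q)
    (h : ∀ φ : ℝ × ℝ → ℂ, ContDiff ℝ 1 φ →
      ∫ p in layer R ρ Z, (Q p * fderiv ℝ φ p (1, 0) + Q' p * φ p) =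
        ∫ t in Ioo a b, q t * φ (γ t)) :
    ∫ p in layer R ρ Z, (Q p * v.dr p + Q' p * v.val p) = ∫ t in Ioo a b, q t * η t := by
  obtain ⟨φ, hφ, h0, h1, -, h3⟩ := hv
  have mQ := memLp_layer (R := R) (ρ := ρ) (Z := Z) hQ
  have mQ' := memLp_layer (R := R) (ρ := ρ) (Z := Z) hQ'
  have l0 := tendsto_integral_mul_of_eLpNorm mQ' (fun n => memLp_layer (hφ n).continuous)
    (Lp.memLp v.val) h0
  have l1 := tendsto_integral_mul_of_eLpNorm mQ
    (fun n => memLp_layer (continuous_fderiv_apply (hφ n) (1, 0))) (Lp.memLp v.dr) h1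
  have l3 := tendsto_integral_mul_of_eLpNorm (memLp_Ioo hq)
    (fun n => memLp_Ioo ((hφ n).continuous.comp hγ)) hη h3
  rw [integral_add (integrable_mul_of_memLp mQ (Lp.memLp _))
    (integrable_mul_of_memLp mQ' (Lp.memLp _))]
  refine tendsto_nhds_unique ((l1.add l0).congr fun n => ?_) l3
  rw [← integral_add (integrable_mul_of_memLp mQ (memLp_layer (continuous_fderiv_apply (hφ n) _)))
    (integrable_mul_of_memLp mQ' (memLp_layer (hφ n).continuous))]
  exact h _ (hφ n)

theorem HasTrace.integral_dz {v : H1 (layer R ρ Z)} {γ : ℝ → ℝ × ℝ} {a b : ℝ} {η : ℝ → ℂ}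
    (hv : v.HasTrace γ (Ioo a b) η) (hγ : Continuous γ)
    (hη : MemLp η 2 (volume.restrict (Ioo a b))) {Q Q' : ℝ × ℝ → ℂ} {q : ℝ → ℂ}
    (hQ : Continuous Q) (hQ' : Continuous Q') (hq : Continuous q)
    (h : ∀ φ : ℝ × ℝ → ℂ, ContDiff ℝ 1 φ →
      ∫ p in layer R ρ Z, (Q p * fderiv ℝ φ p (0, 1) + Q' p * φ p) =
        ∫ t in Ioo a b, q t * φ (γ t)) :
    ∫ p in layer R ρ Z, (Q p * v.dz p + Q' p * v.val p) = ∫ t in Ioo a b, q t * η t := by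
  obtain ⟨φ, hφ, h0, -, h1, h3⟩ := hv
  have mQ := memLp_layer (R := R) (ρ := ρ) (Z := Z) hQ
  have mQ' := memLp_layer (R := R) (ρ := ρ) (Z := Z) hQ'
  have l0 := tendsto_integral_mul_of_eLpNorm mQ' (fun n => memLp_layer (hφ n).continuous)
    (Lp.memLp v.val) h0
  have l1 := tendsto_integral_mul_of_eLpNorm mQ
    (fun n => memLp_layer (continuous_fderiv_apply (hφ n) (0, 1))) (Lp.memLp v.dz) h1
  have l3 := tendsto_integral_mul_of_eLpNorm (memLp_Ioo hq)
    (fun n => memLp_Ioo ((hφ n).continuous.comp hγ)) hη h3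
  rw [integral_add (integrable_mul_of_memLp mQ (Lp.memLp _))
    (integrable_mul_of_memLp mQ' (Lp.memLp _))]
  refine tendsto_nhds_unique ((l1.add l0).congr fun n => ?_) l3
  rw [← integral_add (integrable_mul_of_memLp mQ (memLp_layer (continuous_fderiv_apply (hφ n) _)))
    (integrable_mul_of_memLp mQ' (memLp_layer (hφ n).continuous))]
  exact h _ (hφ n)

theorem memLp_zero_fun {a b : ℝ} : MemLp (fun _ : ℝ => (0 : ℂ)) 2 (volume.restrict (Ioo a b)) :=
  memLp_Ioo continuous_const

/-- Green's formula in the direction of `r`. -/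
theorem HasDirichletData.integral_dr {v : H1 (layer R ρ Z)} {η : ℝ → ℂ}
    (hv : HasDirichletData v η) (hρ : R < ρ) (hη : MemLp η 2 (volume.restrict (Ioo 0 Z)))
    {g s : ℝ → ℂ} (hg : ContDiff ℝ 1 g) (hs : Continuous s) :
    ∫ p in layer R ρ Z, (g p.1 * s p.2 * v.dr p + deriv g p.1 * s p.2 * v.val p) =
      -(g R * ∫ z in Ioo 0 Z, s z * η z) := by
  have cg := hg.continuous
  have hd : ((ρ - R : ℝ) : ℂ) ≠ 0 := by exact_mod_cast (sub_pos.2 hρ).ne'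
  -- The traces on the two sides are realized by possibly different approximating sequences. The
  -- affine partition of unity `a + b = 1` splits `g` so that each half has a boundary term on one
  -- side only.
  let a : ℝ → ℂ := fun r => ((ρ - r : ℝ) : ℂ) / ((ρ - R : ℝ) : ℂ)
  let b : ℝ → ℂ := fun r => ((r - R : ℝ) : ℂ) / ((ρ - R : ℝ) : ℂ)
  have hab : ∀ r, a r + b r = 1 := fun r => by
    simp only [a, b]
    rw [← add_div, ← Complex.ofReal_add, show ρ - r + (r - R) = ρ - R by ring, div_self hd]
  have ca : ContDiff ℝ 1 a :=
    (Complex.ofRealCLM.contDiff.comp (contDiff_const.sub contDiff_id)).div_const _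
  have cb : ContDiff ℝ 1 b :=
    (Complex.ofRealCLM.contDiff.comp (contDiff_id.sub contDiff_const)).div_const _
  have cag : ContDiff ℝ 1 (a * g) := ca.mul hg
  have cbg : ContDiff ℝ 1 (b * g) := cb.mul hg
  have main : ∀ c : ℝ → ℂ, ContDiff ℝ 1 c → ∀ φ : ℝ × ℝ → ℂ, ContDiff ℝ 1 φ → _ :=
    fun c hc φ hφ => integral_layer_deriv_fst (Z := Z) hρ.le hc hs hφ
  have e1 := HasTrace.integral_dr hv.1 (by fun_prop) hη
    (Q := fun p => (a * g) p.1 * s p.2) (Q' := fun p => deriv (a * g) p.1 * s p.2)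
    (q := fun z => -(g R * s z))
    ((cag.continuous.comp continuous_fst).mul (hs.comp continuous_snd))
    (((cag.continuous_deriv le_rfl).comp continuous_fst).mul (hs.comp continuous_snd))
    (by fun_prop) fun φ hφ => by
      rw [main _ cag φ hφ]
      refine integral_congr_ae (ae_of_all _ fun z => ?_)
      have h1 : a ρ = 0 := by simp [a]
      have h2 : a R = 1 := by simp only [a]; exact div_self hd
      simp only [Pi.mul_apply, h1, h2]
      ring
  have e2 := HasTrace.integral_dr hv.2.1 (by fun_prop) memLp_zero_fun
    (Q := fun p => (b * g) p.1 * s p.2) (Q' := fun p => deriv (b * g) p.1 * s p.2)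
    (q := fun z => g ρ * s z)
    ((cbg.continuous.comp continuous_fst).mul (hs.comp continuous_snd))
    (((cbg.continuous_deriv le_rfl).comp continuous_fst).mul (hs.comp continuous_snd))
    (by fun_prop) fun φ hφ => by
      rw [main _ cbg φ hφ]
      refine integral_congr_ae (ae_of_all _ fun z => ?_)
      have h1 : b R = 0 := by simp [b]
      have h2 : b ρ = 1 := by simp only [b]; exact div_self hd
      simp only [Pi.mul_apply, h1, h2]
      ring
  have hsum : ∀ r, deriv (a * g) r + deriv (b * g) r = deriv g r := fun r => by
    rw [← deriv_add (cag.differentiable (by norm_num) r) (cbg.differentiable (by norm_num) r)]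
    congr 1
    ext x
    simp only [Pi.add_apply, Pi.mul_apply]
    rw [← add_mul, hab, one_mul]
  have i1 : ∀ c : ℝ → ℂ, ContDiff ℝ 1 c → Integrable (fun p : ℝ × ℝ => c p.1 * s p.2 * v.dr p +
      deriv c p.1 * s p.2 * v.val p) (volume.restrict (layer R ρ Z)) := fun c hc =>
    (integrable_mul_of_memLp (memLp_layer ((hc.continuous.comp continuous_fst).mul
      (hs.comp continuous_snd))) (Lp.memLp _)).add
    (integrable_mul_of_memLp (memLp_layer (((hc.continuous_deriv le_rfl).comp
      continuous_fst).mul (hs.comp continuous_snd))) (Lp.memLp _))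
  have e3 := congrArg₂ (· + ·) e1 e2
  rw [← integral_add (i1 _ cag) (i1 _ cbg)] at e3
  simp only [mul_zero, integral_zero, add_zero] at e3
  rw [← integral_const_mul, ← integral_neg]
  refine Eq.trans (integral_congr_ae (ae_of_all _ fun p => ?_)) (e3.trans
    (integral_congr_ae (ae_of_all _ fun z => ?_)))
  · simp only [Pi.mul_apply]
    rw [← hsum]
    linear_combination -(g p.1 * s p.2 * v.dr p) * hab p.1
  · simp only; ring

/-- Green's formula in the direction of `z`. -/
theorem HasDirichletData.integral_dz {v : H1 (layer R ρ Z)} {η : ℝ → ℂ}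
    (hv : HasDirichletData v η) (hZ : 0 < Z)
    {g s : ℝ → ℂ} (hg : Continuous g) (hs : ContDiff ℝ 1 s) :
    ∫ p in layer R ρ Z, (g p.1 * s p.2 * v.dz p + g p.1 * deriv s p.2 * v.val p) = 0 := by
  have cs := hs.continuous
  have hd : (Z : ℂ) ≠ 0 := by exact_mod_cast hZ.ne'
  -- The same splitting, now between the sides `z = 0` and `z = Z`.
  let a : ℝ → ℂ := fun z => ((Z - z : ℝ) : ℂ) / Z
  let b : ℝ → ℂ := fun z => (z : ℂ) / Z
  have hab : ∀ r, a r + b r = 1 := fun r => by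
    simp only [a, b]
    rw [← add_div, ← Complex.ofReal_add, sub_add_cancel, div_self hd]
  have ca : ContDiff ℝ 1 a :=
    (Complex.ofRealCLM.contDiff.comp (contDiff_const.sub contDiff_id)).div_const _
  have cb : ContDiff ℝ 1 b := Complex.ofRealCLM.contDiff.div_const _
  have cag : ContDiff ℝ 1 (a * s) := ca.mul hs
  have cbg : ContDiff ℝ 1 (b * s) := cb.mul hs
  have main : ∀ c : ℝ → ℂ, ContDiff ℝ 1 c → ∀ φ : ℝ × ℝ → ℂ, ContDiff ℝ 1 φ → _ :=
    fun c hc φ hφ => integral_layer_deriv_snd (R := R) (ρ := ρ) hZ.le hg hc hφ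
  have e1 := HasTrace.integral_dz hv.2.2.1 (by fun_prop) memLp_zero_fun
    (Q := fun p => g p.1 * (a * s) p.2) (Q' := fun p => g p.1 * deriv (a * s) p.2)
    (q := fun r => -(s 0 * g r))
    ((hg.comp continuous_fst).mul (cag.continuous.comp continuous_snd))
    ((hg.comp continuous_fst).mul ((cag.continuous_deriv le_rfl).comp continuous_snd))
    (by fun_prop) fun φ hφ => by
      rw [main _ cag φ hφ]
      refine integral_congr_ae (ae_of_all _ fun z => ?_)
      have h1 : a Z = 0 := by simp [a]
      have h2 : a 0 = 1 := by simp [a, hd]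
      simp only [Pi.mul_apply, h1, h2]
      ring
  have e2 := HasTrace.integral_dz hv.2.2.2 (by fun_prop) memLp_zero_fun
    (Q := fun p => g p.1 * (b * s) p.2) (Q' := fun p => g p.1 * deriv (b * s) p.2)
    (q := fun r => s Z * g r)
    ((hg.comp continuous_fst).mul (cbg.continuous.comp continuous_snd))
    ((hg.comp continuous_fst).mul ((cbg.continuous_deriv le_rfl).comp continuous_snd))
    (by fun_prop) fun φ hφ => by
      rw [main _ cbg φ hφ]
      refine integral_congr_ae (ae_of_all _ fun z => ?_)
      have h1 : b 0 = 0 := by simp [b]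
      have h2 : b Z = 1 := by simp only [b]; exact div_self hd
      simp only [Pi.mul_apply, h1, h2]
      ring
  have hsum : ∀ r, deriv (a * s) r + deriv (b * s) r = deriv s r := fun r => by
    rw [← deriv_add (cag.differentiable (by norm_num) r) (cbg.differentiable (by norm_num) r)]
    congr 1
    ext x
    simp only [Pi.add_apply, Pi.mul_apply]
    rw [← add_mul, hab, one_mul]
  have i1 : ∀ c : ℝ → ℂ, ContDiff ℝ 1 c → Integrable (fun p : ℝ × ℝ => g p.1 * c p.2 * v.dz p +
      g p.1 * deriv c p.2 * v.val p) (volume.restrict (layer R ρ Z)) := fun c hc =>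
    (integrable_mul_of_memLp (memLp_layer ((hg.comp continuous_fst).mul
      (hc.continuous.comp continuous_snd))) (Lp.memLp _)).add
    (integrable_mul_of_memLp (memLp_layer ((hg.comp continuous_fst).mul
      ((hc.continuous_deriv le_rfl).comp continuous_snd))) (Lp.memLp _))
  have e3 := congrArg₂ (· + ·) e1 e2
  rw [← integral_add (i1 _ cag) (i1 _ cbg)] at e3
  simp only [mul_zero, integral_zero, add_zero] at e3
  refine Eq.trans (integral_congr_ae (ae_of_all _ fun p => ?_)) e3
  simp only [Pi.mul_apply]
  rw [← hsum]
  linear_combination -(g p.1 * s p.2 * v.dz p) * hab p.2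

end Green

/-! ### Construction of elements of `H¹`, and the form tested with separable functions -/

section Construction

variable {R ρ Z : ℝ}

theorem integral_mul_fderiv_layer {φ ψ : ℝ × ℝ → ℂ} (hφ : ContDiff ℝ 1 φ) (hψ : ContDiff ℝ ∞ ψ)
    (hc : HasCompactSupport ψ) (hs : tsupport ψ ⊆ layer R ρ Z) (e : ℝ × ℝ) :
    ∫ p in layer R ρ Z, φ p * fderiv ℝ ψ p e = -∫ p in layer R ρ Z, fderiv ℝ φ p e * ψ p := by
  have hψ1 : ContDiff ℝ 1 ψ := hψ.of_le (by exact_mod_cast le_top)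
  have cφ := hφ.continuous
  have cφ' := continuous_fderiv_apply hφ e
  have cψ := hψ.continuous
  have cψ' := continuous_fderiv_apply hψ1 e
  have z0 : ∀ p, p ∉ layer R ρ Z → ψ p = 0 := fun p hp =>
    image_eq_zero_of_notMem_tsupport fun h => hp (hs h)
  have z1 : ∀ p, p ∉ layer R ρ Z → fderiv ℝ ψ p e = 0 := fun p hp => by
    rw [fderiv_of_notMem_tsupport ℝ fun h => hp (hs h)]; simp
  have hc' : HasCompactSupport fun p => fderiv ℝ ψ p e := hc.fderiv_apply (𝕜 := ℝ) e
  rw [setIntegral_eq_integral_of_forall_compl_eq_zero fun p hp => by rw [z1 p hp, mul_zero],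
    setIntegral_eq_integral_of_forall_compl_eq_zero fun p hp => by rw [z0 p hp, mul_zero]]
  exact integral_mul_fderiv_eq_neg_fderiv_mul_of_integrable
    ((cφ'.mul cψ).integrable_of_hasCompactSupport hc.mul_left)
    ((cφ.mul cψ').integrable_of_hasCompactSupport hc'.mul_left)
    ((cφ.mul cψ).integrable_of_hasCompactSupport hc.mul_left)
    (fun x _ => hφ.differentiable (by norm_num) x)
    (fun x _ => hψ1.differentiable (by norm_num) x)

/-- For a fixed test function, integration by parts is an identity between `L²` pairings and hence
stable under `L²` limits. -/
theorem isWeakDeriv_of_tendsto {φ : ℕ → ℝ × ℝ → ℂ} (hφ : ∀ n, ContDiff ℝ 1 (φ n)) {e : ℝ × ℝ}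
    {U V : Lp ℂ 2 (volume.restrict (layer R ρ Z))}
    (h0 : Tendsto (fun n => eLpNorm (fun p => φ n p - U p) 2 (volume.restrict (layer R ρ Z)))
      atTop (𝓝 0))
    (h1 : Tendsto (fun n => eLpNorm (fun p => fderiv ℝ (φ n) p e - V p) 2
      (volume.restrict (layer R ρ Z))) atTop (𝓝 0)) :
    IsWeakDeriv (layer R ρ Z) e U V := by
  intro ψ hψ hc hs
  have hψ1 : ContDiff ℝ 1 ψ := hψ.of_le (by exact_mod_cast le_top)
  have l0 := tendsto_integral_mul_of_eLpNorm (memLp_layer (continuous_fderiv_apply hψ1 e))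
    (fun n => memLp_layer (hφ n).continuous) (Lp.memLp U) h0
  have l1 := tendsto_integral_mul_of_eLpNorm (memLp_layer hψ.continuous)
    (fun n => memLp_layer (continuous_fderiv_apply (hφ n) e)) (Lp.memLp V) h1
  simp_rw [mul_comm (U _), mul_comm (V _)]
  refine tendsto_nhds_unique l0 (l1.neg.congr fun n => ?_)
  have := integral_mul_fderiv_layer (hφ n) hψ hc hs e
  simp_rw [mul_comm (φ n _), mul_comm (fderiv ℝ (φ n) _ _)] at this
  exact this.symm

/-- The limit in `H¹` of a sequence of `C¹` functions. -/
def H1.ofTendsto (φ : ℕ → ℝ × ℝ → ℂ) (hφ : ∀ n, ContDiff ℝ 1 (φ n))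
    (U V W : Lp ℂ 2 (volume.restrict (layer R ρ Z)))
    (h0 : Tendsto (fun n => eLpNorm (fun p => φ n p - U p) 2 (volume.restrict (layer R ρ Z)))
      atTop (𝓝 0))
    (h1 : Tendsto (fun n => eLpNorm (fun p => fderiv ℝ (φ n) p (1, 0) - V p) 2
      (volume.restrict (layer R ρ Z))) atTop (𝓝 0))
    (h2 : Tendsto (fun n => eLpNorm (fun p => fderiv ℝ (φ n) p (0, 1) - W p) 2
      (volume.restrict (layer R ρ Z))) atTop (𝓝 0)) : H1 (layer R ρ Z) where
  val := U
  dr := V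
  dz := W
  weak_dr := isWeakDeriv_of_tendsto hφ h0 h1
  weak_dz := isWeakDeriv_of_tendsto hφ h0 h2

theorem eLpNorm_sub_toLp {f : ℝ × ℝ → ℂ} (hf : MemLp f 2 (volume.restrict (layer R ρ Z))) :
    eLpNorm (fun p => f p - hf.toLp f p) 2 (volume.restrict (layer R ρ Z)) = 0 := by
  have : (fun p => f p - hf.toLp f p) =ᵐ[volume.restrict (layer R ρ Z)] 0 := by
    filter_upwards [hf.coeFn_toLp] with p hp
    rw [hp, sub_self]; rfl
  rw [eLpNorm_congr_ae this, eLpNorm_zero]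

/-- A `C¹` function as an element of `H¹`. -/
noncomputable def H1.ofContDiff (R ρ Z : ℝ) {φ : ℝ × ℝ → ℂ} (hφ : ContDiff ℝ 1 φ) :
    H1 (layer R ρ Z) :=
  H1.ofTendsto (fun _ => φ) (fun _ => hφ) ((memLp_layer hφ.continuous).toLp _)
    ((memLp_layer (continuous_fderiv_apply hφ (1, 0))).toLp _)
    ((memLp_layer (continuous_fderiv_apply hφ (0, 1))).toLp _)
    (by simp_rw [eLpNorm_sub_toLp]; exact tendsto_const_nhds)
    (by simp_rw [eLpNorm_sub_toLp]; exact tendsto_const_nhds)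
    (by simp_rw [eLpNorm_sub_toLp]; exact tendsto_const_nhds)

theorem H1.hasTrace_ofContDiff {φ : ℝ × ℝ → ℂ} (hφ : ContDiff ℝ 1 φ) {γ : ℝ → ℝ × ℝ} {I : Set ℝ}
    {g : ℝ → ℂ} (h : ∀ t, φ (γ t) = g t) : (H1.ofContDiff R ρ Z hφ).HasTrace γ I g := by
  refine ⟨fun _ => φ, fun _ => hφ, ?_, ?_, ?_, ?_⟩
  · change Tendsto (fun _ : ℕ => eLpNorm (fun p => φ p -
      (memLp_layer hφ.continuous).toLp φ p) 2 (volume.restrict (layer R ρ Z))) atTop (𝓝 0)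
    rw [eLpNorm_sub_toLp]; exact tendsto_const_nhds
  · change Tendsto (fun _ : ℕ => eLpNorm (fun p => fderiv ℝ φ p (1, 0) -
      (memLp_layer (continuous_fderiv_apply hφ (1, 0))).toLp _ p) 2
      (volume.restrict (layer R ρ Z))) atTop (𝓝 0)
    rw [eLpNorm_sub_toLp]; exact tendsto_const_nhds
  · change Tendsto (fun _ : ℕ => eLpNorm (fun p => fderiv ℝ φ p (0, 1) -
      (memLp_layer (continuous_fderiv_apply hφ (0, 1))).toLp _ p) 2
      (volume.restrict (layer R ρ Z))) atTop (𝓝 0)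
    rw [eLpNorm_sub_toLp]; exact tendsto_const_nhds
  · simp [h]

theorem eq_of_forall_integral_test {U V : Lp ℂ 2 (volume.restrict (layer R ρ Z))}
    (h : ∀ ψ : ℝ × ℝ → ℂ, ContDiff ℝ ∞ ψ → HasCompactSupport ψ → tsupport ψ ⊆ layer R ρ Z →
      ∫ p in layer R ρ Z, U p * ψ p = ∫ p in layer R ρ Z, V p * ψ p) : U = V := by
  have iU := (Lp.memLp U).integrable (by norm_num : (1 : ENNReal) ≤ 2)
  have iV := (Lp.memLp V).integrable (by norm_num : (1 : ENNReal) ≤ 2)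
  have key := (isOpen_layer R ρ Z).ae_eq_zero_of_integral_contDiff_smul_eq_zero (μ := volume)
    (f := fun p => U p - V p) (IntegrableOn.locallyIntegrableOn (iU.sub iV))
    fun g hg hc hs => by
      have hψ : ContDiff ℝ ∞ fun p => (g p : ℂ) := Complex.ofRealCLM.contDiff.comp hg
      have hcψ : HasCompactSupport fun p => (g p : ℂ) :=
        hc.comp_left (g := fun x : ℝ => (x : ℂ)) Complex.ofReal_zero
      have hsψ : tsupport (fun p => (g p : ℂ)) ⊆ layer R ρ Z :=
        (closure_mono (Function.support_comp_subset (g := fun x : ℝ => (x : ℂ))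
          Complex.ofReal_zero g)).trans hs
      have h1 := h _ hψ hcψ hsψ
      have mψ := memLp_layer (R := R) (ρ := ρ) (Z := Z) hψ.continuous
      have h2 : ∫ p in layer R ρ Z, g p • (U p - V p) = 0 := by
        rw [← sub_eq_zero, ← integral_sub (integrable_mul_of_memLp (Lp.memLp U) mψ)
          (integrable_mul_of_memLp (Lp.memLp V) mψ)] at h1
        rw [← h1]
        refine integral_congr_ae (ae_of_all _ fun p => ?_)
        simp only [Complex.real_smul]
        ring
      rwa [setIntegral_eq_integral_of_forall_compl_eq_zero fun p hp => by
        rw [image_eq_zero_of_notMem_tsupport fun h => hp (hs h), zero_smul]] at h2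
  refine Lp.ext ?_
  filter_upwards [(ae_restrict_iff' (measurableSet_layer R ρ Z)).2 key] with p hp
  exact sub_eq_zero.1 hp

/-- An element of `H¹` is determined by its class in `L²`. -/
theorem H1.ext_val {w₁ w₂ : H1 (layer R ρ Z)} (h : w₁.val = w₂.val) : w₁ = w₂ := by
  have h1 : w₁.dr = w₂.dr := eq_of_forall_integral_test fun ψ hψ hc hs => by
    have e1 := w₁.weak_dr ψ hψ hc hs
    rw [h, w₂.weak_dr ψ hψ hc hs] at e1
    exact (neg_injective e1).symm
  have h2 : w₁.dz = w₂.dz := eq_of_forall_integral_test fun ψ hψ hc hs => by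
    have e1 := w₁.weak_dz ψ hψ hc hs
    rw [h, w₂.weak_dz ψ hψ hc hs] at e1
    exact (neg_injective e1).symm
  cases w₁; cases w₂
  simp only at h h1 h2
  subst h h1 h2
  rfl

/-- By Fubini, for each `m` the sine coefficient of the slice `D(r, ·)` vanishes for almost every
`r`. There are countably many `m`, so almost every slice has all coefficients zero and vanishes by
completeness of the sines. -/
theorem ae_eq_zero_of_forall_integral_mul_mode (hZ : 0 < Z) {D : ℝ × ℝ → ℂ}
    (hD : Integrable D (volume.restrict (layer R ρ Z)))
    (h : ∀ (f : ℝ → ℝ) (m : ℕ), Continuous f → 1 ≤ m →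
      ∫ p in layer R ρ Z, (f p.1 : ℂ) * sinMode Z m p.2 * D p = 0) :
    D =ᵐ[volume.restrict (layer R ρ Z)] 0 := by
  have hD' := hD
  rw [restrict_layer] at hD'
  have bdd : ∀ (m : ℕ) (z : ℝ), ‖sinMode Z m z‖ ≤ 1 := fun m z => by
    rw [sinMode, Complex.norm_real]; exact Real.abs_sin_le_one _
  have iD : ∀ m : ℕ, Integrable (fun p : ℝ × ℝ => D p * sinMode Z m p.2)
      ((volume.restrict (Ioo R ρ)).prod (volume.restrict (Ioo 0 Z))) := fun m =>
    hD'.mul_bdd (c := 1) ((continuous_sinMode Z m).comp continuous_snd).aestronglyMeasurable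
      (ae_of_all _ fun p => bdd m p.2)
  have h1 : ∀ m : ℕ, 1 ≤ m → ∀ᵐ r ∂(volume.restrict (Ioo R ρ)),
      ∫ z in Ioo 0 Z, D (r, z) * sinMode Z m z = 0 := fun m hm => by
    refine ae_eq_zero_of_forall_integral_mul_continuous (iD m).integral_prod_left fun f hf => ?_
    rw [← h f m hf hm, restrict_layer]
    have i2 : Integrable (fun p : ℝ × ℝ => (f p.1 : ℂ) * sinMode Z m p.2 * D p)
        ((volume.restrict (Ioo R ρ)).prod (volume.restrict (Ioo 0 Z))) := by
      obtain ⟨C, hC⟩ := isCompact_Icc.exists_bound_of_continuousOn (hf.continuousOn (s := Icc R ρ))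
      have i3 : Integrable (fun p : ℝ × ℝ => D p * sinMode Z m p.2 * (f p.1 : ℂ))
          ((volume.restrict (Ioo R ρ)).prod (volume.restrict (Ioo 0 Z))) := by
        refine (iD m).mul_bdd (c := C) (by fun_prop) ?_
        rw [← restrict_layer]
        filter_upwards [ae_restrict_mem (measurableSet_layer R ρ Z)] with p hp
        rw [Complex.norm_real]
        exact hC _ (Ioo_subset_Icc_self hp.1)
      exact i3.congr (ae_of_all _ fun p => by ring)
    rw [integral_prod _ i2]
    refine integral_congr_ae (ae_of_all _ fun r => ?_)
    simp only
    rw [← integral_mul_const]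
    refine integral_congr_ae (ae_of_all _ fun z => ?_)
    ring
  have h2 : ∀ᵐ r ∂(volume.restrict (Ioo R ρ)), ∀ m : ℕ, 1 ≤ m →
      ∫ z in Ioo 0 Z, D (r, z) * sinMode Z m z = 0 :=
    ae_all_iff.2 fun m => by
      by_cases hm : 1 ≤ m
      · filter_upwards [h1 m hm] with r hr _ using hr
      · exact ae_of_all _ fun r hm' => absurd hm' hm
  have h3 : ∫ p, ‖D p‖ ∂((volume.restrict (Ioo R ρ)).prod (volume.restrict (Ioo 0 Z))) = 0 := by
    rw [integral_prod _ hD'.norm]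
    refine integral_eq_zero_of_ae ?_
    filter_upwards [h2, hD'.prod_right_ae] with r hr hi
    have h4 := ae_eq_zero_of_forall_integral_mul_sin hZ hi hr
    refine integral_eq_zero_of_ae ?_
    filter_upwards [h4] with z hz
    simpa using hz
  rw [restrict_layer]
  have h5 := (integral_eq_zero_iff_of_nonneg (fun p => norm_nonneg _) hD'.norm).1 h3
  filter_upwards [h5] with p hp
  simpa using hp

theorem contDiff_separable {g s : ℝ → ℂ} (hg : ContDiff ℝ 1 g) (hs : ContDiff ℝ 1 s) :
    ContDiff ℝ 1 fun p : ℝ × ℝ => g p.1 * s p.2 :=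
  (hg.comp contDiff_fst).mul (hs.comp contDiff_snd)

theorem fderiv_separable_fst {g s : ℝ → ℂ} (hg : ContDiff ℝ 1 g) (hs : ContDiff ℝ 1 s)
    (p : ℝ × ℝ) : fderiv ℝ (fun p : ℝ × ℝ => g p.1 * s p.2) p (1, 0) = deriv g p.1 * s p.2 :=
  (hasDerivAt_fst_slice (contDiff_separable hg hs) p.1 p.2).unique
    ((hg.differentiable (by norm_num) p.1).hasDerivAt.mul_const (s p.2))

theorem fderiv_separable_snd {g s : ℝ → ℂ} (hg : ContDiff ℝ 1 g) (hs : ContDiff ℝ 1 s)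
    (p : ℝ × ℝ) : fderiv ℝ (fun p : ℝ × ℝ => g p.1 * s p.2) p (0, 1) = g p.1 * deriv s p.2 :=
  (hasDerivAt_snd_slice (contDiff_separable hg hs) p.1 p.2).unique
    ((hs.differentiable (by norm_num) p.2).hasDerivAt.const_mul (g p.1))

theorem contDiff_star_comp {g : ℝ → ℂ} (hg : ContDiff ℝ 1 g) :
    ContDiff ℝ 1 fun r => star (g r) :=
  Complex.conjCLE.contDiff.comp hg

theorem deriv_star_comp {g : ℝ → ℂ} (hg : ContDiff ℝ 1 g) (r : ℝ) :
    deriv (fun r => star (g r)) r = star (deriv g r) :=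
  ((hg.differentiable (by norm_num) r).hasDerivAt.star).deriv

/-- The mass coefficient, extended continuously to the left of `R`. -/
noncomputable def massCoeffExt (χ₀ R r : ℝ) : ℂ := massCoeff χ₀ R (max r R)

theorem continuous_massCoeffExt {χ₀ R : ℝ} (hχ : 0 ≤ χ₀) (hR : 0 < R) :
    Continuous (massCoeffExt χ₀ R) :=
  (continuousOn_massCoeff hχ hR).comp_continuous (by fun_prop) fun x => mem_Ici.2 (le_max_right x R)

theorem massCoeffExt_of_le {χ₀ R r : ℝ} (h : R ≤ r) : massCoeffExt χ₀ R r = massCoeff χ₀ R r := by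
  rw [massCoeffExt, max_eq_left h]

theorem weight_mul_alpha {χ₀ R r : ℝ} (hr : r ≠ 0) :
    1 / ((r : ℂ) * beta χ₀ R r) * alpha χ₀ R r = massCoeff χ₀ R r := by
  have : (r : ℂ) ≠ 0 := by exact_mod_cast hr
  rw [beta, mul_div_cancel₀ _ this, massCoeff]
  ring

theorem weight_mul_alpha_inv {χ₀ R r : ℝ} (hr : r ≠ 0) :
    1 / ((r : ℂ) * beta χ₀ R r) * (alpha χ₀ R r)⁻¹ = (fluxCoeff χ₀ R r)⁻¹ := by
  have : (r : ℂ) ≠ 0 := by exact_mod_cast hr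
  rw [beta, mul_div_cancel₀ _ this, fluxCoeff, mul_inv]
  ring

theorem deriv_sinMode (Z : ℝ) (m : ℕ) (z : ℝ) :
    deriv (sinMode Z m) z = (m * Real.pi / Z : ℝ) * cosMode Z m z :=
  (hasDerivAt_sinMode Z m z).deriv

theorem contDiff_cosMode (Z : ℝ) (m : ℕ) : ContDiff ℝ 1 (cosMode Z m) := by
  unfold cosMode
  exact Complex.ofRealCLM.contDiff.comp (Real.contDiff_cos.comp (by fun_prop))

/-- The form of an element of `H¹` with Dirichlet data, tested with a separable function. -/
theorem HasDirichletData.integral_mode {k : ℝ} {w : H1 (layer R ρ Z)} {η f g q : ℝ → ℂ} {m : ℕ}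
    (hw : HasDirichletData w η) (hρ : R < ρ) (hZ : 0 < Z)
    (hη : MemLp η 2 (volume.restrict (Ioo 0 Z))) (hq : ContDiff ℝ 1 q) (hg : Continuous g)
    (hf : Continuous f) (h : ∀ r ∈ Icc R ρ, HasDerivAt q (sep k Z m * g r + f r) r) :
    ∫ p in layer R ρ Z, (q p.1 * sinMode Z m p.2 * w.dr p +
        g p.1 * ((m * Real.pi / Z : ℝ) * cosMode Z m p.2) * w.dz p -
        (k : ℂ) ^ 2 * (g p.1 * sinMode Z m p.2) * w.val p) =
      -(q R * ∫ z in Ioo 0 Z, sinMode Z m z * η z) -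
        ∫ p in layer R ρ Z, f p.1 * sinMode Z m p.2 * w.val p := by
  have cs := continuous_sinMode Z m
  have cc := (contDiff_const (c := ((m * Real.pi / Z : ℝ) : ℂ))).mul (contDiff_cosMode Z m)
  have e1 := hw.integral_dr hρ hη hq cs
  -- Differentiating `(mπ/Z) cos` once more yields `-(mπ/Z)² sin`, which cancels the corresponding
  -- part of `q' = ((mπ/Z)² - k²) g + f`; only the terms with `k²` and `f` multiply `w` itself.
  have e2 := hw.integral_dz hZ hg cc
  have i1 : Integrable (fun p : ℝ × ℝ => q p.1 * sinMode Z m p.2 * w.dr p +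
      deriv q p.1 * sinMode Z m p.2 * w.val p) (volume.restrict (layer R ρ Z)) :=
    (integrable_mul_of_memLp (memLp_layer ((hq.continuous.comp continuous_fst).mul
      (cs.comp continuous_snd))) (Lp.memLp _)).add
    (integrable_mul_of_memLp (memLp_layer (((hq.continuous_deriv le_rfl).comp
      continuous_fst).mul (cs.comp continuous_snd))) (Lp.memLp _))
  have i2 : Integrable (fun p : ℝ × ℝ =>
      g p.1 * (((m * Real.pi / Z : ℝ) : ℂ) * cosMode Z m p.2) * w.dz p +
      g p.1 * deriv (fun z => ((m * Real.pi / Z : ℝ) : ℂ) * cosMode Z m z) p.2 * w.val p)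
      (volume.restrict (layer R ρ Z)) :=
    (integrable_mul_of_memLp (memLp_layer (R := R) (ρ := ρ) (Z := Z)
      ((hg.comp continuous_fst).mul (cc.continuous.comp continuous_snd))) (Lp.memLp w.dz)).add
    (integrable_mul_of_memLp (memLp_layer (R := R) (ρ := ρ) (Z := Z) ((hg.comp continuous_fst).mul
      ((cc.continuous_deriv le_rfl).comp continuous_snd))) (Lp.memLp w.val))
  have i12 := i1.add i2
  simp only [Pi.add_def] at i12
  have i3 : Integrable (fun p : ℝ × ℝ => f p.1 * sinMode Z m p.2 * w.val p)
      (volume.restrict (layer R ρ Z)) :=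
    integrable_mul_of_memLp (memLp_layer ((hf.comp continuous_fst).mul (cs.comp continuous_snd)))
      (Lp.memLp _)
  have e3 := congrArg₂ (· - ·) (congrArg₂ (· + ·) e1 e2)
    (rfl : ∫ p in layer R ρ Z, f p.1 * sinMode Z m p.2 * w.val p = _)
  rw [add_zero, ← integral_add i1 i2, ← integral_sub i12 i3] at e3
  rw [← e3]
  refine integral_congr_ae ?_
  filter_upwards [ae_restrict_mem (measurableSet_layer R ρ Z)] with p hp
  have hd : deriv q p.1 = sep k Z m * g p.1 + f p.1 := (h p.1 (Ioo_subset_Icc_self hp.1)).deriv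
  have hd2 : deriv (fun z => ((m * Real.pi / Z : ℝ) : ℂ) * cosMode Z m z) p.2 =
      -(((m * Real.pi / Z) ^ 2 : ℝ) : ℂ) * sinMode Z m p.2 := by
    rw [((hasDerivAt_cosMode Z m p.2).const_mul _).deriv]
    push_cast
    ring
  have hsep : (sep k Z m : ℂ) = (((m * Real.pi / Z) ^ 2 : ℝ) : ℂ) - (k : ℂ) ^ 2 := by
    rw [sep]; push_cast; ring
  rw [hd, hd2, hsep]
  ring

end Construction

/-! ### Uniqueness -/

section Uniqueness

variable {R ρ Z : ℝ}

theorem IsMode.deriv_fst {χ₀ l r : ℝ} {f w p : ℝ → ℂ} (h : IsMode χ₀ R ρ l f w p)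
    (hr : r ∈ Icc R ρ) : deriv w r = fluxCoeff χ₀ R r * p r :=
  (h.hasDerivAt_fst r hr).deriv

/-- The form tested with the conjugate of a separable function. -/
theorem form_ofContDiff {k χ₀ : ℝ} (hχ : 0 < χ₀) (hR : 0 < R) {l : ℝ} {f ψ q : ℝ → ℂ} {m : ℕ}
    (h : IsMode χ₀ R ρ l f ψ q) (w : H1 (layer R ρ Z)) :
    form k χ₀ w (H1.ofContDiff R ρ Z
      (contDiff_separable (contDiff_star_comp h.contDiff_fst) (contDiff_sinMode Z m))) =
    ∫ p in layer R ρ Z, (q p.1 * sinMode Z m p.2 * w.dr p +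
        massCoeffExt χ₀ R p.1 * ψ p.1 * ((m * Real.pi / Z : ℝ) * cosMode Z m p.2) * w.dz p -
        (k : ℂ) ^ 2 * (massCoeffExt χ₀ R p.1 * ψ p.1 * sinMode Z m p.2) * w.val p) := by
  have hφ := contDiff_separable (contDiff_star_comp h.contDiff_fst) (contDiff_sinMode Z m)
  refine integral_congr_ae ?_
  filter_upwards [(memLp_layer (R := R) (ρ := ρ) (Z := Z) hφ.continuous).coeFn_toLp,
    (memLp_layer (R := R) (ρ := ρ) (Z := Z) (continuous_fderiv_apply hφ (1, 0))).coeFn_toLp,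
    (memLp_layer (R := R) (ρ := ρ) (Z := Z) (continuous_fderiv_apply hφ (0, 1))).coeFn_toLp,
    ae_restrict_mem (measurableSet_layer R ρ Z)] with p h0 h1 h2 hp
  have hr : p.1 ∈ Icc R ρ := Ioo_subset_Icc_self hp.1
  have hr0 : p.1 ≠ 0 := (hR.trans_le hr.1).ne'
  have e0 : (H1.ofContDiff R ρ Z hφ).val p = star (ψ p.1) * sinMode Z m p.2 := h0
  have e1 : (H1.ofContDiff R ρ Z hφ).dr p =
      star (fluxCoeff χ₀ R p.1 * q p.1) * sinMode Z m p.2 := by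
    refine h1.trans ?_
    rw [fderiv_separable_fst (contDiff_star_comp h.contDiff_fst) (contDiff_sinMode Z m),
      deriv_star_comp h.contDiff_fst, h.deriv_fst hr]
  have e2 : (H1.ofContDiff R ρ Z hφ).dz p =
      star (ψ p.1) * ((m * Real.pi / Z : ℝ) * cosMode Z m p.2) := by
    refine h2.trans ?_
    rw [fderiv_separable_snd (contDiff_star_comp h.contDiff_fst) (contDiff_sinMode Z m),
      deriv_sinMode]
  have hsin : star (sinMode Z m p.2) = sinMode Z m p.2 := star_sinMode Z m p.2
  have hcos : star (((m * Real.pi / Z : ℝ) : ℂ) * cosMode Z m p.2) =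
      ((m * Real.pi / Z : ℝ) : ℂ) * cosMode Z m p.2 := by
    rw [cosMode, ← Complex.ofReal_mul]; exact Complex.conj_ofReal _
  -- The weight of the radial term is `1/G` and the radial derivative of the mode is `G q`, so only
  -- the `C¹` flux `q` remains.
  have hflux : (fluxCoeff χ₀ R p.1)⁻¹ * fluxCoeff χ₀ R p.1 = 1 :=
    inv_mul_cancel₀ (fluxCoeff_ne_zero hχ.le hR hr.1)
  rw [e0, e1, e2]
  rw [star_mul' (star (fluxCoeff χ₀ R p.1 * q p.1)), star_mul' (star (ψ p.1)),
    star_mul' (star (ψ p.1)), star_star, star_star, hsin, hcos,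
    massCoeffExt_of_le hr.1, ← weight_mul_alpha hr0]
  rw [← weight_mul_alpha_inv hr0] at hflux
  linear_combination (q p.1 * sinMode Z m p.2 * w.dr p) * hflux

/-- Duality. The operator is complex symmetric, so the modal problem with source `f`, conjugated,
serves as the adjoint problem: testing with it expresses `∫ f sin (mπz/Z) w` through `η` alone. -/
theorem IsSolution.unique {k χ₀ : ℝ} (hk : 0 ≤ k) (hZ : 0 < Z) (hR : 0 < R)
    (hχ : 0 < χ₀) (hκ : 1 ≤ kappa k Z * χ₀ * R) (hρ : 2 * R ≤ ρ) {η : ℝ → ℂ}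
    (hη : MemLp η 2 (volume.restrict (Ioo 0 Z))) {w₁ w₂ : H1 (layer R ρ Z)}
    (h₁ : IsSolution k χ₀ η w₁) (h₂ : IsSolution k χ₀ η w₂) : w₁ = w₂ := by
  have hRρ : R < ρ := by linarith
  have i1 := (Lp.memLp w₁.val).integrable (by norm_num : (1 : ENNReal) ≤ 2)
  have i2 := (Lp.memLp w₂.val).integrable (by norm_num : (1 : ENNReal) ≤ 2)
  have key := ae_eq_zero_of_forall_integral_mul_mode hZ (i1.sub i2) fun f m hf hm => by
    have hfc : Continuous fun r => (f r : ℂ) := Complex.continuous_ofReal.comp hf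
    obtain ⟨ψ, q, h, hψR, hψρ⟩ :=
      exists_isMode_dirichlet hk hZ hR hχ hκ hρ hm (f := fun r => (f r : ℂ)) hfc.continuousOn 0
    have hv : HasDirichletData (H1.ofContDiff R ρ Z (contDiff_separable
        (contDiff_star_comp h.contDiff_fst) (contDiff_sinMode Z m))) (fun _ => 0) :=
      ⟨H1.hasTrace_ofContDiff _ fun z => by simp [hψR],
        H1.hasTrace_ofContDiff _ fun z => by simp [hψρ],
        H1.hasTrace_ofContDiff _ fun r => by simp [sinMode_zero_right],
        H1.hasTrace_ofContDiff _ fun r => by simp [sinMode_right hZ]⟩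
    have main : ∀ w : H1 (layer R ρ Z), IsSolution k χ₀ η w →
        ∫ p in layer R ρ Z, (f p.1 : ℂ) * sinMode Z m p.2 * w.val p =
          -(q R * ∫ z in Ioo 0 Z, sinMode Z m z * η z) := fun w hw => by
      have e1 := hw.1 _ hv
      rw [form_ofContDiff hχ hR h, hw.2.integral_mode
        (g := fun r => massCoeffExt χ₀ R r * ψ r) hRρ hZ hη h.contDiff_flux
        ((continuous_massCoeffExt hχ.le hR).mul h.contDiff_fst.continuous) hfc fun r hr =>
        (h.hasDerivAt_flux r hr).congr_deriv (by rw [massCoeffExt_of_le hr.1]; ring)] at e1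
      linear_combination -e1
    have i0 : ∀ w : H1 (layer R ρ Z), Integrable (fun p : ℝ × ℝ =>
        (f p.1 : ℂ) * sinMode Z m p.2 * w.val p) (volume.restrict (layer R ρ Z)) := fun w =>
      integrable_mul_of_memLp (memLp_layer ((hfc.comp continuous_fst).mul
        ((continuous_sinMode Z m).comp continuous_snd))) (Lp.memLp _)
    simp_rw [Pi.sub_apply, mul_sub]
    rw [integral_sub (i0 w₁) (i0 w₂), main w₁ h₁, main w₂ h₂, sub_self]
  refine H1.ext_val (Lp.ext ?_)
  filter_upwards [key] with p hp
  exact sub_eq_zero.1 hp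

end Uniqueness

/-! ### Orthogonal series of separable functions -/

theorem exists_hasSum_of_pairwise_orthogonal {E : Type*} [NormedAddCommGroup E]
    [InnerProductSpace ℂ E] [CompleteSpace E] {T : ℕ → E}
    (h : Pairwise fun m n => inner ℂ (T m) (T n) = 0) (hs : Summable fun m => ‖T m‖ ^ 2) :
    ∃ U, HasSum T U ∧ HasSum (fun m => ‖T m‖ ^ 2) (‖U‖ ^ 2) := by
  -- The spans of the `T m` are used since some of these vectors may vanish and cannot be
  -- normalized.
  have hV : OrthogonalFamily ℂ (fun m => (ℂ ∙ T m : Submodule ℂ E))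
      fun m => (ℂ ∙ T m : Submodule ℂ E).subtypeₗᵢ := fun m n hmn v w => by
    obtain ⟨a, ha⟩ := Submodule.mem_span_singleton.1 v.2
    obtain ⟨b, hb⟩ := Submodule.mem_span_singleton.1 w.2
    change inner ℂ (v : E) (w : E) = 0
    rw [← ha, ← hb, inner_smul_left, inner_smul_right, h hmn, mul_zero, mul_zero]
  let t : ∀ m, (ℂ ∙ T m : Submodule ℂ E) := fun m => ⟨T m, Submodule.mem_span_singleton_self _⟩
  obtain ⟨U, hU⟩ := (hV.summable_iff_norm_sq_summable t).2 hs
  have hU' : HasSum T U := hU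
  refine ⟨U, hU', ?_⟩
  have h1 : Tendsto (fun s : Finset ℕ => ‖∑ m ∈ s, T m‖ ^ 2) atTop (𝓝 (‖U‖ ^ 2)) :=
    (hU'.norm).pow 2
  exact h1.congr fun s => hV.norm_sum t s

section Series

variable {R ρ Z : ℝ}

theorem integral_norm_sq_eq_intervalIntegral (hρ : R ≤ ρ) (G : ℝ → ℂ) :
    ∫ r in Ioo R ρ, star (G r) * G r = ((∫ r in R..ρ, ‖G r‖ ^ 2 : ℝ) : ℂ) := by
  rw [intervalIntegral.integral_of_le hρ, integral_Ioc_eq_integral_Ioo,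
    ← integral_complex_ofReal]
  refine integral_congr_ae (ae_of_all _ fun r => ?_)
  have := Complex.conj_mul' (G r)
  simp only [RCLike.star_def]
  rw [this]
  norm_cast

/-- Convergence of a series of separable functions that are orthogonal in the second variable. -/
theorem exists_tendsto_series {s : ℝ} (hρ : R ≤ ρ) {G S : ℕ → ℝ → ℂ} (hG : ∀ m, Continuous (G m))
    (hS : ∀ m, Continuous (S m)) (hstar : ∀ m z, star (S m z) = S m z)
    (horth : ∀ m n, ∫ z in Ioo 0 Z, S m z * S n z = if m = n then (s : ℂ) else 0)
    (hsum : Summable fun m => s * ∫ r in R..ρ, ‖G m r‖ ^ 2) :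
    ∃ U : Lp ℂ 2 (volume.restrict (layer R ρ Z)),
      Tendsto (fun N => eLpNorm (fun p : ℝ × ℝ =>
        (∑ m ∈ Finset.range N, G m p.1 * S m p.2) - U p) 2 (volume.restrict (layer R ρ Z)))
        atTop (𝓝 0) ∧
      HasSum (fun m => s * ∫ r in R..ρ, ‖G m r‖ ^ 2) (‖U‖ ^ 2) := by
  have mT : ∀ m, MemLp (fun p : ℝ × ℝ => G m p.1 * S m p.2) 2 (volume.restrict (layer R ρ Z)) :=
    fun m => memLp_layer (((hG m).comp continuous_fst).mul ((hS m).comp continuous_snd))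
  let T : ℕ → Lp ℂ 2 (volume.restrict (layer R ρ Z)) := fun m => (mT m).toLp _
  have hT : ∀ m, T m =ᵐ[volume.restrict (layer R ρ Z)] fun p : ℝ × ℝ => G m p.1 * S m p.2 :=
    fun m => (mT m).coeFn_toLp
  have hinner : ∀ m n, inner ℂ (T m) (T n) =
      (∫ r in Ioo R ρ, star (G m r) * G n r) * if m = n then (s : ℂ) else 0 := fun m n => by
    rw [L2.inner_def, ← horth, ← integral_prod_mul, ← restrict_layer]
    refine integral_congr_ae ?_
    filter_upwards [hT m, hT n] with p h1 h2
    rw [h1, h2, RCLike.inner_apply, starRingEnd_apply, star_mul', hstar]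
    ring
  have hnorm : ∀ m, ‖T m‖ ^ 2 = s * ∫ r in R..ρ, ‖G m r‖ ^ 2 := fun m => by
    have h1 := hinner m m
    rw [if_pos rfl, integral_norm_sq_eq_intervalIntegral hρ, inner_self_eq_norm_sq_to_K] at h1
    have h2 : ((‖T m‖ ^ 2 : ℝ) : ℂ) = ((s * ∫ r in R..ρ, ‖G m r‖ ^ 2 : ℝ) : ℂ) := by
      push_cast
      rw [mul_comm]
      exact h1
    exact_mod_cast h2
  simp_rw [← hnorm] at hsum ⊢
  obtain ⟨U, hU, hU2⟩ := exists_hasSum_of_pairwise_orthogonal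
    (T := T) (fun m n hmn => (hinner m n).trans (by rw [if_neg hmn, mul_zero])) hsum
  refine ⟨U, ?_, hU2⟩
  have h1 := hU.tendsto_sum_nat
  rw [Lp.tendsto_Lp_iff_tendsto_eLpNorm'] at h1
  refine h1.congr fun N => eLpNorm_congr_ae ?_
  filter_upwards [ae_all_iff.2 hT, Lp.coeFn_finsetSum (Finset.range N) T] with p h1 h2
  simp only [Pi.sub_apply]
  rw [h2, Finset.sum_apply]
  simp only [h1]

end Series

/-! ### Existence -/

section Existence

variable {R ρ Z : ℝ}

/-- The partial sums of the series solution with coefficients `a` and radial profiles `u`. -/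
noncomputable def partialSum (Z : ℝ) (a : ℕ → ℂ) (u : ℕ → ℝ → ℂ) (N : ℕ) (p : ℝ × ℝ) : ℂ :=
  ∑ m ∈ Finset.range N, a m * u m p.1 * sinMode Z (m + 1) p.2

section PartialSum

variable {a : ℕ → ℂ} {u : ℕ → ℝ → ℂ}

theorem contDiff_coeff_mul (hu : ∀ m, ContDiff ℝ 1 (u m)) (m : ℕ) :
    ContDiff ℝ 1 fun r => a m * u m r :=
  contDiff_const.mul (hu m)

theorem contDiff_partialSum (hu : ∀ m, ContDiff ℝ 1 (u m)) (N : ℕ) :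
    ContDiff ℝ 1 (partialSum Z a u N) :=
  ContDiff.sum fun m _ => contDiff_separable (contDiff_coeff_mul hu m) (contDiff_sinMode Z (m + 1))

theorem fderiv_partialSum (hu : ∀ m, ContDiff ℝ 1 (u m)) (N : ℕ) (p e : ℝ × ℝ) :
    fderiv ℝ (partialSum Z a u N) p e = ∑ m ∈ Finset.range N,
      fderiv ℝ (fun p : ℝ × ℝ => a m * u m p.1 * sinMode Z (m + 1) p.2) p e := by
  have : partialSum Z a u N = fun p => ∑ m ∈ Finset.range N,
    a m * u m p.1 * sinMode Z (m + 1) p.2 := rfl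
  rw [this, fderiv_fun_sum fun m _ => (contDiff_separable (contDiff_coeff_mul hu m)
    (contDiff_sinMode Z (m + 1))).differentiable (by norm_num) p]
  simp only [sum_apply]

theorem fderiv_partialSum_fst (hu : ∀ m, ContDiff ℝ 1 (u m)) (N : ℕ) (p : ℝ × ℝ) :
    fderiv ℝ (partialSum Z a u N) p (1, 0) = ∑ m ∈ Finset.range N,
      a m * deriv (u m) p.1 * sinMode Z (m + 1) p.2 := by
  rw [fderiv_partialSum hu]
  refine Finset.sum_congr rfl fun m _ => ?_
  rw [fderiv_separable_fst (contDiff_coeff_mul hu m) (contDiff_sinMode Z (m + 1)),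
    ((((hu m).differentiable (by norm_num) p.1).hasDerivAt).const_mul (a m)).deriv]

theorem fderiv_partialSum_snd (hu : ∀ m, ContDiff ℝ 1 (u m)) (N : ℕ) (p : ℝ × ℝ) :
    fderiv ℝ (partialSum Z a u N) p (0, 1) = ∑ m ∈ Finset.range N,
      a m * ((m + 1 : ℕ) * Real.pi / Z : ℝ) * u m p.1 * cosMode Z (m + 1) p.2 := by
  rw [fderiv_partialSum hu]
  refine Finset.sum_congr rfl fun m _ => ?_
  rw [fderiv_separable_snd (contDiff_coeff_mul hu m) (contDiff_sinMode Z (m + 1)), deriv_sinMode]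
  ring

end PartialSum

/-- The inverse of the flux coefficient, extended continuously to the left of `R`. -/
noncomputable def fluxCoeffInvExt (χ₀ R r : ℝ) : ℂ := (fluxCoeff χ₀ R (max r R))⁻¹

theorem continuous_fluxCoeffInvExt {χ₀ R : ℝ} (hχ : 0 ≤ χ₀) (hR : 0 < R) :
    Continuous (fluxCoeffInvExt χ₀ R) :=
  ((continuous_fluxCoeff χ₀ R).comp (by fun_prop : Continuous fun r : ℝ => max r R)).inv₀
    fun r => fluxCoeff_ne_zero hχ hR (le_max_right r R)

theorem fluxCoeffInvExt_of_le {χ₀ R r : ℝ} (h : R ≤ r) :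
    fluxCoeffInvExt χ₀ R r = (fluxCoeff χ₀ R r)⁻¹ := by
  rw [fluxCoeffInvExt, max_eq_left h]

theorem memLp_mul_star {g : ℝ → ℂ} (hg : Continuous g) {v : ℝ × ℝ → ℂ}
    (hv : MemLp v 2 (volume.restrict (layer R ρ Z))) :
    MemLp (fun p => g p.1 * star (v p)) 2 (volume.restrict (layer R ρ Z)) := by
  obtain ⟨C, hC⟩ := isCompact_Icc.exists_bound_of_continuousOn (hg.continuousOn (s := Icc R ρ))
  refine hv.of_le_mul (c := C) ((hg.comp continuous_fst).aestronglyMeasurable.mul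
    (continuous_star.comp_aestronglyMeasurable hv.1)) ?_
  filter_upwards [ae_restrict_mem (measurableSet_layer R ρ Z)] with p hp
  rw [norm_mul, norm_star]
  exact mul_le_mul_of_nonneg_right (hC _ (Ioo_subset_Icc_self hp.1)) (norm_nonneg _)

/-- The integrand of the form, in terms of the coefficients extended continuously. -/
theorem form_eq {k χ₀ : ℝ} (hR : 0 < R) (w v : H1 (layer R ρ Z)) :
    form k χ₀ w v = ∫ p in layer R ρ Z, (fluxCoeffInvExt χ₀ R p.1 * star (v.dr p) * w.dr p +
      massCoeffExt χ₀ R p.1 * star (v.dz p) * w.dz p +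
      -(k : ℂ) ^ 2 * massCoeffExt χ₀ R p.1 * star (v.val p) * w.val p) := by
  refine integral_congr_ae ?_
  filter_upwards [ae_restrict_mem (measurableSet_layer R ρ Z)] with p hp
  have hr : R ≤ p.1 := hp.1.1.le
  have hr0 : p.1 ≠ 0 := (hR.trans_le hr).ne'
  rw [massCoeffExt_of_le hr, fluxCoeffInvExt_of_le hr, ← weight_mul_alpha hr0,
    ← weight_mul_alpha_inv hr0]
  ring

/-- For fixed `v` the form is linear in `w`, with coefficients in `L²` because the weights are
bounded on the layer. -/
theorem tendsto_form {k χ₀ : ℝ} (hχ : 0 ≤ χ₀) (hR : 0 < R) (w v : H1 (layer R ρ Z))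
    {φ : ℕ → ℝ × ℝ → ℂ} (hφ : ∀ n, ContDiff ℝ 1 (φ n))
    (h0 : Tendsto (fun n => eLpNorm (fun p => φ n p - w.val p) 2
      (volume.restrict (layer R ρ Z))) atTop (𝓝 0))
    (h1 : Tendsto (fun n => eLpNorm (fun p => fderiv ℝ (φ n) p (1, 0) - w.dr p) 2
      (volume.restrict (layer R ρ Z))) atTop (𝓝 0))
    (h2 : Tendsto (fun n => eLpNorm (fun p => fderiv ℝ (φ n) p (0, 1) - w.dz p) 2
      (volume.restrict (layer R ρ Z))) atTop (𝓝 0)) :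
    Tendsto (fun n => ∫ p in layer R ρ Z,
      (fluxCoeffInvExt χ₀ R p.1 * star (v.dr p) * fderiv ℝ (φ n) p (1, 0) +
      massCoeffExt χ₀ R p.1 * star (v.dz p) * fderiv ℝ (φ n) p (0, 1) +
      -(k : ℂ) ^ 2 * massCoeffExt χ₀ R p.1 * star (v.val p) * φ n p)) atTop
      (𝓝 (form k χ₀ w v)) := by
  have m1 := memLp_mul_star (continuous_fluxCoeffInvExt hχ hR) (Lp.memLp v.dr)
  have m2 := memLp_mul_star (continuous_massCoeffExt hχ hR) (Lp.memLp v.dz)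
  have m0 := memLp_mul_star (g := fun r => -(k : ℂ) ^ 2 * massCoeffExt χ₀ R r)
    (continuous_const.mul (continuous_massCoeffExt hχ hR)) (Lp.memLp v.val)
  have n0 := fun n => memLp_layer (R := R) (ρ := ρ) (Z := Z) (hφ n).continuous
  have n1 := fun n => memLp_layer (R := R) (ρ := ρ) (Z := Z) (continuous_fderiv_apply (hφ n) (1, 0))
  have n2 := fun n => memLp_layer (R := R) (ρ := ρ) (Z := Z) (continuous_fderiv_apply (hφ n) (0, 1))
  have split : ∀ F₁ F₂ F₀ : ℝ × ℝ → ℂ, MemLp F₁ 2 (volume.restrict (layer R ρ Z)) →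
      MemLp F₂ 2 (volume.restrict (layer R ρ Z)) → MemLp F₀ 2 (volume.restrict (layer R ρ Z)) →
      ∫ p in layer R ρ Z, (fluxCoeffInvExt χ₀ R p.1 * star (v.dr p) * F₁ p +
        massCoeffExt χ₀ R p.1 * star (v.dz p) * F₂ p +
        -(k : ℂ) ^ 2 * massCoeffExt χ₀ R p.1 * star (v.val p) * F₀ p) =
      (∫ p in layer R ρ Z, fluxCoeffInvExt χ₀ R p.1 * star (v.dr p) * F₁ p) +
        (∫ p in layer R ρ Z, massCoeffExt χ₀ R p.1 * star (v.dz p) * F₂ p) +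
        ∫ p in layer R ρ Z, -(k : ℂ) ^ 2 * massCoeffExt χ₀ R p.1 * star (v.val p) * F₀ p :=
    fun F₁ F₂ F₀ f1 f2 f0 => by
      have i1 := integrable_mul_of_memLp m1 f1
      have i2 := integrable_mul_of_memLp m2 f2
      have i12 := i1.add i2
      simp only [Pi.add_def] at i12
      rw [integral_add i12 (integrable_mul_of_memLp m0 f0), integral_add i1 i2]
  rw [form_eq hR, split _ _ _ (Lp.memLp _) (Lp.memLp _) (Lp.memLp _)]
  simp_rw [fun n => split _ _ _ (n1 n) (n2 n) (n0 n)]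
  exact ((tendsto_integral_mul_of_eLpNorm m1 n1 (Lp.memLp _) h1).add
    (tendsto_integral_mul_of_eLpNorm m2 n2 (Lp.memLp _) h2)).add
    (tendsto_integral_mul_of_eLpNorm m0 n0 (Lp.memLp _) h0)

/-- A mode satisfies the equation weakly. -/
theorem IsMode.integral_star_eq_zero {k χ₀ : ℝ} {u p : ℝ → ℂ} {m : ℕ} (hχ : 0 < χ₀) (hR : 0 < R)
    (hρ : R < ρ) (hZ : 0 < Z) (h : IsMode χ₀ R ρ (sep k Z m) 0 u p) {v : H1 (layer R ρ Z)}
    (hv : HasDirichletData v fun _ => 0) :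
    ∫ x in layer R ρ Z, star (star (p x.1) * sinMode Z m x.2 * v.dr x +
        star (massCoeffExt χ₀ R x.1 * u x.1) * ((m * Real.pi / Z : ℝ) * cosMode Z m x.2) * v.dz x -
        (k : ℂ) ^ 2 * (star (massCoeffExt χ₀ R x.1 * u x.1) * sinMode Z m x.2) * v.val x) = 0 := by
  -- The roles are exchanged: Green's formula is applied to the test function `v`, and the
  -- conjugated mode supplies the coefficients. Conjugation keeps `q' = l g` because `l` is real,
  -- and the zero data of `v` remove the boundary term.
  have e := hv.integral_mode (k := k) (m := m) (f := fun _ => 0)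
    (g := fun r => star (massCoeffExt χ₀ R r * u r)) hρ hZ memLp_zero_fun
    (contDiff_star_comp h.contDiff_flux)
    (continuous_star.comp ((continuous_massCoeffExt hχ.le hR).mul h.contDiff_fst.continuous))
    continuous_const fun r hr => (h.hasDerivAt_flux r hr).star.congr_deriv (by
      rw [massCoeffExt_of_le hr.1, Pi.zero_apply, add_zero, add_zero, mul_assoc, star_mul' (_ : ℂ)]
      congr 1
      exact Complex.conj_ofReal _)
  simp only [mul_zero, zero_mul, integral_zero, neg_zero, sub_zero] at e
  refine (integral_conj (𝕜 := ℂ)).trans ?_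
  rw [e, map_zero]

theorem integral_partialSum_eq_zero {k χ₀ : ℝ} {a : ℕ → ℂ} {u p : ℕ → ℝ → ℂ} (hχ : 0 < χ₀)
    (hR : 0 < R) (hρ : R < ρ) (hZ : 0 < Z)
    (h : ∀ m, IsMode χ₀ R ρ (sep k Z (m + 1)) 0 (u m) (p m)) {v : H1 (layer R ρ Z)}
    (hv : HasDirichletData v fun _ => 0) (N : ℕ) :
    ∫ x in layer R ρ Z,
      (fluxCoeffInvExt χ₀ R x.1 * star (v.dr x) * fderiv ℝ (partialSum Z a u N) x (1, 0) +
      massCoeffExt χ₀ R x.1 * star (v.dz x) * fderiv ℝ (partialSum Z a u N) x (0, 1) +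
      -(k : ℂ) ^ 2 * massCoeffExt χ₀ R x.1 * star (v.val x) * partialSum Z a u N x) = 0 := by
  have hu := fun m => (h m).contDiff_fst
  -- `J m` is the conjugate of the integrand of the form for the `m`-th mode without its coefficient
  -- `a m`.
  let J : ℕ → ℝ × ℝ → ℂ := fun m x => star (p m x.1) * sinMode Z (m + 1) x.2 * v.dr x +
        star (massCoeffExt χ₀ R x.1 * u m x.1) *
          (((m + 1 : ℕ) * Real.pi / Z : ℝ) * cosMode Z (m + 1) x.2) * v.dz x -
        (k : ℂ) ^ 2 * (star (massCoeffExt χ₀ R x.1 * u m x.1) * sinMode Z (m + 1) x.2) * v.val x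
  have hJ0 : ∀ m, ∫ x in layer R ρ Z, star (J m x) = 0 := fun m =>
    (h m).integral_star_eq_zero hχ hR hρ hZ hv
  have hJ : ∀ m, Integrable (J m) (volume.restrict (layer R ρ Z)) := fun m => by
    have c1 := (continuous_star.comp (h m).contDiff_flux.continuous).comp
      (continuous_fst (X := ℝ) (Y := ℝ))
    have c2 := (continuous_star.comp ((continuous_massCoeffExt hχ.le hR).mul
      (hu m).continuous)).comp (continuous_fst (X := ℝ) (Y := ℝ))
    have c3 := (continuous_sinMode Z (m + 1)).comp (continuous_snd (X := ℝ) (Y := ℝ))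
    have c4 := (continuous_const (y := (((m + 1 : ℕ) * Real.pi / Z : ℝ) : ℂ))).mul
      ((continuous_cosMode Z (m + 1)).comp (continuous_snd (X := ℝ) (Y := ℝ)))
    exact ((integrable_mul_of_memLp (memLp_layer (c1.mul c3)) (Lp.memLp v.dr)).add
      (integrable_mul_of_memLp (memLp_layer (c2.mul c4)) (Lp.memLp v.dz))).sub
      (integrable_mul_of_memLp (memLp_layer (continuous_const.mul (c2.mul c3))) (Lp.memLp v.val))
  have hI : ∀ m, Integrable (fun x => a m * star (J m x)) (volume.restrict (layer R ρ Z)) :=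
    fun m => (Complex.conjCLE.toContinuousLinearMap.integrable_comp (hJ m)).const_mul (a m)
  have hsum : ∫ x in layer R ρ Z, ∑ m ∈ Finset.range N, a m * star (J m x) = 0 := by
    rw [integral_finsetSum _ fun m _ => hI m]
    refine Finset.sum_eq_zero fun m _ => ?_
    rw [integral_const_mul, hJ0, mul_zero]
  rw [← hsum]
  refine integral_congr_ae ?_
  filter_upwards [ae_restrict_mem (measurableSet_layer R ρ Z)] with x hx
  have hr : x.1 ∈ Icc R ρ := Ioo_subset_Icc_self hx.1
  rw [fderiv_partialSum_fst hu, fderiv_partialSum_snd hu, partialSum, Finset.mul_sum,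
    Finset.mul_sum, Finset.mul_sum, ← Finset.sum_add_distrib, ← Finset.sum_add_distrib]
  refine Finset.sum_congr rfl fun m _ => ?_
  have hflux : fluxCoeffInvExt χ₀ R x.1 * fluxCoeff χ₀ R x.1 = 1 := by
    rw [fluxCoeffInvExt_of_le hr.1]
    exact inv_mul_cancel₀ (fluxCoeff_ne_zero hχ.le hR hr.1)
  have hsin : star (sinMode Z (m + 1) x.2) = sinMode Z (m + 1) x.2 := star_sinMode _ _ _
  have hcos : star (cosMode Z (m + 1) x.2) = cosMode Z (m + 1) x.2 := Complex.conj_ofReal _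
  have hc : star (((m + 1 : ℕ) * Real.pi / Z : ℝ) : ℂ) = (((m + 1 : ℕ) * Real.pi / Z : ℝ) : ℂ) :=
    Complex.conj_ofReal _
  have hk : star (k : ℂ) = (k : ℂ) := Complex.conj_ofReal _
  rw [(h m).deriv_fst hr]
  simp only [J, star_add, star_sub, star_mul', star_star, star_pow, hsin, hcos, hc, hk]
  linear_combination (a m * p m x.1 * star (v.dr x) * sinMode Z (m + 1) x.2) * hflux

/-- The series solution of the Dirichlet problem. -/
theorem exists_isSolution {k χ₀ B : ℝ} {u p : ℕ → ℝ → ℂ} (hχ : 0 < χ₀)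
    (hR : 0 < R) (hρ : R < ρ) (hZ : 0 < Z)
    (h : ∀ m, IsMode χ₀ R ρ (sep k Z (m + 1)) 0 (u m) (p m)) (huR : ∀ m, u m R = 1)
    (huρ : ∀ m, u m ρ = 0)
    (hB : ∀ m : ℕ, (∫ r in R..ρ, ‖fluxCoeff χ₀ R r * p m r‖ ^ 2) +
      (1 + ((m + 1 : ℕ) * Real.pi / Z) ^ 2) * (∫ r in R..ρ, ‖u m r‖ ^ 2) ≤ B * (m + 1 : ℕ))
    {η : Lp ℂ 2 (volume.restrict (Ioo (0 : ℝ) Z))} (hη : η ∈ HalfSpace Z) :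
    ∃ w : H1 (layer R ρ Z), IsSolution k χ₀ η w ∧
      ‖w.val‖ ^ 2 + ‖w.dr‖ ^ 2 + ‖w.dz‖ ^ 2 ≤ Z / 2 * B * halfNorm Z η ^ 2 := by
  have hu := fun m => (h m).contDiff_fst
  obtain ⟨a, ha⟩ : ∃ a : ℕ → ℂ, ∀ m, a m = sineCoeff Z η (m + 1) := ⟨_, fun _ => rfl⟩
  obtain ⟨c, hc⟩ : ∃ c : ℕ → ℝ, ∀ m, c m = (m + 1 : ℕ) * Real.pi / Z := ⟨_, fun _ => rfl⟩
  obtain ⟨E, hE⟩ : ∃ E : ℕ → ℝ, ∀ m, E m = ∫ r in R..ρ, ‖fluxCoeff χ₀ R r * p m r‖ ^ 2 :=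
    ⟨_, fun _ => rfl⟩
  obtain ⟨F, hF⟩ : ∃ F : ℕ → ℝ, ∀ m, F m = ∫ r in R..ρ, ‖u m r‖ ^ 2 := ⟨_, fun _ => rfl⟩
  simp_rw [← hE, ← hF, ← hc] at hB
  have hE0 : ∀ m, 0 ≤ E m := fun m => by
    rw [hE]; exact intervalIntegral.integral_nonneg hρ.le fun r _ => sq_nonneg _
  have hF0 : ∀ m, 0 ≤ F m := fun m => by
    rw [hF]; exact intervalIntegral.integral_nonneg hρ.le fun r _ => sq_nonneg _
  have i0 : ∀ m, ∫ r in R..ρ, ‖a m * u m r‖ ^ 2 = ‖a m‖ ^ 2 * F m := fun m => by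
    rw [hF, ← intervalIntegral.integral_const_mul]
    simp_rw [norm_mul, mul_pow]
  have i1 : ∀ m, ∫ r in R..ρ, ‖a m * deriv (u m) r‖ ^ 2 = ‖a m‖ ^ 2 * E m := fun m => by
    rw [hE, ← intervalIntegral.integral_const_mul]
    refine intervalIntegral.integral_congr fun r hr => ?_
    rw [uIcc_of_le hρ.le] at hr
    rw [(h m).deriv_fst hr, norm_mul (a m), mul_pow]
  have i2 : ∀ m, ∫ r in R..ρ, ‖a m * c m * u m r‖ ^ 2 = ‖a m‖ ^ 2 * (c m ^ 2 * F m) := fun m => by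
    rw [hF, ← mul_assoc, ← intervalIntegral.integral_const_mul]
    simp_rw [norm_mul, mul_pow, Complex.norm_real, Real.norm_eq_abs, sq_abs]
  have hs : Summable fun m : ℕ => ((m + 1 : ℕ) : ℝ) * ‖a m‖ ^ 2 := by
    simp_rw [ha]
    exact (summable_nat_add_iff 1).2 hη
  -- The term with index `0` vanishes because of its weight, so the sum may start at the first mode.
  have hs_half : halfNorm Z η ^ 2 = ∑' m : ℕ, ((m + 1 : ℕ) : ℝ) * ‖a m‖ ^ 2 := by
    rw [halfNorm, Real.sq_sqrt (tsum_nonneg fun m => by positivity), Summable.tsum_eq_zero_add hη]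
    simp_rw [ha]
    simp
  have hsB := hs.mul_left (Z / 2 * B)
  -- The three summands are the contributions of one mode to the squared norms of `w`, `∂_r w` and
  -- `∂_z w`; `Z/2` is the squared norm of each sine and cosine.
  have hterm : ∀ m, Z / 2 * (‖a m‖ ^ 2 * F m) + Z / 2 * (‖a m‖ ^ 2 * E m) +
      Z / 2 * (‖a m‖ ^ 2 * (c m ^ 2 * F m)) ≤ Z / 2 * B * ((m + 1 : ℕ) * ‖a m‖ ^ 2) := fun m => by
    have : Z / 2 * ‖a m‖ ^ 2 * (E m + (1 + c m ^ 2) * F m) ≤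
        Z / 2 * ‖a m‖ ^ 2 * (B * (m + 1 : ℕ)) := mul_le_mul_of_nonneg_left (hB m) (by positivity)
    linarith
  have p0 : ∀ m, 0 ≤ Z / 2 * (‖a m‖ ^ 2 * F m) := fun m => by have := hF0 m; positivity
  have p1 : ∀ m, 0 ≤ Z / 2 * (‖a m‖ ^ 2 * E m) := fun m => by have := hE0 m; positivity
  have p2 : ∀ m, 0 ≤ Z / 2 * (‖a m‖ ^ 2 * (c m ^ 2 * F m)) := fun m => by
    have := hF0 m; positivity
  have hsin : ∀ m n : ℕ, ∫ z in Ioo 0 Z, sinMode Z (m + 1) z * sinMode Z (n + 1) z =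
      if m = n then ((Z / 2 : ℝ) : ℂ) else 0 := fun m n => by
    rw [integral_sinMode_mul hZ (by omega)]; simp only [add_left_inj]
  have hcos : ∀ m n : ℕ, ∫ z in Ioo 0 Z, cosMode Z (m + 1) z * cosMode Z (n + 1) z =
      if m = n then ((Z / 2 : ℝ) : ℂ) else 0 := fun m n => by
    rw [integral_cosMode_mul hZ (by omega)]; simp only [add_left_inj]
  obtain ⟨U, hU, hU2⟩ := exists_tendsto_series (Z := Z) (s := Z / 2) hρ.le
    (G := fun m r => a m * u m r) (S := fun m => sinMode Z (m + 1))
    (fun m => (contDiff_coeff_mul hu m).continuous) (fun m => continuous_sinMode Z (m + 1))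
    (fun m z => star_sinMode Z (m + 1) z) hsin (by
      simp_rw [i0]
      exact hsB.of_nonneg_of_le p0 fun m => by linarith [hterm m, p1 m, p2 m])
  obtain ⟨V, hV, hV2⟩ := exists_tendsto_series (Z := Z) (s := Z / 2) hρ.le
    (G := fun m r => a m * deriv (u m) r) (S := fun m => sinMode Z (m + 1))
    (fun m => continuous_const.mul ((hu m).continuous_deriv le_rfl))
    (fun m => continuous_sinMode Z (m + 1)) (fun m z => star_sinMode Z (m + 1) z) hsin (by
      simp_rw [i1]
      exact hsB.of_nonneg_of_le p1 fun m => by linarith [hterm m, p0 m, p2 m])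
  obtain ⟨W, hW, hW2⟩ := exists_tendsto_series (Z := Z) (s := Z / 2) hρ.le
    (G := fun m r => a m * c m * u m r) (S := fun m => cosMode Z (m + 1))
    (fun m => continuous_const.mul (hu m).continuous) (fun m => continuous_cosMode Z (m + 1))
    (fun m z => Complex.conj_ofReal _) hcos (by
      simp_rw [i2]
      exact hsB.of_nonneg_of_le p2 fun m => by linarith [hterm m, p0 m, p1 m])
  have cφ := fun N => contDiff_partialSum (Z := Z) (a := a) hu N
  have hV' : Tendsto (fun N => eLpNorm (fun x => fderiv ℝ (partialSum Z a u N) x (1, 0) - V x) 2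
      (volume.restrict (layer R ρ Z))) atTop (𝓝 0) := by
    simp_rw [fderiv_partialSum_fst hu]; exact hV
  have hW' : Tendsto (fun N => eLpNorm (fun x => fderiv ℝ (partialSum Z a u N) x (0, 1) - W x) 2
      (volume.restrict (layer R ρ Z))) atTop (𝓝 0) := by
    simp_rw [fderiv_partialSum_snd hu, ← hc]; exact hW
  let w : H1 (layer R ρ Z) := H1.ofTendsto (partialSum Z a u) cφ U V W hU hV' hW'
  -- The partial sums themselves realize all four traces; on the three homogeneous sides they vanish
  -- identically.
  have trace0 : ∀ (γ : ℝ → ℝ × ℝ) (I : Set ℝ), (∀ N t, partialSum Z a u N (γ t) = 0) →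
      w.HasTrace γ I fun _ => 0 := fun γ I hγ => by
    refine ⟨partialSum Z a u, cφ, hU, hV', hW', ?_⟩
    simp [hγ]
  refine ⟨w, ⟨fun v hv => ?_, ⟨partialSum Z a u, cφ, hU, hV', hW', ?_⟩,
    trace0 _ _ fun N t => ?_, trace0 _ _ fun N t => ?_, trace0 _ _ fun N t => ?_⟩, ?_⟩
  · have l := tendsto_form (k := k) hχ.le hR w v cφ hU hV' hW'
    simp_rw [integral_partialSum_eq_zero hχ hR hρ hZ h hv] at l
    exact tendsto_nhds_unique l tendsto_const_nhds
  · refine (tendsto_sine_series hZ η).congr fun N => ?_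
    simp only [partialSum, huR, ha, mul_one]
  · exact Finset.sum_eq_zero fun m _ => by simp [huρ]
  · exact Finset.sum_eq_zero fun m _ => by simp [sinMode_zero_right]
  · exact Finset.sum_eq_zero fun m _ => by simp [sinMode_right hZ]
  · change ‖U‖ ^ 2 + ‖V‖ ^ 2 + ‖W‖ ^ 2 ≤ _
    simp_rw [i0] at hU2
    simp_rw [i1] at hV2
    simp_rw [i2] at hW2
    rw [hs_half, ← hs.tsum_mul_left]
    exact hasSum_le hterm ((hU2.add hV2).add hW2) hsB.hasSum

end Existence

end PML

/-! ### The main theorem -/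

theorem theorem4p1 (k Z R : ℝ) (hk : 0 ≤ k) (hZ : 0 < Z) (hR : 0 < R)
    (hres : ∀ m : ℕ, 1 ≤ m → k ≠ m * Real.pi / Z) :
    ∃ C : ℝ, 0 < C ∧ ∀ χ₀ ρ : ℝ, 0 < χ₀ → 1 ≤ PML.kappa k Z * χ₀ * R → 2 * R ≤ ρ →
      ∀ η ∈ PML.HalfSpace Z,
        (∃! w : PML.H1 (PML.layer R ρ Z), PML.IsSolution k χ₀ η w) ∧
        ∀ w : PML.H1 (PML.layer R ρ Z), PML.IsSolution k χ₀ η w →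
          w.norm ≤ C * (ρ - R) ^ 6 * ‖PML.alpha χ₀ R ρ‖ ^ 4 * ‖PML.beta χ₀ R ρ‖ ^ 2 *
            PML.halfNorm Z η := by
  obtain ⟨C, hC0, hC⟩ := PML.exists_mode_bound hk hZ hR
  -- `Z/2 · C` bounds the squared norm; the factor `4` comes from `A² ≤ (2|β(ρ)|)²`.
  refine ⟨4 * √(Z / 2 * C), by positivity, fun χ₀ ρ hχ hκ hρ η hη => ?_⟩
  have hRρ : R < ρ := by linarith
  choose u p h huR huρ using fun m : ℕ => PML.exists_isMode_dirichlet hk hZ hR hχ hκ hρ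
    (m := m + 1) (by omega) (f := 0) continuousOn_const 1
  obtain ⟨A, hA⟩ : ∃ A, A = 1 + χ₀ * (ρ - R) := ⟨_, rfl⟩
  obtain ⟨w, hw, hwn⟩ := PML.exists_isSolution (B := C * ((ρ - R) ^ 12 * A ^ 12)) hχ hR hRρ hZ
    h huR huρ (fun m => by
      have := hC χ₀ ρ hχ hκ hρ (m + 1) (u m) (p m) (by omega) (h m) (huρ m)
      rw [huR, norm_one, one_pow, mul_one, ← hA] at this
      exact this) hη
  have huniq : ∀ w', PML.IsSolution k χ₀ η w' → w' = w := fun w' hw' =>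
    hw'.unique hk hZ hR hχ hκ hρ (Lp.memLp η) hw
  refine ⟨⟨w, hw, huniq⟩, fun w' hw' => ?_⟩
  rw [huniq w' hw']
  have hA0 : 0 ≤ A := by rw [hA]; have := mul_pos hχ (sub_pos.2 hRρ); linarith
  have hα : A ≤ ‖PML.alpha χ₀ R ρ‖ := hA ▸ PML.le_norm_alpha hχ.le hRρ.le
  have hβ : A ≤ 2 * ‖PML.beta χ₀ R ρ‖ := by
    have := PML.le_norm_beta hχ.le hR hρ
    rw [← hA] at this
    linarith
  have hd : 0 ≤ ρ - R := by linarith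
  have hn : 0 ≤ PML.halfNorm Z η := Real.sqrt_nonneg _
  calc w.norm ≤ √(Z / 2 * C) * ((ρ - R) ^ 6 * A ^ 6) * PML.halfNorm Z η := by
        refine Real.sqrt_le_iff.2 ⟨by positivity, hwn.trans_eq ?_⟩
        rw [mul_pow, mul_pow, Real.sq_sqrt (by positivity)]
        ring
    _ ≤ √(Z / 2 * C) * ((ρ - R) ^ 6 * (‖PML.alpha χ₀ R ρ‖ ^ 4 * (2 * ‖PML.beta χ₀ R ρ‖) ^ 2)) *
          PML.halfNorm Z η := by
        have : A ^ 6 ≤ ‖PML.alpha χ₀ R ρ‖ ^ 4 * (2 * ‖PML.beta χ₀ R ρ‖) ^ 2 := by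
          rw [show A ^ 6 = A ^ 4 * A ^ 2 by ring]
          exact mul_le_mul (pow_le_pow_left₀ hA0 hα 4) (pow_le_pow_left₀ hA0 hβ 2)
            (by positivity) (by positivity)
        gcongr
    _ = _ := by ring
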